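/- **Setting.** Repeated indices are summed over $1,2,3$; $A_{\langle ij\rangle}$, $A_{\langle ijk\rangle}$ denote symmetric trace-free parts. The unknowns are $\rho,\theta$ (scalars), $v_i,\bar q_i$ (vectors) and $\bar\sigma_{ij}$ (a symmetric trace-free tensor), functions of $(t,x)$. The linear R13 equations with Knudsen number $Kn>0$ and constants $k_0,\dots,k_{10},l_1,l_2$ are $$\partial_t\rho+\partial_jv_j=0,$$ $$\partial_t\theta+\tfrac23\partial_jv_j+\tfrac23k_0\,\partial_j\bar q_j-k_1Kn\,\Delta\theta+k_2Kn\,\partial_i\partial_j\bar\sigma_{ij}=0,$$ $$\partial_tv_i+\partial_i\rho+\partial_i\theta-k_3Kn\,\partial_j\partial_{\langle i}v_{j\rangle}-k_4Kn\,\partial_j\partial_{\langle i}\bar q_{j\rangle}+k_5\,\partial_j\bar\sigma_{ij}=0,$$ $$\partial_t\bar q_i+\tfrac52k_0\,\partial_i\theta-\tfrac52k_4Kn\,\partial_j\partial_{\langle i}v_{j\rangle}-2k_6Kn\,\partial_i\partial_j\bar q_j-\tfrac{12}5k_7Kn\,\partial_j\partial_{\langle i}\bar q_{j\rangle}+k_8\,\partial_j\bar\sigma_{ij}=-\tfrac{2l_1}{3Kn}\bar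 q_i,$$ $$\partial_t\bar\sigma_{ij}+3k_2Kn\,\partial_{\langle i}\partial_{j\rangle}\theta+2k_5\,\partial_{\langle i}v_{j\rangle}+\tfrac45k_8\,\partial_{\langle i}\bar q_{j\rangle}-2k_9Kn\,\partial_k\partial_{\langle k}\bar\sigma_{ij\rangle}-k_{10}Kn\,\partial_{\langle i}\partial_{|k|}\bar\sigma_{j\rangle k}=-\tfrac{l_2}{Kn}\bar\sigma_{ij}.$$ The entropy density is $H=H_0-\tfrac12\big(\rho^2+\tfrac32\theta^2+v_iv_i+\tfrac25\bar q_i\bar q_i+\tfrac12\bar\sigma_{ij}\bar\sigma_{ij}\big)$ with a constant $H_0$. **Boundary conditions.** At a boundary point let $(n,\tau_1,\tau_2)$ be an orthonormal frame with $n$ the outer unit normal; let $0\le\chi\le1$, $\tilde\chi=2\chi/(2-\chi)$, and let $\theta^W$, $v^W$ be the wall temperature and velocity. With constants $m_{ij}$, and for $i=1,2$ (derivative indices refer to the frame): $$v_n=0,$$ $$\bar q_n=\tilde\chi\big(m_{11}(\theta-\theta^W)+m_{12}\bar\sigma_{nn}-m_{13}Kn\,\partial_j\bar q_j-m_{14}Kn\,\partial_{\langle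 n}\bar q_{n\rangle}-m_{15}Kn\,\partial_{\langle n}v_{n\rangle}\big),$$ $$m_{26}\bar q_n+m_{27}Kn\,\partial_n\theta-m_{28}Kn\,\partial_j\bar\sigma_{nj}=\tilde\chi\big(-m_{21}(\theta-\theta^W)+m_{22}\bar\sigma_{nn}+m_{23}Kn\,\partial_j\bar q_j+m_{24}Kn\,\partial_{\langle n}\bar q_{n\rangle}+m_{25}Kn\,\partial_{\langle n}v_{n\rangle}\big),$$ $$\bar\sigma_{\tau_in}=\tilde\chi\big(m_{31}(v_{\tau_i}-v^W_{\tau_i})+m_{32}\bar q_{\tau_i}-m_{33}Kn\,\partial_j\bar\sigma_{\tau_ij}-m_{34}Kn\,\partial_{\langle n}\bar\sigma_{n\tau_i\rangle}+m_{35}Kn\,\partial_{\tau_i}\theta\big),$$ for $r=4,5$: $$m_{r6}\bar\sigma_{\tau_in}+m_{r7}Kn\,\partial_{\langle\tau_i}v_{n\rangle}+m_{r8}Kn\,\partial_{\langle\tau_i}\bar q_{n\rangle}=-\tilde\chi\big(-m_{r1}(v_{\tau_i}-v^W_{\tau_i})+m_{r2}\bar q_{\tau_i}+m_{r3}Kn\,\partial_j\bar\sigma_{\tau_ij}+m_{r4}Kn\,\partial_{\langle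 n}\bar\sigma_{n\tau_i\rangle}-m_{r5}Kn\,\partial_{\tau_i}\theta\big),$$ $$m_{66}\bar q_n+Kn\big(m_{67}\partial_{\langle n}\bar\sigma_{nn\rangle}+m_{68}\partial_j\bar\sigma_{nj}+m_{69}\partial_n\theta\big)=-\tilde\chi\big(-m_{61}(\theta-\theta^W)+m_{62}\bar\sigma_{nn}+m_{63}Kn\,\partial_j\bar q_j+m_{64}Kn\,\partial_{\langle n}\bar q_{n\rangle}+m_{65}Kn\,\partial_{\langle n}v_{n\rangle}\big),$$ $$Kn\big(\partial_{\langle\tau_i}\bar\sigma_{\tau_in\rangle}+\tfrac12\partial_{\langle n}\bar\sigma_{nn\rangle}\big)=-\tilde\chi m_{71}\big(\bar\sigma_{\tau_i\tau_i}+\tfrac12\bar\sigma_{nn}\big)\ (\text{no sum over } i),\qquad Kn\,\partial_{\langle\tau_1}\bar\sigma_{\tau_2n\rangle}=-\tilde\chi m_{81}\bar\sigma_{\tau_1\tau_2}.$$ **Assumption 1 (dissipative moment system).** The constants $k_i,l_i$ are those obtained by eliminating the second-order moments $u^2,u^2_i,u^3_i,u^1_{ij},u^2_{ij},u^0_{ijk}$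 (tensors symmetric and trace-free) from a linear system $$\partial_t\rho+\partial_jv_j=0,$$ $$\partial_t\theta+\tfrac23\partial_jv_j+\tfrac23c_{11}\partial_j\bar q_j-\sqrt{\tfrac{10}3}\,\partial_j(c_{21}u^2_j+c_{31}u^3_j)=0,$$ $$\partial_tv_i+\partial_i\rho+\partial_i\theta+c_{200}\partial_j\bar\sigma_{ij}+\sqrt{15}\,\partial_j(c_{210}u^1_{ij}+c_{220}u^2_{ij})=0,$$ $$\partial_t\bar q_i+\tfrac52c_{11}\partial_i\theta-\tfrac{\sqrt2}6a_{45}\partial_j\bar\sigma_{ij}-\sqrt{\tfrac56}\big(\partial_j(a_{49}u^1_{ij}+a_{4,10}u^2_{ij})+a_{46}\partial_iu^2\big)=\tfrac1{Kn}\Big(\tfrac13L^1_{00}\bar q_i-\sqrt{\tfrac56}\,(L^1_{01}u^2_i+L^1_{02}u^3_i)\Big),$$ $$\partial_t\bar\sigma_{ij}+2c_{200}\partial_{\langle i}v_{j\rangle}-\tfrac{2\sqrt2}{15}a_{45}\partial_{\langle i}\bar q_{j\rangle}+\tfrac2{\sqrt{15}}\big(\partial_{\langle i}(a_{57}u^2_{j\rangle}+a_{58}u^3_{j\rangle})+a_{5,11}\partial_ku^0_{ijk}\big)=\tfrac1{Kn}\Big(\tfrac2{15}L^2_{00}\bar\sigma_{ij}+\tfrac2{\sqrt{15}}(L^2_{01}u^1_{ij}+L^2_{02}u^2_{ij})\Big),$$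 $$-\sqrt{\tfrac2{15}}\,a_{46}\partial_j\bar q_j=\tfrac1{Kn}L^0u^2,\qquad \tfrac1{\sqrt{15}}a_{5,11}\partial_{\langle k}\bar\sigma_{ij\rangle}=\tfrac1{Kn}L^3u^0_{ijk},$$ and, for $m=1,2$ with $(c^1_1,c^1_2)=(c_{21},c_{31})$, $(a^5_1,a^5_2)=(a_{57},a_{58})$, $(c^2_1,c^2_2)=(c_{210},c_{220})$, $(a^4_1,a^4_2)=(a_{49},a_{4,10})$, $$-\sqrt{\tfrac{15}2}\,c^1_m\partial_i\theta+\tfrac1{\sqrt{15}}a^5_m\partial_j\bar\sigma_{ij}=\tfrac1{Kn}\Big(-\sqrt{\tfrac2{15}}L^1_{m0}\bar q_i+L^1_{m1}u^2_i+L^1_{m2}u^3_i\Big),$$ $$\sqrt{15}\,c^2_m\partial_{\langle i}v_{j\rangle}-\sqrt{\tfrac2{15}}\,a^4_m\partial_{\langle i}\bar q_{j\rangle}=\tfrac1{Kn}\Big(\tfrac1{\sqrt{15}}L^2_{m0}\bar\sigma_{ij}+L^2_{m1}u^1_{ij}+L^2_{m2}u^2_{ij}\Big).$$ Here the collision operator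 is symmetric negative definite: $L^0,L^3<0$, and $L^1,L^2\in\mathbb R^{3\times3}$ are symmetric negative definite. Moreover $a_{5,11}\ne0$, and $c_{21}=0$ only if also $c_{31}=a_{57}=a_{58}=0$ (as for Maxwell molecules). **Assumption 2 (Onsager form).** Let $\kappa=c_{31}/c_{21}$ ($0$ if $c_{21}=0$) and $\mu=\dfrac{2(a_{58}-\kappa a_{57})}{3a_{5,11}(1+\kappa^2)}$. The second-order moments at the wall are expressed through $\theta,v,\bar q,\bar\sigma$ and their derivatives by the last four relations above. There are symmetric negative semidefinite $Q^N,Q^T\in\mathbb R^{3\times3}$ and $s_7,s_8\le0$ such that, for all boundary values of the fields, of their derivatives and of the wall data (with $\bar\sigma$ symmetric trace-free), the boundary conditions above are equivalent to $v_n=0$ and $u_{\rm odd}=\tilde\chi\,Q\,A_{oe}(g_{\rm ext}-u_{\rm even})$, that is to $v_n=0$ together with: $$\begin{pmatrix}\bar q_n\\u^2_n+\kappa u^3_n\\u^0_{nnn}+\mu(u^3_n-\kappa u^2_n)\end{pmatrix}=\tilde\chi\,Q^N\begin{pmatrix}F_1/\tfrac52\\(U^2_n+\kappa U^3_n)/\tfrac{1+\kappa^2}3\\(U^0_{nnn}+\mu(U^3_n-\kappa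 U^2_n))/\big(\tfrac4{175}+\tfrac{\mu^2(1+\kappa^2)}3\big)\end{pmatrix},\qquad \begin{pmatrix}\bar\sigma_{\tau_in}\\u^1_{\tau_in}\\u^2_{\tau_in}\end{pmatrix}=\tilde\chi\,Q^T\begin{pmatrix}G^i_0\\15\,G^i_1\\15\,G^i_2\end{pmatrix}\quad(i=1,2),$$ $$u^0_{\tau_i\tau_in}+\tfrac12u^0_{nnn}=\tilde\chi s_7\big(U^0_{\tau_i\tau_in}+\tfrac12U^0_{nnn}\big)\ (i=1,2),\qquad u^0_{\tau_1\tau_2n}=\tilde\chi s_8U^0_{\tau_1\tau_2n},$$ where $F_1=\tfrac52c_{11}(\theta^W-\theta)+\tfrac{\sqrt2}6a_{45}\bar\sigma_{nn}+\sqrt{\tfrac56}(a_{46}u^2+a_{49}u^1_{nn}+a_{4,10}u^2_{nn})$, $U^{m+1}_n=\tfrac{\sqrt{15}}3\big(\tfrac{\sqrt2}2c^1_m(\theta-\theta^W)-\tfrac1{15}a^5_m\bar\sigma_{nn}\big)$ for $m=1,2$, $U^0_{nnn}=-\tfrac{2\sqrt{15}}{875}a_{5,11}\bar\sigma_{nn}$,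 $U^0_{\tau_i\tau_jn}=\tfrac{2\sqrt{15}}{1575}a_{5,11}\big(\tfrac25\delta_{ij}\bar\sigma_{nn}-\bar\sigma_{\tau_i\tau_j}\big)$, $G^i_0=c_{200}(v^W_{\tau_i}-v_{\tau_i})+\tfrac{\sqrt2}{15}a_{45}\bar q_{\tau_i}-\tfrac1{\sqrt{15}}(a_{57}u^2_{\tau_i}+a_{58}u^3_{\tau_i}+2a_{5,11}u^0_{\tau_inn})$, $G^i_m=\tfrac{\sqrt{15}}{15}\big(c^2_m(v^W_{\tau_i}-v_{\tau_i})+\tfrac{\sqrt2}{15}a^4_m\bar q_{\tau_i}\big)$ for $m=1,2$. **Claim (entropy inequality on bounded domains).** Fix constants $k_i,l_i$, $m_{ij}$ and $\chi\in[0,1]$ satisfying Assumptions 1 and 2. Then there are constants $C_1,\dots,C_6$, depending only on these, such that the following holds for every $Kn>0$, every bounded open $\Omega\subset\mathbb R^3$ with $C^1$ boundary, every choice of the frames $(n,\tau_1,\tau_2)$ on $\partial\Omega$, and every open set $I$ of times. Let $(\rho,\theta,v,\bar q,\bar\sigma)$ be a classical solution of the R13 equations in $I\times\Omega$ ($C^2$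 in $x$ and $C^1$ in $t$, up to $\partial\Omega$) that satisfies the boundary conditions on $I\times\partial\Omega$ with wall data $\theta^W(t,\cdot),v^W(t,\cdot)$ integrable over $\partial\Omega$. Then, for all $t\in I$, $\int_\Omega H\,dx$ is differentiable at $t$ and $$-\frac{d}{dt}\int_\Omega H\,dx\le\int_{\partial\Omega}\theta^W\big(C_1\theta+C_2\bar q_n+C_3\bar\sigma_{nn}\big)\,ds+\int_{\partial\Omega}\sum_{i=1}^2v^W_{\tau_i}\big(C_4v_{\tau_i}+C_5\bar q_{\tau_i}+C_6\bar\sigma_{n\tau_i}\big)\,ds .$$ -/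

import Mathlib

open MeasureTheory Set Topology

noncomputable section

namespace LinearR13

/-! ### Tensor calculus in three dimensions -/

/-- Physical space. -/
abbrev E3 := EuclideanSpace ℝ (Fin 3)

/-- Kronecker delta. -/
def delta (i j : Fin 3) : ℝ := if i = j then 1 else 0

/-- Symmetric trace-free part `A_⟨ij⟩` of a 2-tensor. -/
def stf2 (A : Fin 3 → Fin 3 → ℝ) (i j : Fin 3) : ℝ :=
  (A i j + A j i) / 2 - delta i j * (∑ k, A k k) / 3

/-- Symmetric part `T_(ijk)` of a 3-tensor. -/
def sym3 (T : Fin 3 → Fin 3 → Fin 3 → ℝ) (i j k : Fin 3) : ℝ :=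
  (T i j k + T i k j + T j i k + T j k i + T k i j + T k j i) / 6

/-- Symmetric trace-free part `T_⟨ijk⟩` of a 3-tensor. -/
def stf3 (T : Fin 3 → Fin 3 → Fin 3 → ℝ) (i j k : Fin 3) : ℝ :=
  sym3 T i j k - (1 / 5) * (delta j k * (∑ l, sym3 T i l l) + delta i k * (∑ l, sym3 T j l l)
    + delta i j * (∑ l, sym3 T k l l))

/-- A 2-tensor that is symmetric and trace-free. -/
def IsStf (A : Fin 3 → Fin 3 → ℝ) : Prop :=
  (∀ i j, A i j = A j i) ∧ ∑ k, A k k = 0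

/-- The partial derivative `∂f/∂x_i`. -/
def pd (i : Fin 3) (f : E3 → ℝ) (x : E3) : ℝ :=
  fderiv ℝ f x (EuclideanSpace.single i 1)

/-- `Δ f`. -/
def laplacian (f : E3 → ℝ) (x : E3) : ℝ := ∑ i, pd i (pd i f) x

/-- `(∇² f)_ij`. -/
def hess (f : E3 → ℝ) (x : E3) (i j : Fin 3) : ℝ := pd i (pd j f) x

/-- `(∇ w)_ij = ∂w_j/∂x_i` for a vector field `w`. -/
def gradV (w : E3 → Fin 3 → ℝ) (x : E3) (i j : Fin 3) : ℝ := pd i (fun y => w y j) x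

/-- `(∇ T)_ijk = ∂T_jk/∂x_i` for a 2-tensor field `T`. -/
def gradT (T : E3 → Fin 3 → Fin 3 → ℝ) (x : E3) (i j k : Fin 3) : ℝ := pd i (fun y => T y j k) x

/-- `∇·w` for a vector field `w`. -/
def divV (w : E3 → Fin 3 → ℝ) (x : E3) : ℝ := ∑ j, pd j (fun y => w y j) x

/-- `(∇·T)_i = ∂T_ij/∂x_j` for a 2-tensor field `T`. -/
def divT (T : E3 → Fin 3 → Fin 3 → ℝ) (x : E3) (i : Fin 3) : ℝ := ∑ j, pd j (fun y => T y i j) x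

/-- `(∇·T)_ij = ∂T_ijk/∂x_k` for a 3-tensor field `T`. -/
def divT3 (T : E3 → Fin 3 → Fin 3 → Fin 3 → ℝ) (x : E3) (i j : Fin 3) : ℝ :=
  ∑ k, pd k (fun y => T y i j k) x

/-! ### The linear R13 equations -/

/-- The thirteen unknown fields, as functions of time and position:
density `ρ`, temperature `θ`, velocity `v`, and the modified heat flux `q̄` and stress `σ̄`. -/
structure Fields where
  ρ : ℝ → E3 → ℝ
  θ : ℝ → E3 → ℝ
  v : ℝ → E3 → Fin 3 → ℝ
  q : ℝ → E3 → Fin 3 → ℝ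
  σ : ℝ → E3 → Fin 3 → Fin 3 → ℝ

/-- The constants of the moment equations. -/
structure EqCoeffs where
  (k0 k1 k2 k3 k4 k5 k6 k7 k8 k9 k10 l1 l2 : ℝ)

/-- `u` is `C¹` in time and `C²` in space, up to the boundary of `Ω`, for times in `I`. -/
structure IsRegular (I : Set ℝ) (Ω : Set E3) (u : ℝ → E3 → ℝ) : Prop where
  space : ∀ t ∈ I, ∀ x ∈ closure Ω, ContDiffAt ℝ 2 (u t) x
  time : ∀ t ∈ I, ∀ x ∈ closure Ω, DifferentiableAt ℝ (fun s => u s x) t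
  time_cont : ContinuousOn (fun p : ℝ × E3 => deriv (fun s => u s p.2) p.1) (I ×ˢ closure Ω)

/-- `S` is a classical solution (up to the boundary) of the linear R13 equations in `Ω`
for times in `I`, with Knudsen number `Kn`. -/
structure IsSolution (K : EqCoeffs) (Kn : ℝ) (I : Set ℝ) (Ω : Set E3) (S : Fields) : Prop where
  reg_ρ : IsRegular I Ω S.ρ
  reg_θ : IsRegular I Ω S.θ
  reg_v : ∀ i, IsRegular I Ω (fun t x => S.v t x i)
  reg_q : ∀ i, IsRegular I Ω (fun t x => S.q t x i)
  reg_σ : ∀ i j, IsRegular I Ω (fun t x => S.σ t x i j)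
  stf_σ : ∀ t ∈ I, ∀ x ∈ closure Ω, IsStf (S.σ t x)
  eq_ρ : ∀ t ∈ I, ∀ x ∈ Ω, deriv (fun s => S.ρ s x) t + divV (S.v t) x = 0
  eq_θ : ∀ t ∈ I, ∀ x ∈ Ω,
    deriv (fun s => S.θ s x) t + 2 / 3 * divV (S.v t) x + 2 / 3 * K.k0 * divV (S.q t) x
      - K.k1 * Kn * laplacian (S.θ t) x + K.k2 * Kn * divV (divT (S.σ t)) x = 0
  eq_v : ∀ t ∈ I, ∀ x ∈ Ω, ∀ i,
    deriv (fun s => S.v s x i) t + pd i (S.ρ t) x + pd i (S.θ t) x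
      - K.k3 * Kn * divT (fun y => stf2 (gradV (S.v t) y)) x i
      - K.k4 * Kn * divT (fun y => stf2 (gradV (S.q t) y)) x i
      + K.k5 * divT (S.σ t) x i = 0
  eq_q : ∀ t ∈ I, ∀ x ∈ Ω, ∀ i,
    deriv (fun s => S.q s x i) t + 5 / 2 * K.k0 * pd i (S.θ t) x
      - 5 / 2 * K.k4 * Kn * divT (fun y => stf2 (gradV (S.v t) y)) x i
      - 2 * K.k6 * Kn * pd i (divV (S.q t)) x
      - 12 / 5 * K.k7 * Kn * divT (fun y => stf2 (gradV (S.q t) y)) x i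
      + K.k8 * divT (S.σ t) x i = -(1 / Kn) * (2 / 3) * K.l1 * S.q t x i
  eq_σ : ∀ t ∈ I, ∀ x ∈ Ω, ∀ i j,
    deriv (fun s => S.σ s x i j) t + 3 * K.k2 * Kn * stf2 (hess (S.θ t) x) i j
      + 2 * K.k5 * stf2 (gradV (S.v t) x) i j + 4 / 5 * K.k8 * stf2 (gradV (S.q t) x) i j
      - 2 * K.k9 * Kn * divT3 (fun y => stf3 (gradT (S.σ t) y)) x i j
      - K.k10 * Kn * stf2 (gradV (divT (S.σ t)) x) i j = -(1 / Kn) * K.l2 * S.σ t x i j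

/-- The entropy density `H`, with free additive constant `H₀`. -/
def entropy (H₀ : ℝ) (S : Fields) (t : ℝ) (x : E3) : ℝ :=
  H₀ - 1 / 2 * (S.ρ t x ^ 2 + 3 / 2 * S.θ t x ^ 2 + (∑ i, S.v t x i ^ 2)
    + 2 / 5 * (∑ i, S.q t x i ^ 2) + 1 / 2 * (∑ i, ∑ j, S.σ t x i j ^ 2))

/-! ### Domains, outer normal and surface measure -/

/-- Near `p`, the set `Ω` is the sublevel set `{φ < 0}` of a `C¹` function with `∇φ(p) ≠ 0`. -/
def IsDefiningFunction (Ω : Set E3) (p : E3) (φ : E3 → ℝ) : Prop :=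
  ContDiffAt ℝ 1 φ p ∧ gradient φ p ≠ 0 ∧ ∀ᶠ x in 𝓝 p, (x ∈ Ω ↔ φ x < 0)

/-- A bounded open set with `C¹` boundary. -/
structure IsC1Domain (Ω : Set E3) : Prop where
  isOpen : IsOpen Ω
  isBounded : Bornology.IsBounded Ω
  boundary : ∀ p ∈ frontier Ω, ∃ φ, IsDefiningFunction Ω p φ

/-- `n` is the outer unit normal vector of `Ω` at the boundary point `p`. -/
def IsOuterNormal (Ω : Set E3) (p n : E3) : Prop :=
  ∃ φ, IsDefiningFunction Ω p φ ∧ n = ‖gradient φ p‖⁻¹ • gradient φ p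

/-- `e x = (n, τ₁, τ₂)` is, at each boundary point `x`, an orthonormal basis whose first vector
is the outer unit normal. -/
def IsWallFrame (Ω : Set E3) (e : E3 → Fin 3 → E3) : Prop :=
  ∀ x ∈ frontier Ω, Orthonormal ℝ (e x) ∧ IsOuterNormal Ω x (e x 0)

/-- The surface (area) measure `ds` on the boundary of `Ω`. -/
def surfaceMeasure (Ω : Set E3) : Measure E3 :=
  (Measure.euclideanHausdorffMeasure 2).restrict (frontier Ω)

/-- Component `w_a` of a vector in the frame `e`. -/
def compV (e : Fin 3 → E3) (w : Fin 3 → ℝ) (a : Fin 3) : ℝ := ∑ i, w i * e a i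

/-- Component `T_ab` of a 2-tensor in the frame `e`. -/
def compT (e : Fin 3 → E3) (T : Fin 3 → Fin 3 → ℝ) (a b : Fin 3) : ℝ :=
  ∑ i, ∑ j, T i j * e a i * e b j

/-- Component `T_abc` of a 3-tensor in the frame `e`. -/
def compT3 (e : Fin 3 → E3) (T : Fin 3 → Fin 3 → Fin 3 → ℝ) (a b c : Fin 3) : ℝ :=
  ∑ i, ∑ j, ∑ k, T i j k * e a i * e b j * e c k

/-! ### Wall boundary conditions -/

/-- Everything that enters the boundary conditions at one wall point, in components with respect
to `(n, τ₁, τ₂)`, which carry the indices `0, 1, 2`. The gradients are multiplied by the Knudsen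
number: `dθ a = Kn ∂θ/∂x_a`, `dv a b = Kn ∂v_b/∂x_a`, `dσ a b c = Kn ∂σ̄_bc/∂x_a`. -/
structure WallState where
  (θ θW : ℝ)
  (v vW q dθ : Fin 3 → ℝ)
  (dv dq σ : Fin 3 → Fin 3 → ℝ)
  dσ : Fin 3 → Fin 3 → Fin 3 → ℝ

namespace WallState

/-- `σ̄` and its derivatives are symmetric and trace-free. -/
def IsAdmissible (w : WallState) : Prop := IsStf w.σ ∧ ∀ a, IsStf (w.dσ a)

/-- `Kn ∂q̄_j/∂x_j`. -/
def divq (w : WallState) : ℝ := ∑ j, w.dq j j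

/-- `Kn ∂σ̄_aj/∂x_j`. -/
def divσ (w : WallState) (a : Fin 3) : ℝ := ∑ j, w.dσ j a j

/-- `Kn ∂v_⟨a/∂x_b⟩`. -/
def Dv (w : WallState) (a b : Fin 3) : ℝ := stf2 w.dv a b

/-- `Kn ∂q̄_⟨a/∂x_b⟩`. -/
def Dq (w : WallState) (a b : Fin 3) : ℝ := stf2 w.dq a b

/-- `Kn ∂σ̄_⟨ab/∂x_c⟩`. -/
def Dσ (w : WallState) (a b c : Fin 3) : ℝ := stf3 w.dσ a b c

end WallState

/-- The wall state of `S` at the boundary point `x` with wall temperature `θW` and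
wall velocity `vW`. -/
def wallState (Kn : ℝ) (S : Fields) (θW : ℝ → E3 → ℝ) (vW : ℝ → E3 → Fin 3 → ℝ)
    (e : E3 → Fin 3 → E3) (t : ℝ) (x : E3) : WallState where
  θ := S.θ t x
  θW := θW t x
  v := compV (e x) (S.v t x)
  vW := compV (e x) (vW t x)
  q := compV (e x) (S.q t x)
  dθ := compV (e x) (fun i => Kn * pd i (S.θ t) x)
  dv := compT (e x) (fun i j => Kn * gradV (S.v t) x i j)
  dq := compT (e x) (fun i j => Kn * gradV (S.q t) x i j)
  σ := compT (e x) (S.σ t x)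
  dσ := compT3 (e x) (fun i j k => Kn * gradT (S.σ t) x i j k)

/-- The constants of the wall boundary conditions. -/
structure WallCoeffs where
  (m11 m12 m13 m14 m15 : ℝ)
  (m21 m22 m23 m24 m25 m26 m27 m28 : ℝ)
  (m31 m32 m33 m34 m35 : ℝ)
  (m41 m42 m43 m44 m45 m46 m47 m48 : ℝ)
  (m51 m52 m53 m54 m55 m56 m57 m58 : ℝ)
  (m61 m62 m63 m64 m65 m66 m67 m68 m69 : ℝ)
  (m71 m81 : ℝ)

/-- The modified accommodation coefficient `χ̃ = 2χ / (2 - χ)`. -/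
def chiT (χ : ℝ) : ℝ := 2 * χ / (2 - χ)

/-- The wall boundary conditions, for accommodation coefficient `χ`. -/
structure WallBC (M : WallCoeffs) (χ : ℝ) (w : WallState) : Prop where
  bc0 : w.v 0 = 0
  bc1 : w.q 0 = chiT χ * (M.m11 * (w.θ - w.θW) + M.m12 * w.σ 0 0 - M.m13 * w.divq
    - M.m14 * w.Dq 0 0 - M.m15 * w.Dv 0 0)
  bc2 : M.m26 * w.q 0 + M.m27 * w.dθ 0 - M.m28 * w.divσ 0
    = chiT χ * (-M.m21 * (w.θ - w.θW) + M.m22 * w.σ 0 0 + M.m23 * w.divq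
      + M.m24 * w.Dq 0 0 + M.m25 * w.Dv 0 0)
  bc3 : ∀ i : Fin 3, i ≠ 0 → w.σ i 0 = chiT χ * (M.m31 * (w.v i - w.vW i) + M.m32 * w.q i
    - M.m33 * w.divσ i - M.m34 * w.Dσ i 0 0 + M.m35 * w.dθ i)
  bc4 : ∀ i : Fin 3, i ≠ 0 → M.m46 * w.σ i 0 + M.m47 * w.Dv i 0 + M.m48 * w.Dq i 0
    = -chiT χ * (-M.m41 * (w.v i - w.vW i) + M.m42 * w.q i
      + M.m43 * w.divσ i + M.m44 * w.Dσ i 0 0 - M.m45 * w.dθ i)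
  bc5 : ∀ i : Fin 3, i ≠ 0 → M.m56 * w.σ i 0 + M.m57 * w.Dv i 0 + M.m58 * w.Dq i 0
    = -chiT χ * (-M.m51 * (w.v i - w.vW i) + M.m52 * w.q i
      + M.m53 * w.divσ i + M.m54 * w.Dσ i 0 0 - M.m55 * w.dθ i)
  bc6 : M.m66 * w.q 0 + (M.m67 * w.Dσ 0 0 0 + M.m68 * w.divσ 0 + M.m69 * w.dθ 0)
    = -chiT χ * (-M.m61 * (w.θ - w.θW) + M.m62 * w.σ 0 0 + M.m63 * w.divq
      + M.m64 * w.Dq 0 0 + M.m65 * w.Dv 0 0)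
  bc7 : ∀ i : Fin 3, i ≠ 0 → w.Dσ i i 0 + 1 / 2 * w.Dσ 0 0 0
    = -chiT χ * M.m71 * (w.σ i i + 1 / 2 * w.σ 0 0)
  bc8 : w.Dσ 1 2 0 = -chiT χ * M.m81 * w.σ 1 2

/-! ### The underlying symmetric moment system -/

/-- The constants of the symmetric 37-moment system for the thirteen fields and the second-order
moments `u²`, `u²_i`, `u³_i`, `u¹_ij`, `u²_ij`, `u⁰_ijk`, from which the R13 equations arise by
eliminating the second-order moments:
`∂_t ρ + ∂_j v_j = 0`,
`∂_t θ + 2/3 ∂_j v_j + 2/3 c11 ∂_j q̄_j - √(10/3) ∂_j (c21 u²_j + c31 u³_j) = 0`,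
`∂_t v_i + ∂_i ρ + ∂_i θ + c200 ∂_j σ̄_ij + √15 ∂_j (c210 u¹_ij + c220 u²_ij) = 0`,
`∂_t q̄_i + 5/2 c11 ∂_i θ - √2/6 A45 ∂_j σ̄_ij - √(5/6) (∂_j (A49 u¹_ij + A410 u²_ij) + A46 ∂_i u²)`
`  = Kn⁻¹ (1/3 L1₀₀ q̄_i - √(5/6) (L1₀₁ u²_i + L1₀₂ u³_i))`,
`∂_t σ̄_ij + 2 c200 ∂_⟨i v_j⟩ - 2√2/15 A45 ∂_⟨i q̄_j⟩`
`  + 2/√15 (∂_⟨i (A57 u²_j⟩ + A58 u³_j⟩) + A511 ∂_k u⁰_ijk)`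
`  = Kn⁻¹ (2/15 L2₀₀ σ̄_ij + 2/√15 (L2₀₁ u¹_ij + L2₀₂ u²_ij))`,
`-√(2/15) A46 ∂_j q̄_j = Kn⁻¹ L0 u²`,
`-√(15/2) c21 ∂_i θ + 1/√15 A57 ∂_j σ̄_ij = Kn⁻¹ (-√(2/15) L1₁₀ q̄_i + L1₁₁ u²_i + L1₁₂ u³_i)`,
`-√(15/2) c31 ∂_i θ + 1/√15 A58 ∂_j σ̄_ij = Kn⁻¹ (-√(2/15) L1₂₀ q̄_i + L1₂₁ u²_i + L1₂₂ u³_i)`,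
`√15 c210 ∂_⟨i v_j⟩ - √(2/15) A49 ∂_⟨i q̄_j⟩`
`  = Kn⁻¹ (1/√15 L2₁₀ σ̄_ij + L2₁₁ u¹_ij + L2₁₂ u²_ij)`,
`√15 c220 ∂_⟨i v_j⟩ - √(2/15) A410 ∂_⟨i q̄_j⟩`
`  = Kn⁻¹ (1/√15 L2₂₀ σ̄_ij + L2₂₁ u¹_ij + L2₂₂ u²_ij)`,
`1/√15 A511 ∂_⟨k σ̄_ij⟩ = Kn⁻¹ L3 u⁰_ijk`.
The `L`'s represent the linearized collision operator on scalars, vectors, 2-tensors, 3-tensors. -/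
structure MomentCoeffs where
  (c11 c21 c31 c200 c210 c220 : ℝ)
  (A45 A46 A49 A410 A57 A58 A511 : ℝ)
  (L0 L3 : ℝ)
  (L1 L2 : Matrix (Fin 3) (Fin 3) ℝ)

namespace MomentCoeffs

variable (D : MomentCoeffs)

/-- The collision operator is self-adjoint and negative definite on the non-equilibrium moments,
and the basis functions of the odd space below are well defined. The last condition says that
`c21 = 0` occurs only for gases (such as Maxwell molecules) in which `θ` and `σ̄` do not couple to
`u²_i`, `u³_i` at all. -/
structure IsAdmissible : Prop where
  L0_neg : D.L0 < 0
  L3_neg : D.L3 < 0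
  L1_neg : (-D.L1).PosDef
  L2_neg : (-D.L2).PosDef
  A511_ne : D.A511 ≠ 0
  degenerate : D.c21 = 0 → D.c31 = 0 ∧ D.A57 = 0 ∧ D.A58 = 0

/-- `(c21, c31)`. -/
def c1 : Fin 2 → ℝ := ![D.c21, D.c31]
/-- `(c210, c220)`. -/
def c2 : Fin 2 → ℝ := ![D.c210, D.c220]
/-- `(A49, A410)`. -/
def a4 : Fin 2 → ℝ := ![D.A49, D.A410]
/-- `(A57, A58)`. -/
def a5 : Fin 2 → ℝ := ![D.A57, D.A58]
/-- Coupling of `q̄_i` to `u²_i, u³_i` in the collision operator. -/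
def r1 : Fin 2 → ℝ := ![D.L1 1 0, D.L1 2 0]
/-- Coupling of `σ̄_ij` to `u¹_ij, u²_ij` in the collision operator. -/
def r2 : Fin 2 → ℝ := ![D.L2 1 0, D.L2 2 0]
/-- Inverse of the collision matrix of `(u²_i, u³_i)`. -/
def R1 : Matrix (Fin 2) (Fin 2) ℝ := (D.L1.submatrix Fin.succ Fin.succ)⁻¹
/-- Inverse of the collision matrix of `(u¹_ij, u²_ij)`. -/
def R2 : Matrix (Fin 2) (Fin 2) ℝ := (D.L2.submatrix Fin.succ Fin.succ)⁻¹

/-- The bilinear form `xᵀ R y`. -/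
def bil (x : Fin 2 → ℝ) (R : Matrix (Fin 2) (Fin 2) ℝ) (y : Fin 2 → ℝ) : ℝ :=
  ∑ i, ∑ j, x i * R i j * y j

/-- The constants of the R13 equations obtained by eliminating the second-order moments. -/
def eqCoeffs : EqCoeffs where
  k0 := D.c11 - bil D.c1 D.R1 D.r1
  k1 := -5 * bil D.c1 D.R1 D.c1
  k2 := -(√2 / 3) * bil D.c1 D.R1 D.a5
  k3 := -15 * bil D.c2 D.R2 D.c2
  k4 := √2 * bil D.a4 D.R2 D.c2
  k5 := D.c200 - bil D.c2 D.R2 D.r2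
  k6 := -(D.A46 ^ 2 / (6 * D.L0))
  k7 := -(5 / 36) * bil D.a4 D.R2 D.a4
  k8 := √2 / 6 * (-D.A45 + bil D.a5 D.R1 D.r1 + bil D.a4 D.R2 D.r2)
  k9 := -(D.A511 ^ 2 / (15 * D.L3))
  k10 := -(2 / 15) * bil D.a5 D.R1 D.a5
  l1 := -(1 / 2) * (D.L1 0 0 - bil D.r1 D.R1 D.r1)
  l2 := -(2 / 15) * (D.L2 0 0 - bil D.r2 D.R2 D.r2)

variable (w : WallState)

/-- The second-order scalar `u²` at the wall. -/
def uS : ℝ := -√(2 / 15) * D.A46 * w.divq / D.L0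

/-- The second-order vectors `(u²_a, u³_a)` at the wall. -/
def uV (a : Fin 3) : Fin 2 → ℝ :=
  D.R1.mulVec fun m => -√(15 / 2) * D.c1 m * w.dθ a + 1 / √15 * D.a5 m * w.divσ a
    + √(2 / 15) * D.r1 m * w.q a

/-- The second-order 2-tensors `(u¹_ab, u²_ab)` at the wall. -/
def uT (a b : Fin 3) : Fin 2 → ℝ :=
  D.R2.mulVec fun m => √15 * D.c2 m * w.Dv a b - √(2 / 15) * D.a4 m * w.Dq a b
    - 1 / √15 * D.r2 m * w.σ a b

/-- The second-order 3-tensor `u⁰_abc` at the wall. -/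
def uTT (a b c : Fin 3) : ℝ := 1 / √15 * D.A511 * w.Dσ a b c / D.L3

/-- `c31 / c21` (and `0` for Maxwell molecules). -/
def κ : ℝ := D.c31 / D.c21

/-- `μ₂ / μ₁`, where `μ₁ φ⁰_nnn + μ₂ (φ³_n - κ φ²_n)` is a basis function of the odd space. -/
def μ : ℝ := 2 * (D.A58 - D.κ * D.A57) / (3 * D.A511 * (1 + D.κ ^ 2))

/-- Odd moments `q̄_n`, `u²_n + κ u³_n`, `u⁰_nnn + μ (u³_n - κ u²_n)`. -/
def oddN : Fin 3 → ℝ :=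
  ![w.q 0, D.uV w 0 0 + D.κ * D.uV w 0 1,
    D.uTT w 0 0 0 + D.μ * (D.uV w 0 1 - D.κ * D.uV w 0 0)]

/-- Odd moments `σ̄_τn`, `u¹_τn`, `u²_τn`, for the tangential direction `τ = i`. -/
def oddT (i : Fin 3) : Fin 3 → ℝ := ![w.σ i 0, D.uT w i 0 0, D.uT w i 0 1]

/-- Squared norms of the basis functions that belong to `oddN`. -/
def normN : Fin 3 → ℝ := ![5 / 2, (1 + D.κ ^ 2) / 3, 4 / 175 + D.μ ^ 2 * (1 + D.κ ^ 2) / 3]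

/-- Squared norms of the basis functions that belong to `oddT`. -/
def normT : Fin 3 → ℝ := ![1, 1 / 15, 1 / 15]

/-- The normal flux `U²_n` of `u²_n` for the difference between wall and gas. -/
def U2n : ℝ := √15 / 3 * (√2 / 2 * D.c21 * (w.θ - w.θW) - 1 / 15 * D.A57 * w.σ 0 0)

/-- The normal flux `U³_n`. -/
def U3n : ℝ := √15 / 3 * (√2 / 2 * D.c31 * (w.θ - w.θW) - 1 / 15 * D.A58 * w.σ 0 0)

/-- The normal flux `U⁰_nnn`. -/
def Unnn : ℝ := -(2 * √15 / 875) * D.A511 * w.σ 0 0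

/-- The normal flux `U⁰_ijn` for tangential `i, j`. -/
def Uttn (i j : Fin 3) : ℝ :=
  2 * √15 / 1575 * D.A511 * (2 / 5 * delta i j * w.σ 0 0 - w.σ i j)

/-- The entries of `A_oe (g_ext - u_even)` that belong to `oddN`. -/
def fluxN : Fin 3 → ℝ :=
  ![5 / 2 * D.c11 * (w.θW - w.θ) + √2 / 6 * D.A45 * w.σ 0 0
      + √(5 / 6) * (D.A46 * D.uS w + D.A49 * D.uT w 0 0 0 + D.A410 * D.uT w 0 0 1),
    D.U2n w + D.κ * D.U3n w,
    D.Unnn w + D.μ * (D.U3n w - D.κ * D.U2n w)]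

/-- The entries of `A_oe (g_ext - u_even)` that belong to `oddT`. -/
def fluxT (i : Fin 3) : Fin 3 → ℝ :=
  ![D.c200 * (w.vW i - w.v i) + √2 / 15 * D.A45 * w.q i
      - 1 / √15 * (D.A57 * D.uV w i 0 + D.A58 * D.uV w i 1 + 2 * D.A511 * D.uTT w i 0 0),
    √15 / 15 * (D.c210 * (w.vW i - w.v i) + √2 / 15 * D.A49 * w.q i),
    √15 / 15 * (D.c220 * (w.vW i - w.v i) + √2 / 15 * D.A410 * w.q i)]

/-- Onsager boundary conditions `u_odd = Q A_oe (g_ext - u_even)`, in the orthogonal basis of the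
odd space above. Here `Q` is block diagonal, with blocks `χ̃ QN` (normal), `χ̃ QT` (one copy for each
tangential direction) and the scalars `χ̃ s₇`, `χ̃ s₈`; its entries are
`⟨φ_i, 𝒬 φ_j⟩`, and `fluxN j / normN j` is the coefficient of `φ_j` in `A_oe (g_ext - u_even)`.
The condition for the mass flux is `v_n = 0`. -/
structure OnsagerBC (QN QT : Matrix (Fin 3) (Fin 3) ℝ) (s₇ s₈ χ : ℝ) : Prop where
  mass : w.v 0 = 0
  normal : ∀ j, D.oddN w j = chiT χ * ∑ l, QN j l * (D.fluxN w l / D.normN l)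
  tangential : ∀ i : Fin 3, i ≠ 0 → ∀ j,
    D.oddT w i j = chiT χ * ∑ l, QT j l * (D.fluxT w i l / normT l)
  shear : ∀ i : Fin 3, i ≠ 0 → D.uTT w i i 0 + 1 / 2 * D.uTT w 0 0 0
    = chiT χ * s₇ * (D.Uttn w i i + 1 / 2 * D.Unnn w)
  shear' : D.uTT w 1 2 0 = chiT χ * s₈ * D.Uttn w 1 2

end MomentCoeffs

/-- The constants `K` of the R13 equations come from a symmetric dissipative moment system, and the
wall boundary conditions with constants `M` and accommodation coefficient `χ` are Onsager boundary
conditions for this system, with a symmetric negative semidefinite matrix `Q`. -/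
def IsOnsagerModel (K : EqCoeffs) (M : WallCoeffs) (χ : ℝ) : Prop :=
  ∃ D : MomentCoeffs, D.IsAdmissible ∧ K = D.eqCoeffs ∧
    ∃ (QN QT : Matrix (Fin 3) (Fin 3) ℝ) (s₇ s₈ : ℝ),
      (-QN).PosSemidef ∧ (-QT).PosSemidef ∧ s₇ ≤ 0 ∧ s₈ ≤ 0 ∧
      ∀ w : WallState, w.IsAdmissible → (WallBC M χ w ↔ D.OnsagerBC w QN QT s₇ s₈ χ)

end LinearR13

end

namespace LinearR13

open scoped NNReal ENNReal RealInnerProductSpace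

/-! ### Lipschitz images and oblique coordinates -/

/-! Up to sign and an additive constant the entropy is a weighted square norm of the fields, and its
weights symmetrize the R13 system. Multiplying each equation by its weighted unknown and adding
leaves the divergence of a flux and a remainder (`IsSolution.entropy_balance`). Written with the
second-order moments, the remainder is `1 / Kn` times the collision form evaluated at first- and
second-order moments, so it is nonpositive (`MomentCoeffs.IsAdmissible.production_nonpos`). What is
left after integration is the boundary integral of the negative normal flux.

At the wall the pressure part `(ρ + θ) v_n` vanishes. In the frame `(n, τ₁, τ₂)` the rest is a
pairing of odd moments with even fluxes (`MomentCoeffs.neg_flux_eq`); `MomentCoeffs.flux_rotate`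
passes from Cartesian components to the frame. For zero wall data the Onsager conditions `u = X Q f`
make this pairing `X fᵀ Q f ≤ 0`. Wall data add cross terms, and the first entry of `f` in each
block contains second-order moments that must not appear in the final bound. `schur_bound` removes
them: `Q` is split into the rank-one form of its first row and a Schur complement. The rank-one part
sees the first entry of `f` only through the odd moment `q̄_n` or `σ̄_τn`; the complement sees only
`θ`, `σ̄_nn`, `v_τ`, `q̄_τ` and wall data. Two nonpositive squares are discarded, and what remains
is linear in the wall data. Its coefficients are the constants `C₁, …, C₆`. They do not depend on
the Knudsen number or the domain, because the wall relations are pointwise and `Kn` is absorbed into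
the gradients.

The divergence theorem for a `C¹` domain with Hausdorff surface measure
(`IsC1Domain.integral_fderiv`) is obtained without an area formula. Near a boundary point, Fubini in
oblique coordinates along a direction `a` with `⟪n, a⟫ = 1` gives an exact identity, but for the
measure on the boundary that projects to area on the tangent plane. The projection and its inverse
have Lipschitz constants close to one on a small box, so this measure and the surface measure differ
by a factor close to one. The resulting error is at most `ε ∫ |f| ds`. Such errors add up under a
partition of unity, and then `ε` tends to zero.

Differentiation of the total entropy under the integral rests on the joint continuity of the fields
in `(t, x)`, which is deduced in `IsRegular.continuousOn`. -/

theorem euclideanHausdorffMeasure_image_le {X Y : Type*} [EMetricSpace X] [MeasurableSpace X]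
    [BorelSpace X] [EMetricSpace Y] [MeasurableSpace Y] [BorelSpace Y] {K : ℝ≥0} {f : X → Y}
    {s : Set X} (h : LipschitzOnWith K f s) (d : ℕ) :
    Measure.euclideanHausdorffMeasure d (f '' s)
      ≤ (K : ℝ≥0∞) ^ d * Measure.euclideanHausdorffMeasure d s := by
  have h1 := h.hausdorffMeasure_image_le (d := (d : ℝ)) (by positivity)
  rw [ENNReal.rpow_natCast] at h1
  simp only [Measure.euclideanHausdorffMeasure_def, Measure.smul_apply, ENNReal.smul_def,
    smul_eq_mul]
  calc _ ≤ _ := mul_le_mul_right h1 _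
    _ = _ := by ring

section Oblique

variable {E : Type*} [NormedAddCommGroup E] [InnerProductSpace ℝ E]

theorem inner_orthogonal_span {n : E} (y : (ℝ ∙ n)ᗮ) : ⟪n, (y : E)⟫ = 0 :=
  Submodule.mem_orthogonal_singleton_iff_inner_right.1 y.2

/-- The projection onto `nᗮ` along the direction `a`, where `⟪n, a⟫ = 1`. -/
noncomputable def obliqueProj (n a : E) : E →L[ℝ] (ℝ ∙ n)ᗮ :=
  (ℝ ∙ n)ᗮ.orthogonalProjectionOnto ∘L (ContinuousLinearMap.id ℝ E - (innerSL ℝ n).smulRight a)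

theorem coe_obliqueProj {n a : E} (ha : ⟪n, a⟫ = 1) (x : E) :
    (obliqueProj n a x : E) = x - ⟪n, x⟫ • a := by
  have : x - ⟪n, x⟫ • a ∈ (ℝ ∙ n)ᗮ := by
    rw [Submodule.mem_orthogonal_singleton_iff_inner_right]
    simp [inner_sub_right, inner_smul_right, ha]
  simp only [obliqueProj, ContinuousLinearMap.comp_apply, sub_apply,
    ContinuousLinearMap.id_apply, ContinuousLinearMap.smulRight_apply, innerSL_apply_apply]
  exact congrArg Subtype.val (Submodule.orthogonalProjectionOnto_mem_subspace_eq_self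
    (K := (ℝ ∙ n)ᗮ) ⟨_, this⟩)

/-- The point with oblique coordinates `(t, y)`. -/
def obliquePoint (n a : E) (z : ℝ × (ℝ ∙ n)ᗮ) : E := z.1 • a + z.2

theorem inner_obliquePoint {n a : E} (ha : ⟪n, a⟫ = 1) (z : ℝ × (ℝ ∙ n)ᗮ) :
    ⟪n, obliquePoint n a z⟫ = z.1 := by
  simp [obliquePoint, inner_add_right, inner_smul_right, ha, inner_orthogonal_span]

theorem obliqueProj_obliquePoint {n a : E} (ha : ⟪n, a⟫ = 1) (z : ℝ × (ℝ ∙ n)ᗮ) :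
    obliqueProj n a (obliquePoint n a z) = z.2 := by
  apply Subtype.ext
  rw [coe_obliqueProj ha, inner_obliquePoint ha]
  simp [obliquePoint]

theorem obliquePoint_coords {n a : E} (ha : ⟪n, a⟫ = 1) (x : E) :
    obliquePoint n a (⟪n, x⟫, obliqueProj n a x) = x := by
  simp [obliquePoint, coe_obliqueProj ha]

theorem continuous_obliquePoint (n a : E) : Continuous (obliquePoint n a) := by
  unfold obliquePoint
  fun_prop

variable [FiniteDimensional ℝ E] [MeasurableSpace E] [BorelSpace E]

theorem measurePreserving_orthogonalPoint {n : E} (hn : ‖n‖ = 1) :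
    MeasurePreserving (obliquePoint n n) := by
  let li : WithLp 2 (ℝ × (ℝ ∙ n)ᗮ) →ₗᵢ[ℝ] E :=
    { toFun := fun z => z.fst • n + z.snd
      map_add' := fun x y => by simp [add_smul]; abel
      map_smul' := fun c x => by simp [smul_smul]
      norm_map' := fun z => by
        have h0 : ⟪z.fst • n, (z.snd : E)⟫ = 0 := by
          rw [inner_smul_left, inner_orthogonal_span, mul_zero]
        have h1 := norm_add_sq_eq_norm_sq_add_norm_sq_real h0
        have h2 := WithLp.prod_norm_sq_eq_of_L2 z
        rw [norm_smul, hn, mul_one] at h1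
        have h3 : ‖z.fst • n + (z.snd : E)‖ ^ 2 = ‖z‖ ^ 2 := by
          rw [h2, pow_two, h1, pow_two, pow_two]; rfl
        exact (sq_eq_sq₀ (norm_nonneg _) (norm_nonneg _)).1 h3 }
  have hne : n ≠ 0 := by rintro rfl; simp at hn
  have hdim : Module.finrank ℝ (WithLp 2 (ℝ × (ℝ ∙ n)ᗮ)) = Module.finrank ℝ E := by
    rw [(WithLp.linearEquiv 2 ℝ (ℝ × (ℝ ∙ n)ᗮ)).finrank_eq, Module.finrank_prod,
      ← Submodule.finrank_add_finrank_orthogonal (ℝ ∙ n), finrank_span_singleton hne,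
      Module.finrank_self]
  have := (li.toLinearIsometryEquiv hdim).measurePreserving.comp
    (WithLp.volume_preserving_toLp ℝ (ℝ ∙ n)ᗮ)
  exact this

/-- Since `a - n` is orthogonal to `n`, oblique coordinates are orthogonal ones preceded by the
shear `(t, y) ↦ (t, t (a - n) + y)`. Shears preserve volume, so no Jacobian appears. -/
theorem measurePreserving_obliquePoint {n a : E} (hn : ‖n‖ = 1) (ha : ⟪n, a⟫ = 1) :
    MeasurePreserving (obliquePoint n a) := by
  have hmem : a - n ∈ (ℝ ∙ n)ᗮ := by
    rw [Submodule.mem_orthogonal_singleton_iff_inner_right]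
    simp [inner_sub_right, ha, hn]
  let a' : (ℝ ∙ n)ᗮ := ⟨a - n, hmem⟩
  have hs : MeasurePreserving (fun p : ℝ × (ℝ ∙ n)ᗮ => (p.1, p.1 • a' + p.2)) := by
    refine MeasurePreserving.skew_product (MeasurePreserving.id volume)
      (g := fun t y => t • a' + y) ?_ ?_
    · exact Continuous.measurable (by fun_prop)
    · exact Filter.Eventually.of_forall fun t => map_add_left_eq_self volume _
  have := (measurePreserving_orthogonalPoint hn).comp hs
  convert this using 1
  ext z
  simp [obliquePoint, a', smul_sub]
  abel

theorem measurableEmbedding_obliquePoint {n a : E} (ha : ⟪n, a⟫ = 1) :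
    MeasurableEmbedding (obliquePoint n a) := by
  let h : (ℝ × (ℝ ∙ n)ᗮ) ≃ₜ E :=
    { toFun := obliquePoint n a
      invFun := fun x => (⟪n, x⟫, obliqueProj n a x)
      left_inv := fun z => by simp [inner_obliquePoint ha, obliqueProj_obliquePoint ha]
      right_inv := fun x => obliquePoint_coords ha x
      continuous_toFun := continuous_obliquePoint n a
      continuous_invFun := by fun_prop }
  exact h.measurableEmbedding

theorem integral_eq_integral_oblique {n a : E} (hn : ‖n‖ = 1) (ha : ⟪n, a⟫ = 1) {f : E → ℝ}
    (hf : Integrable f) :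
    ∫ x, f x = ∫ y : (ℝ ∙ n)ᗮ, ∫ t : ℝ, f (obliquePoint n a (t, y)) := by
  have hm := measurePreserving_obliquePoint hn ha
  have he := measurableEmbedding_obliquePoint ha
  rw [← hm.integral_comp he]
  exact integral_prod_symm _ ((hm.integrable_comp_emb he).2 hf)

end Oblique

/-! ### Comparable measures -/

section Comparable

variable {X : Type*} [MeasurableSpace X] {μ ν : Measure X} {c : ℝ≥0}

theorem integral_le_of_le_smul (h : μ ≤ c • ν) {f : X → ℝ} (hf : 0 ≤ f) (hi : Integrable f ν) :
    ∫ x, f x ∂μ ≤ c * ∫ x, f x ∂ν := by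
  have h1 := integral_mono_measure h (Filter.Eventually.of_forall hf) (hi.smul_measure_nnreal)
  rwa [integral_smul_nnreal_measure] at h1

/-- For a nonnegative integrand the lower bound follows from `1 / (1 + ε) ≥ 1 - ε`. A signed
integrand is split into positive and negative parts, whose errors add up to the integral of the
absolute value. -/
theorem abs_integral_sub_le_of_comparable {ε : ℝ≥0} (h1 : μ ≤ (1 + ε) • ν) (h2 : ν ≤ (1 + ε) • μ)
    {f : X → ℝ} (hi : Integrable f ν) :
    |∫ x, f x ∂μ - ∫ x, f x ∂ν| ≤ ε * ∫ x, |f x| ∂ν := by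
  have key : ∀ g : X → ℝ, 0 ≤ g → Integrable g ν →
      |∫ x, g x ∂μ - ∫ x, g x ∂ν| ≤ ε * ∫ x, g x ∂ν := by
    intro g hg hgi
    have hgm : Integrable g μ := Integrable.of_measure_le_smul (c := ((1 + ε : ℝ≥0) : ℝ≥0∞)) (by simp) h1 hgi
    have e1 := integral_le_of_le_smul h1 hg hgi
    have e2 := integral_le_of_le_smul h2 hg hgm
    have e3 : 0 ≤ ∫ x, g x ∂ν := integral_nonneg hg
    have e4 : 0 ≤ ∫ x, g x ∂μ := integral_nonneg hg
    have e5 : (0 : ℝ) ≤ ε := ε.2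
    push_cast at e1 e2
    rw [abs_le]
    constructor
    · by_cases hle : ∫ x, g x ∂μ ≤ ∫ x, g x ∂ν
      · nlinarith
      · nlinarith
    · nlinarith
  have hp := key (fun x => max (f x) 0) (fun x => le_max_right _ _) hi.pos_part
  have hm := key (fun x => max (-f x) 0) (fun x => le_max_right _ _) hi.neg_part
  have him : Integrable f μ := Integrable.of_measure_le_smul (c := ((1 + ε : ℝ≥0) : ℝ≥0∞)) (by simp) h1 hi
  have d1 : ∀ x, f x = max (f x) 0 - max (-f x) 0 := fun x => by
    rcases le_total (f x) 0 with h | h <;> simp [h]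
  have d2 : ∀ x, |f x| = max (f x) 0 + max (-f x) 0 := fun x => by
    rcases le_total (f x) 0 with h | h
    · simp [h, abs_of_nonpos h]
    · simp [h, abs_of_nonneg h]
  have s1 : ∫ x, f x ∂μ = ∫ x, max (f x) 0 ∂μ - ∫ x, max (-f x) 0 ∂μ := by
    rw [← integral_sub him.pos_part him.neg_part]; exact integral_congr_ae (Filter.Eventually.of_forall d1)
  have s2 : ∫ x, f x ∂ν = ∫ x, max (f x) 0 ∂ν - ∫ x, max (-f x) 0 ∂ν := by
    rw [← integral_sub hi.pos_part hi.neg_part]; exact integral_congr_ae (Filter.Eventually.of_forall d1)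
  have s3 : ∫ x, |f x| ∂ν = ∫ x, max (f x) 0 ∂ν + ∫ x, max (-f x) 0 ∂ν := by
    rw [← integral_add hi.pos_part hi.neg_part]; exact integral_congr_ae (Filter.Eventually.of_forall d2)
  rw [abs_le] at hp hm ⊢
  rw [s1, s2, s3]
  constructor <;> nlinarith [hp.1, hp.2, hm.1, hm.2]

end Comparable

end LinearR13

namespace LinearR13

open scoped NNReal ENNReal RealInnerProductSpace

/-! ### Boundary charts -/

/-- The box around `p` of size `r` in oblique coordinates. -/
def obliqueBox (n a p : E3) (r : ℝ) : Set E3 :=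
  {x | |⟪n, x - p⟫| < r ∧ ‖obliqueProj n a (x - p)‖ < r}

theorem isOpen_obliqueBox (n a p : E3) (r : ℝ) : IsOpen (obliqueBox n a p r) := by
  have h1 : Continuous fun x : E3 => |⟪n, x - p⟫| := by fun_prop
  have h2 : Continuous fun x : E3 => ‖obliqueProj n a (x - p)‖ := by fun_prop
  exact (isOpen_lt h1 continuous_const).inter (isOpen_lt h2 continuous_const)

theorem self_mem_obliqueBox (n a p : E3) {r : ℝ} (hr : 0 < r) : p ∈ obliqueBox n a p r := by
  simp [obliqueBox, hr]

theorem norm_le_of_mem_obliqueBox {n a p x : E3} {r : ℝ} (ha : ⟪n, a⟫ = 1)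
    (hx : x ∈ obliqueBox n a p r) : ‖x - p‖ ≤ r * (‖a‖ + 1) := by
  have h := obliquePoint_coords ha (x - p)
  rw [← h]
  unfold obliquePoint
  refine (norm_add_le _ _).trans ?_
  rw [norm_smul, Real.norm_eq_abs]
  have h1 : ‖((obliqueProj n a (x - p) : (ℝ ∙ n)ᗮ) : E3)‖ < r := hx.2
  have h2 : |⟪n, x - p⟫| < r := hx.1
  simp only
  nlinarith [norm_nonneg a]

/-- In the box of size `r` around `p`, the set `Ω` is the sublevel set `{ψ < 0}` of a function
close to `x ↦ ⟪n, x - p⟫`. -/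
structure IsBoundaryChart (Ω : Set E3) (n a p : E3) (c : ℝ≥0) (r : ℝ) (ψ : E3 → ℝ) : Prop where
  r_pos : 0 < r
  norm_n : ‖n‖ = 1
  inner_n : ⟪n, a⟫ = 1
  small : c * (‖a‖ + 2) < 1
  approx : ApproximatesLinearOn ψ (innerSL ℝ n) (obliqueBox n a p r) c
  mem_iff : ∀ x ∈ obliqueBox n a p r, (x ∈ Ω ↔ ψ x < 0)
  zero : ψ p = 0

theorem IsDefiningFunction.nonneg_of_mem_frontier {Ω : Set E3} (hΩ : IsOpen Ω) {p : E3} {φ : E3 → ℝ}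
    (h : IsDefiningFunction Ω p φ) (hp : p ∈ frontier Ω) : φ p = 0 := by
  have h1 : p ∉ Ω := by
    rw [hΩ.frontier_eq] at hp; exact hp.2
  have h2 : 0 ≤ φ p := by
    have := h.2.2.self_of_nhds
    by_contra hlt
    exact h1 (this.2 (not_le.1 hlt))
  have h3 : ∃ᶠ x in 𝓝 p, φ x ≤ 0 := by
    have : ∃ᶠ x in 𝓝 p, x ∈ Ω := mem_closure_iff_frequently.1 (frontier_subset_closure hp)
    exact (this.and_eventually h.2.2).mono fun x hx => ((hx.2).1 hx.1).le
  have h4 : φ p ≤ 0 := by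
    by_contra hlt
    have := h.1.continuousAt.eventually (lt_mem_nhds (not_le.1 hlt))
    obtain ⟨x, hx⟩ := (h3.and_eventually this).exists
    exact absurd hx.1 (not_le.2 hx.2)
  exact le_antisymm h4 h2

/-- Dividing the defining function by the length of its gradient at `p` makes its derivative there
equal to `⟪n, ·⟫`. Strict differentiability then gives the linear approximation with any prescribed
constant `c` on a small box. -/
theorem exists_isBoundaryChart {Ω : Set E3} (hΩ : IsOpen Ω) {p n a : E3} (hp : p ∈ frontier Ω)
    (hn : IsOuterNormal Ω p n) (ha : ⟪n, a⟫ = 1) {c : ℝ≥0} (hc : 0 < c) (hca : c * (‖a‖ + 2) < 1)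
    {V : Set E3} (hV : V ∈ 𝓝 p) :
    ∃ r ψ, IsBoundaryChart Ω n a p c r ψ ∧ obliqueBox n a p r ⊆ V := by
  obtain ⟨φ, hφ, rfl⟩ := hn
  set g := gradient φ p with hg
  have hg0 : 0 < ‖g‖ := norm_pos_iff.2 hφ.2.1
  set ψ : E3 → ℝ := fun x => ‖g‖⁻¹ * φ x with hψ
  have hd : HasStrictFDerivAt ψ (innerSL ℝ (‖g‖⁻¹ • g)) p := by
    have hlin : fderiv ℝ φ p = innerSL ℝ g := by
      ext x
      rw [hg, gradient, innerSL_apply_apply, InnerProductSpace.toDual_symm_apply]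
    have h1 := hφ.1.hasStrictFDerivAt (by norm_num)
    rw [hlin] at h1
    have h2 : innerSL ℝ (‖g‖⁻¹ • g) = ‖g‖⁻¹ • innerSL ℝ g := by
      ext x
      simp
    rw [h2]
    exact h1.const_smul ‖g‖⁻¹
  obtain ⟨s, hs, hsl⟩ := hd.approximates_deriv_on_nhds (Or.inr hc)
  have hev : s ∩ V ∩ {x | x ∈ Ω ↔ φ x < 0} ∈ 𝓝 p :=
    Filter.inter_mem (Filter.inter_mem hs hV) hφ.2.2
  obtain ⟨R, hR, hball⟩ := Metric.mem_nhds_iff.1 hev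
  have hpos : 0 < ‖a‖ + 1 := by positivity
  -- A box of size `r` lies within distance `r (‖a‖ + 1)` of `p`; the factor two in the size makes
  -- the inclusion in the open ball strict.
  have hsub : obliqueBox (‖g‖⁻¹ • g) a p (R / (2 * (‖a‖ + 1))) ⊆ s ∩ V ∩ {x | x ∈ Ω ↔ φ x < 0} := by
    intro x hx
    apply hball
    rw [Metric.mem_ball, dist_eq_norm]
    refine (norm_le_of_mem_obliqueBox ha hx).trans_lt ?_
    have : R / (2 * (‖a‖ + 1)) * (‖a‖ + 1) = R / 2 := by field_simp
    rw [this]; linarith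
  refine ⟨R / (2 * (‖a‖ + 1)), ψ, ⟨by positivity, ?_, ha, hca,
    hsl.mono_set fun x hx => (hsub hx).1.1, ?_, ?_⟩, fun x hx => (hsub hx).1.2⟩
  · rw [norm_smul, norm_inv, norm_norm, inv_mul_cancel₀ hg0.ne']
  · intro x hx
    have h1 : x ∈ Ω ↔ φ x < 0 := (hsub hx).2
    rw [h1, hψ]
    constructor
    · intro h; exact mul_neg_of_pos_of_neg (by positivity) h
    · intro h; by_contra h'; exact absurd h (not_lt.2 (mul_nonneg (by positivity) (not_lt.1 h')))
  · simp [hψ, hφ.nonneg_of_mem_frontier hΩ hp]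

namespace IsBoundaryChart

variable {Ω : Set E3} {n a p : E3} {c : ℝ≥0} {r : ℝ} {ψ : E3 → ℝ}

theorem abs_sub_le (h : IsBoundaryChart Ω n a p c r ψ) {x x' : E3} (hx : x ∈ obliqueBox n a p r)
    (hx' : x' ∈ obliqueBox n a p r) : |ψ x - ψ x' - ⟪n, x - x'⟫| ≤ c * ‖x - x'‖ := by
  have := h.approx x hx x' hx'
  simpa using this

theorem small' (h : IsBoundaryChart Ω n a p c r ψ) : c * ‖a‖ < 1 := by
  have := h.small
  nlinarith [c.2, norm_nonneg a, show (0:ℝ) ≤ c from c.2]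

/-- Along `a` the linear part grows at rate `⟪n, a⟫ = 1`, while the deviation from it has rate at
most `c ‖a‖ < 1`. -/
theorem strictMono (h : IsBoundaryChart Ω n a p c r ψ) {x : E3} {s : ℝ} (hs : 0 < s)
    (hx : x ∈ obliqueBox n a p r) (hx' : x + s • a ∈ obliqueBox n a p r) : ψ x < ψ (x + s • a) := by
  have h1 := h.abs_sub_le hx' hx
  rw [add_sub_cancel_left, inner_smul_right, h.inner_n, norm_smul, Real.norm_eq_abs,
    abs_of_pos hs, abs_le] at h1
  nlinarith [h1.1, h.small']

theorem frontier_iff (h : IsBoundaryChart Ω n a p c r ψ) (hΩ : IsOpen Ω) {x : E3}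
    (hx : x ∈ obliqueBox n a p r) : x ∈ frontier Ω ↔ ψ x = 0 := by
  have hbox : obliqueBox n a p r ∈ 𝓝 x := (isOpen_obliqueBox n a p r).mem_nhds hx
  have hcont : ContinuousAt ψ x := h.approx.continuousOn.continuousAt hbox
  rw [hΩ.frontier_eq]
  constructor
  · rintro ⟨h1, h2⟩
    have h3 : 0 ≤ ψ x := not_lt.1 fun h' => h2 ((h.mem_iff x hx).2 h')
    refine le_antisymm ?_ h3
    by_contra hlt
    have := hcont.eventually (lt_mem_nhds (not_le.1 hlt))
    obtain ⟨z, hz⟩ := ((mem_closure_iff_frequently.1 h1).and_eventually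
      (this.and hbox)).exists
    exact absurd ((h.mem_iff z hz.2.2).1 hz.1) (not_lt.2 (le_of_lt hz.2.1))
  · intro h0
    refine ⟨?_, fun h' => absurd ((h.mem_iff x hx).1 h') (by simp [h0])⟩
    rw [mem_closure_iff_frequently]
    -- A zero of `ψ` is approached from inside `Ω` along `-a`, where monotonicity makes `ψ`
    -- negative.
    have ht : Filter.Tendsto (fun s : ℝ => x + (-s) • a) (𝓝[>] 0) (𝓝 x) := by
      have : ContinuousAt (fun s : ℝ => x + (-s) • a) 0 := by fun_prop
      have h2 := this.tendsto
      simp only [neg_zero, zero_smul, add_zero] at h2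
      exact h2.mono_left nhdsWithin_le_nhds
    refine ht.frequently (Filter.Eventually.frequently ?_)
    filter_upwards [ht.eventually hbox, self_mem_nhdsWithin] with s hs hs0
    rw [h.mem_iff _ hs, ← h0]
    have := h.strictMono (x := x + (-s) • a) hs0 hs (by simpa using hx)
    simpa using this

theorem mem_box_iff (h : IsBoundaryChart Ω n a p c r ψ) (z : ℝ × (ℝ ∙ n)ᗮ) :
    obliquePoint n a z ∈ obliqueBox n a p r ↔
      |z.1 - ⟪n, p⟫| < r ∧ ‖z.2 - obliqueProj n a p‖ < r := by
  simp only [obliqueBox, mem_ofPred_eq, inner_sub_right, inner_obliquePoint h.inner_n, map_sub,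
    obliqueProj_obliquePoint h.inner_n]

theorem box_coords {x : E3} (hx : x ∈ obliqueBox n a p r) :
    obliqueProj n a x ∈ Metric.ball (obliqueProj n a p) r := by
  rw [Metric.mem_ball, dist_eq_norm, ← map_sub]; exact hx.2

/-- The intermediate value theorem on the segment of half-length `r / 2` above `y`: `ψ` is close
enough to the height over `p` to have opposite signs at the two ends. -/
theorem exists_height (h : IsBoundaryChart Ω n a p c r ψ) {y : (ℝ ∙ n)ᗮ}
    (hy : y ∈ Metric.ball (obliqueProj n a p) r) :
    ∃ t, |t - ⟪n, p⟫| < r ∧ ψ (obliquePoint n a (t, y)) = 0 := by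
  have hr := h.r_pos
  rw [Metric.mem_ball, dist_eq_norm] at hy
  set t₀ := ⟪n, p⟫
  have hmem : ∀ t ∈ Icc (t₀ - r / 2) (t₀ + r / 2), obliquePoint n a (t, y) ∈ obliqueBox n a p r := by
    intro t ht
    rw [h.mem_box_iff]
    refine ⟨?_, hy⟩
    rw [abs_lt]; constructor <;> simp only <;> linarith [ht.1, ht.2]
  have hcont : ContinuousOn (fun t => ψ (obliquePoint n a (t, y))) (Icc (t₀ - r / 2) (t₀ + r / 2)) :=
    h.approx.continuousOn.comp
      ((continuous_obliquePoint n a).comp (by fun_prop)).continuousOn hmem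
  have hest : ∀ t ∈ Icc (t₀ - r / 2) (t₀ + r / 2),
      |ψ (obliquePoint n a (t, y)) - (t - t₀)| ≤ c * (r / 2 * ‖a‖ + r) := by
    intro t ht
    have h1 := h.abs_sub_le (hmem t ht) (self_mem_obliqueBox n a p hr)
    rw [h.zero, inner_sub_right, inner_obliquePoint h.inner_n] at h1
    have h2 : obliquePoint n a (t, y) - p = (t - t₀) • a + ((y - obliqueProj n a p : (ℝ ∙ n)ᗮ) : E3) := by
      conv_lhs => rw [← obliquePoint_coords h.inner_n p]
      simp only [obliquePoint, Submodule.coe_sub, sub_smul, t₀]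
      abel
    have h3 : ‖obliquePoint n a (t, y) - p‖ ≤ r / 2 * ‖a‖ + r := by
      rw [h2]
      refine (norm_add_le _ _).trans ?_
      rw [norm_smul, Real.norm_eq_abs, ← Submodule.coe_norm]
      have : |t - t₀| ≤ r / 2 := by rw [abs_le]; constructor <;> linarith [ht.1, ht.2]
      nlinarith [norm_nonneg a]
    simp only [sub_zero] at h1
    exact h1.trans (mul_le_mul_of_nonneg_left h3 c.2)
  -- This is the requirement behind the summand `2` in `small`: points of the segment are at
  -- distance at most `r / 2 * ‖a‖ + r` from `p`.
  have hsmall : c * (r / 2 * ‖a‖ + r) < r / 2 := by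
    have := h.small
    nlinarith
  have hlo := hest (t₀ - r / 2) ⟨le_rfl, by linarith⟩
  have hhi := hest (t₀ + r / 2) ⟨by linarith, le_rfl⟩
  rw [abs_le] at hlo hhi
  obtain ⟨t, ht, ht0⟩ := intermediate_value_Icc (by linarith) hcont
    (show (0 : ℝ) ∈ Icc _ _ from ⟨by linarith [hlo.2], by linarith [hhi.1]⟩)
  exact ⟨t, by rw [abs_lt]; constructor <;> linarith [ht.1, ht.2], ht0⟩

open Classical in
/-- The boundary point above `y`. -/
noncomputable def graphPoint (h : IsBoundaryChart Ω n a p c r ψ) (y : (ℝ ∙ n)ᗮ) : E3 :=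
  if hy : y ∈ Metric.ball (obliqueProj n a p) r then obliquePoint n a ((h.exists_height hy).choose, y)
  else p

theorem exists_graphPoint_eq (h : IsBoundaryChart Ω n a p c r ψ) {y : (ℝ ∙ n)ᗮ}
    (hy : y ∈ Metric.ball (obliqueProj n a p) r) :
    ∃ t, |t - ⟪n, p⟫| < r ∧ h.graphPoint y = obliquePoint n a (t, y) ∧ ψ (h.graphPoint y) = 0 := by
  refine ⟨(h.exists_height hy).choose, (h.exists_height hy).choose_spec.1, ?_, ?_⟩
  · rw [graphPoint, dif_pos hy]
  · rw [graphPoint, dif_pos hy]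
    exact (h.exists_height hy).choose_spec.2

theorem graphPoint_mem (h : IsBoundaryChart Ω n a p c r ψ) {y : (ℝ ∙ n)ᗮ}
    (hy : y ∈ Metric.ball (obliqueProj n a p) r) : h.graphPoint y ∈ obliqueBox n a p r := by
  obtain ⟨t, ht, he, -⟩ := h.exists_graphPoint_eq hy
  rw [he, h.mem_box_iff]
  rw [Metric.mem_ball, dist_eq_norm] at hy
  exact ⟨ht, hy⟩

theorem obliqueProj_graphPoint (h : IsBoundaryChart Ω n a p c r ψ) {y : (ℝ ∙ n)ᗮ}
    (hy : y ∈ Metric.ball (obliqueProj n a p) r) : obliqueProj n a (h.graphPoint y) = y := by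
  obtain ⟨t, ht, he, -⟩ := h.exists_graphPoint_eq hy
  rw [he, obliqueProj_obliquePoint h.inner_n]

theorem graphPoint_mem_frontier (h : IsBoundaryChart Ω n a p c r ψ) (hΩ : IsOpen Ω) {y : (ℝ ∙ n)ᗮ}
    (hy : y ∈ Metric.ball (obliqueProj n a p) r) : h.graphPoint y ∈ frontier Ω := by
  rw [h.frontier_iff hΩ (h.graphPoint_mem hy)]
  exact (h.exists_graphPoint_eq hy).choose_spec.2.2

/-- Both values of `ψ` vanish, so only the linear part is left in the approximation estimate. Chords
of the boundary are thus almost orthogonal to `n`, which gives both Lipschitz bounds for the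
projection. -/
theorem abs_inner_le (h : IsBoundaryChart Ω n a p c r ψ) (hΩ : IsOpen Ω) {x x' : E3}
    (hx : x ∈ frontier Ω ∩ obliqueBox n a p r) (hx' : x' ∈ frontier Ω ∩ obliqueBox n a p r) :
    |⟪n, x - x'⟫| ≤ c * ‖x - x'‖ := by
  have := h.abs_sub_le hx.2 hx'.2
  rw [(h.frontier_iff hΩ hx.2).1 hx.1, (h.frontier_iff hΩ hx'.2).1 hx'.1] at this
  simpa using this

theorem norm_proj_le (h : IsBoundaryChart Ω n a p c r ψ) (hΩ : IsOpen Ω) {x x' : E3}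
    (hx : x ∈ frontier Ω ∩ obliqueBox n a p r) (hx' : x' ∈ frontier Ω ∩ obliqueBox n a p r) :
    ‖obliqueProj n a x - obliqueProj n a x'‖ ≤ (1 + c * ‖a‖) * ‖x - x'‖ := by
  have h1 := h.abs_inner_le hΩ hx hx'
  rw [← map_sub, Submodule.coe_norm, coe_obliqueProj h.inner_n]
  refine (norm_sub_le _ _).trans ?_
  rw [norm_smul, Real.norm_eq_abs]
  nlinarith [norm_nonneg a]

theorem le_norm_proj (h : IsBoundaryChart Ω n a p c r ψ) (hΩ : IsOpen Ω) {x x' : E3}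
    (hx : x ∈ frontier Ω ∩ obliqueBox n a p r) (hx' : x' ∈ frontier Ω ∩ obliqueBox n a p r) :
    (1 - c * ‖a‖) * ‖x - x'‖ ≤ ‖obliqueProj n a x - obliqueProj n a x'‖ := by
  have h1 := h.abs_inner_le hΩ hx hx'
  rw [← map_sub, Submodule.coe_norm, coe_obliqueProj h.inner_n]
  have h2 := norm_sub_norm_le (x - x') (⟪n, x - x'⟫ • a)
  rw [norm_smul, Real.norm_eq_abs] at h2
  nlinarith [norm_nonneg a]

theorem graphPoint_obliqueProj (h : IsBoundaryChart Ω n a p c r ψ) (hΩ : IsOpen Ω) {x : E3}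
    (hx : x ∈ frontier Ω ∩ obliqueBox n a p r) : h.graphPoint (obliqueProj n a x) = x := by
  have hy := box_coords hx.2
  have h1 := h.le_norm_proj hΩ ⟨h.graphPoint_mem_frontier hΩ hy, h.graphPoint_mem hy⟩ hx
  rw [h.obliqueProj_graphPoint hy, sub_self, norm_zero] at h1
  have h2 : 0 < 1 - c * ‖a‖ := by linarith [h.small']
  have h3 : ‖h.graphPoint (obliqueProj n a x) - x‖ = 0 :=
    le_antisymm (by nlinarith) (norm_nonneg _)
  exact sub_eq_zero.1 (norm_eq_zero.1 h3)

/-- Lipschitz constant of the projection of the boundary and of its inverse. -/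
noncomputable def lip (c : ℝ≥0) (a : E3) : ℝ≥0 := (1 - c * ‖a‖₊)⁻¹

theorem coe_lip (h : IsBoundaryChart Ω n a p c r ψ) : (lip c a : ℝ) = (1 - c * ‖a‖)⁻¹ := by
  have : c * ‖a‖₊ ≤ 1 := by
    rw [← NNReal.coe_le_coe]; push_cast; exact h.small'.le
  simp [lip, NNReal.coe_sub this]

/-- This is `(1 + x) (1 - x) ≤ 1`; it lets one constant serve for the projection and for its
inverse. -/
theorem le_lip (h : IsBoundaryChart Ω n a p c r ψ) : 1 + c * ‖a‖ ≤ lip c a := by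
  rw [h.coe_lip]
  have := h.small'
  rw [le_inv_comm₀ (by positivity) (by linarith), inv_eq_one_div, le_div_iff₀ (by positivity)]
  nlinarith [mul_nonneg c.2 (norm_nonneg a), sq_nonneg (c * ‖a‖ : ℝ)]

theorem lipschitzOnWith_proj (h : IsBoundaryChart Ω n a p c r ψ) (hΩ : IsOpen Ω) :
    LipschitzOnWith (lip c a) (obliqueProj n a) (frontier Ω ∩ obliqueBox n a p r) := by
  refine LipschitzOnWith.of_dist_le_mul fun x hx x' hx' => ?_
  rw [dist_eq_norm, dist_eq_norm]
  exact (h.norm_proj_le hΩ hx hx').trans (mul_le_mul_of_nonneg_right h.le_lip (norm_nonneg _))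

theorem lipschitzOnWith_graphPoint (h : IsBoundaryChart Ω n a p c r ψ) (hΩ : IsOpen Ω) :
    LipschitzOnWith (lip c a) h.graphPoint (Metric.ball (obliqueProj n a p) r) := by
  refine LipschitzOnWith.of_dist_le_mul fun y hy y' hy' => ?_
  rw [dist_eq_norm, dist_eq_norm]
  have := h.le_norm_proj hΩ ⟨h.graphPoint_mem_frontier hΩ hy, h.graphPoint_mem hy⟩
    ⟨h.graphPoint_mem_frontier hΩ hy', h.graphPoint_mem hy'⟩
  rw [h.obliqueProj_graphPoint hy, h.obliqueProj_graphPoint hy'] at this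
  have h2 : 0 < 1 - c * ‖a‖ := by linarith [h.small']
  rw [h.coe_lip, inv_mul_eq_div, le_div_iff₀ h2]
  linarith

/-- The measure on the boundary that projects to the area measure. -/
noncomputable def projMeasure (h : IsBoundaryChart Ω n a p c r ψ) : Measure E3 :=
  (volume.restrict (Metric.ball (obliqueProj n a p) r)).map h.graphPoint

theorem aemeasurable_graphPoint (h : IsBoundaryChart Ω n a p c r ψ) (hΩ : IsOpen Ω) :
    AEMeasurable h.graphPoint (volume.restrict (Metric.ball (obliqueProj n a p) r)) :=
  (h.lipschitzOnWith_graphPoint hΩ).continuousOn.aemeasurable Metric.isOpen_ball.measurableSet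

theorem projMeasure_apply (h : IsBoundaryChart Ω n a p c r ψ) (hΩ : IsOpen Ω) {s : Set E3}
    (hs : MeasurableSet s) :
    h.projMeasure s = volume (obliqueProj n a '' (s ∩ (frontier Ω ∩ obliqueBox n a p r))) := by
  rw [projMeasure, Measure.map_apply_of_aemeasurable (h.aemeasurable_graphPoint hΩ) hs,
    Measure.restrict_apply' Metric.isOpen_ball.measurableSet]
  congr 1
  ext y
  constructor
  · rintro ⟨h1, h2⟩
    exact ⟨_, ⟨h1, h.graphPoint_mem_frontier hΩ h2, h.graphPoint_mem h2⟩, h.obliqueProj_graphPoint h2⟩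
  · rintro ⟨x, ⟨h1, h2⟩, rfl⟩
    refine ⟨?_, box_coords h2.2⟩
    rw [mem_preimage, h.graphPoint_obliqueProj hΩ h2]
    exact h1

/-- With Lebesgue measure on the plane `nᗮ` recognized as a Hausdorff measure, the Lipschitz image
estimate compares it directly with the surface measure. -/
theorem volume_eq_hausdorff (h : IsBoundaryChart Ω n a p c r ψ) :
    (volume : Measure (ℝ ∙ n)ᗮ) = Measure.euclideanHausdorffMeasure 2 := by
  have hne : n ≠ 0 := by
    rintro rfl; simpa using h.norm_n
  have hdim : Module.finrank ℝ (ℝ ∙ n)ᗮ = 2 := by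
    have := Submodule.finrank_add_finrank_orthogonal (ℝ ∙ n)
    rw [finrank_span_singleton hne, finrank_euclideanSpace_fin] at this
    omega
  rw [← InnerProductSpace.euclideanHausdorffMeasure_eq_volume, hdim]

theorem surfaceMeasure_restrict_apply {s : Set E3} (hs : MeasurableSet s) :
    (surfaceMeasure Ω).restrict (obliqueBox n a p r) s
      = Measure.euclideanHausdorffMeasure 2 (s ∩ (frontier Ω ∩ obliqueBox n a p r)) := by
  rw [surfaceMeasure, Measure.restrict_restrict (isOpen_obliqueBox n a p r).measurableSet,
    Measure.restrict_apply hs, inter_comm (frontier Ω)]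

/-- A `K`-Lipschitz map enlarges two-dimensional Hausdorff measure by at most `K ^ 2`. This bound
and the reverse one below, from the inverse map, take the place of the area formula. -/
theorem projMeasure_le (h : IsBoundaryChart Ω n a p c r ψ) (hΩ : IsOpen Ω) :
    h.projMeasure ≤ (lip c a ^ 2) • (surfaceMeasure Ω).restrict (obliqueBox n a p r) := by
  refine Measure.le_iff.2 fun s hs => ?_
  rw [h.projMeasure_apply hΩ hs, Measure.smul_apply, surfaceMeasure_restrict_apply hs,
    h.volume_eq_hausdorff]
  have := euclideanHausdorffMeasure_image_le ((h.lipschitzOnWith_proj hΩ).mono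
    (inter_subset_right (s := s))) 2
  simpa [ENNReal.smul_def] using this

theorem le_projMeasure (h : IsBoundaryChart Ω n a p c r ψ) (hΩ : IsOpen Ω) :
    (surfaceMeasure Ω).restrict (obliqueBox n a p r) ≤ (lip c a ^ 2) • h.projMeasure := by
  refine Measure.le_iff.2 fun s hs => ?_
  rw [Measure.smul_apply, h.projMeasure_apply hΩ hs, surfaceMeasure_restrict_apply hs,
    h.volume_eq_hausdorff]
  have hsub : obliqueProj n a '' (s ∩ (frontier Ω ∩ obliqueBox n a p r)) ⊆
      Metric.ball (obliqueProj n a p) r := by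
    rintro _ ⟨x, hx, rfl⟩
    exact box_coords hx.2.2
  have := euclideanHausdorffMeasure_image_le ((h.lipschitzOnWith_graphPoint hΩ).mono hsub) 2
  have hset : h.graphPoint '' (obliqueProj n a '' (s ∩ (frontier Ω ∩ obliqueBox n a p r)))
      = s ∩ (frontier Ω ∩ obliqueBox n a p r) := by
    rw [image_image]
    conv_rhs => rw [← image_id (s ∩ (frontier Ω ∩ obliqueBox n a p r))]
    exact image_congr fun x hx => h.graphPoint_obliqueProj hΩ hx.2
  rw [hset] at this
  simpa [ENNReal.smul_def] using this

theorem surfaceMeasure_box_lt_top (h : IsBoundaryChart Ω n a p c r ψ) (hΩ : IsOpen Ω) :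
    surfaceMeasure Ω (obliqueBox n a p r) < ∞ := by
  have h1 := Measure.le_iff'.1 (h.le_projMeasure hΩ) univ
  rw [Measure.restrict_apply_univ, Measure.smul_apply, projMeasure,
    Measure.map_apply_of_aemeasurable (h.aemeasurable_graphPoint hΩ) MeasurableSet.univ, preimage_univ,
    Measure.restrict_apply_univ] at h1
  refine h1.trans_lt ?_
  rw [ENNReal.smul_def, smul_eq_mul]
  exact ENNReal.mul_lt_top ENNReal.coe_lt_top measure_ball_lt_top

end IsBoundaryChart

end LinearR13

namespace LinearR13

open scoped NNReal ENNReal RealInnerProductSpace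

/-! ### Integration by parts near a boundary point -/

theorem integrable_fderiv_apply {f : E3 → ℝ} (hf : ContDiff ℝ 1 f) (hc : HasCompactSupport f)
    (a : E3) : Integrable fun x => fderiv ℝ f x a := by
  have h1 : Continuous fun x => fderiv ℝ f x a :=
    (hf.continuous_fderiv (by norm_num)).clm_apply continuous_const
  exact h1.integrable_of_hasCompactSupport (hc.fderiv_apply ℝ a)

namespace IsBoundaryChart

variable {Ω : Set E3} {n a p : E3} {c : ℝ≥0} {r : ℝ} {ψ : E3 → ℝ}

theorem mem_iff_lt (h : IsBoundaryChart Ω n a p c r ψ) {y : (ℝ ∙ n)ᗮ} {t s : ℝ}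
    (ht : obliquePoint n a (t, y) ∈ obliqueBox n a p r)
    (hs : obliquePoint n a (s, y) ∈ obliqueBox n a p r) (h0 : ψ (obliquePoint n a (s, y)) = 0) :
    obliquePoint n a (t, y) ∈ Ω ↔ t < s := by
  have hadd : ∀ u v : ℝ, obliquePoint n a (u, y) + (v - u) • a = obliquePoint n a (v, y) := by
    intro u v; simp only [obliquePoint, sub_smul]; abel
  rw [h.mem_iff _ ht]
  rcases lt_trichotomy t s with hlt | rfl | hgt
  · have := h.strictMono (sub_pos.2 hlt) ht (by rwa [hadd])
    rw [hadd, h0] at this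
    exact iff_of_true this hlt
  · rw [h0]; exact iff_of_false (lt_irrefl _) (lt_irrefl _)
  · have := h.strictMono (sub_pos.2 hgt) hs (by rwa [hadd])
    rw [hadd, h0] at this
    exact iff_of_false this.not_gt hgt.not_gt

/-- Inside the box a line parallel to `a` meets `Ω` exactly below the boundary point. The
fundamental theorem of calculus therefore leaves the value of `f` at that point; the lower end
contributes nothing by compact support. -/
theorem integral_line (h : IsBoundaryChart Ω n a p c r ψ) {f : E3 → ℝ} (hf : ContDiff ℝ 1 f)
    (hsupp : tsupport f ⊆ obliqueBox n a p r) (y : (ℝ ∙ n)ᗮ) :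
    ∫ t : ℝ, Ω.indicator (fun x => fderiv ℝ f x a) (obliquePoint n a (t, y)) =
      (Metric.ball (obliqueProj n a p) r).indicator (fun y => f (h.graphPoint y)) y := by
  have hzero : ∀ x, x ∉ obliqueBox n a p r → fderiv ℝ f x a = 0 := by
    intro x hx
    rw [fderiv_of_notMem_tsupport (𝕜 := ℝ) (f := f) (fun h' => hx (hsupp h'))]; rfl
  by_cases hy : y ∈ Metric.ball (obliqueProj n a p) r
  · rw [indicator_of_mem hy]
    obtain ⟨s, hs, hs1, hs0⟩ := h.exists_graphPoint_eq hy
    have hsm := h.graphPoint_mem hy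
    rw [hs1] at hs0 hsm
    rw [hs1]
    set F : ℝ → ℝ := fun t => f (obliquePoint n a (t, y)) with hF
    have hlin : ∀ t, HasDerivAt (fun t => obliquePoint n a (t, y)) a t := by
      intro t
      have := ((hasDerivAt_id t).smul_const a).add_const (y : E3)
      simpa [obliquePoint] using this
    have hd : ∀ t, HasDerivAt F (fderiv ℝ f (obliquePoint n a (t, y)) a) t := fun t =>
      ((hf.differentiable (by norm_num)).differentiableAt.hasFDerivAt).comp_hasDerivAt t (hlin t)
    have hFc : ContDiff ℝ 1 F := by
      refine hf.comp ?_
      exact (contDiff_id.smul contDiff_const).add (contDiff_const (c := (y : E3)))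
    have hFs : HasCompactSupport F := by
      refine HasCompactSupport.intro (isCompact_Icc (a := ⟪n, p⟫ - r) (b := ⟪n, p⟫ + r)) ?_
      intro t ht
      refine image_eq_zero_of_notMem_tsupport (f := f) fun h' => ht ?_
      have := ((h.mem_box_iff (t, y)).1 (hsupp h')).1
      rw [abs_lt] at this
      constructor <;> linarith [this.1, this.2]
    classical
    -- Outside the box nothing is known about `Ω`, but there the derivative of `f` vanishes, so both
    -- indicators agree.
    have hcongr : (fun t => Ω.indicator (fun x => fderiv ℝ f x a) (obliquePoint n a (t, y)))
        = (Iio s).indicator (deriv F) := by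
      ext t
      simp only [indicator_apply, (hd t).deriv, mem_Iio]
      by_cases ht : obliquePoint n a (t, y) ∈ obliqueBox n a p r
      · simp only [h.mem_iff_lt ht hsm hs0]
      · rw [hzero _ ht]; simp
    rw [hcongr, integral_indicator measurableSet_Iio, ← integral_Iic_eq_integral_Iio,
      hFs.integral_Iic_deriv_eq hFc]
  · rw [indicator_of_notMem hy]
    refine (integral_congr_ae (Filter.Eventually.of_forall fun t => ?_)).trans (integral_zero _ _)
    classical
    rw [indicator_apply, hzero, ite_self]
    rw [h.mem_box_iff]
    rw [Metric.mem_ball, dist_eq_norm] at hy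
    exact fun h' => hy h'.2

theorem integral_fderiv_eq (h : IsBoundaryChart Ω n a p c r ψ) (hΩ : IsOpen Ω) {f : E3 → ℝ}
    (hf : ContDiff ℝ 1 f) (hc : HasCompactSupport f) (hsupp : tsupport f ⊆ obliqueBox n a p r) :
    ∫ x in Ω, fderiv ℝ f x a = ∫ x, f x ∂h.projMeasure := by
  rw [← integral_indicator hΩ.measurableSet, integral_eq_integral_oblique h.norm_n h.inner_n
    ((integrable_fderiv_apply hf hc a).indicator hΩ.measurableSet), projMeasure,
    integral_map (h.aemeasurable_graphPoint hΩ) hf.continuous.aestronglyMeasurable,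
    ← integral_indicator Metric.isOpen_ball.measurableSet]
  exact integral_congr_ae (Filter.Eventually.of_forall fun y => h.integral_line hf hsupp y)

end IsBoundaryChart

theorem exists_small_lip (a : E3) {ε : ℝ≥0} (hε : 0 < ε) :
    ∃ c : ℝ≥0, 0 < c ∧ c * (‖a‖ + 2) < 1 ∧ IsBoundaryChart.lip c a ^ 2 ≤ 1 + ε := by
  have h1 : Filter.Tendsto (fun c : ℝ≥0 => IsBoundaryChart.lip c a ^ 2) (𝓝 0) (𝓝 1) := by
    have : ContinuousAt (fun c : ℝ≥0 => IsBoundaryChart.lip c a ^ 2) 0 := by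
      unfold IsBoundaryChart.lip
      refine ContinuousAt.pow (ContinuousAt.inv₀ (by fun_prop) (by simp)) 2
    simpa [ContinuousAt, IsBoundaryChart.lip] using this
  have h2 : Filter.Tendsto (fun c : ℝ≥0 => (c : ℝ) * (‖a‖ + 2)) (𝓝 0) (𝓝 0) := by
    have : ContinuousAt (fun c : ℝ≥0 => (c : ℝ) * (‖a‖ + 2)) 0 := by fun_prop
    simpa [ContinuousAt] using this
  have h3 := (h1.eventually (ge_mem_nhds (show (1 : ℝ≥0) < 1 + ε by simpa using hε))).and
    (h2.eventually (gt_mem_nhds (show (0 : ℝ) < 1 by norm_num)))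
  obtain ⟨c, hc, hc0⟩ := ((h3.filter_mono (nhdsWithin_le_nhds (s := Ioi 0))).and
    self_mem_nhdsWithin).exists
  exact ⟨c, hc0, hc.2, hc.1⟩

theorem setIntegral_eq_of_tsupport {X : Type*} [TopologicalSpace X] [MeasurableSpace X]
    {μ : Measure X} {U : Set X} {f : X → ℝ} (h : tsupport f ⊆ U) :
    ∫ x in U, f x ∂μ = ∫ x, f x ∂μ :=
  setIntegral_eq_integral_of_forall_compl_eq_zero fun _ hx =>
    image_eq_zero_of_notMem_tsupport fun h' => hx (h h')

/-- Approximate divergence theorem in a direction `a` with `⟪n, a⟫ = 1`. -/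
theorem exists_nhds_abs_integral_sub_le_of_inner_eq_one {Ω : Set E3} (hΩ : IsOpen Ω) {p n a : E3}
    (hp : p ∈ frontier Ω) (hn : IsOuterNormal Ω p n) (ha : ⟪n, a⟫ = 1) {ε : ℝ≥0} (hε : 0 < ε) :
    ∃ U, IsOpen U ∧ p ∈ U ∧ surfaceMeasure Ω U < ∞ ∧
      ∀ f : E3 → ℝ, ContDiff ℝ 1 f → HasCompactSupport f → tsupport f ⊆ U →
        |(∫ x in Ω, fderiv ℝ f x a) - ∫ x, f x ∂surfaceMeasure Ω|
          ≤ ε * ∫ x, |f x| ∂surfaceMeasure Ω := by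
  obtain ⟨c, hc, hca, hl⟩ := exists_small_lip a hε
  obtain ⟨r, ψ, h, -⟩ := exists_isBoundaryChart hΩ hp hn ha hc hca Filter.univ_mem
  refine ⟨obliqueBox n a p r, isOpen_obliqueBox _ _ _ _, self_mem_obliqueBox _ _ _ h.r_pos,
    h.surfaceMeasure_box_lt_top hΩ, fun f hf hfc hs => ?_⟩
  have hfin : IsFiniteMeasure ((surfaceMeasure Ω).restrict (obliqueBox n a p r)) :=
    ⟨by rw [Measure.restrict_apply_univ]; exact h.surfaceMeasure_box_lt_top hΩ⟩
  have hsmul : ∀ μ : Measure E3, IsBoundaryChart.lip c a ^ 2 • μ ≤ (1 + ε) • μ := by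
    intro μ
    refine Measure.le_iff'.2 fun s => ?_
    simp only [Measure.smul_apply, ENNReal.smul_def, smul_eq_mul]
    exact mul_le_mul_left (by exact_mod_cast hl) _
  have hs' : tsupport (fun x => |f x|) ⊆ obliqueBox n a p r :=
    (tsupport_comp_subset (g := fun y : ℝ => |y|) (by simp) f).trans hs
  rw [h.integral_fderiv_eq hΩ hf hfc hs, ← setIntegral_eq_of_tsupport (μ := surfaceMeasure Ω) hs,
    ← setIntegral_eq_of_tsupport (μ := surfaceMeasure Ω) hs']
  refine abs_integral_sub_le_of_comparable ((h.projMeasure_le hΩ).trans (hsmul _))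
    ((h.le_projMeasure hΩ).trans (hsmul _)) ?_
  exact hf.continuous.integrable_of_hasCompactSupport hfc

/-! ### The outer normal -/

/-- A direction in which `φ` decreases to first order leads into `Ω`, hence into `{ψ < 0}`, so `ψ`
cannot increase to first order along it. -/
theorem IsDefiningFunction.inner_nonpos {Ω : Set E3} {p b : E3} {φ ψ : E3 → ℝ}
    (h : IsDefiningFunction Ω p φ) (h' : IsDefiningFunction Ω p ψ) (h0 : φ p = 0) (h0' : ψ p = 0)
    (hb : ⟪gradient φ p, b⟫ < 0) : ⟪gradient ψ p, b⟫ ≤ 0 := by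
  have hlin : HasDerivAt (fun s : ℝ => p + s • b) b 0 := by
    simpa using ((hasDerivAt_id (0 : ℝ)).smul_const b).const_add p
  have key : ∀ χ : E3 → ℝ, IsDefiningFunction Ω p χ →
      HasDerivAt (fun s : ℝ => χ (p + s • b)) ⟪gradient χ p, b⟫ 0 := by
    intro χ hχ
    have h1 := (hχ.1.differentiableAt (by norm_num)).hasFDerivAt
    have h2 : HasFDerivAt χ (fderiv ℝ χ p) (p + (0 : ℝ) • b) := by simpa using h1
    have h3 := h2.comp_hasDerivAt (0 : ℝ) hlin
    have h4 : ⟪gradient χ p, b⟫ = fderiv ℝ χ p b := by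
      rw [gradient, InnerProductSpace.toDual_symm_apply]
    rw [h4]; exact h3
  have hlim : Filter.Tendsto (fun s : ℝ => p + s • b) (𝓝[>] 0) (𝓝 p) := by
    have := hlin.continuousAt.tendsto
    simp only [zero_smul, add_zero] at this
    exact this.mono_left nhdsWithin_le_nhds
  have hsub : Ioi (0 : ℝ) ⊆ {0}ᶜ := fun _ hx => ne_of_gt hx
  have d1 := (hasDerivAt_iff_tendsto_slope.1 (key φ h)).mono_left
    (nhdsWithin_mono 0 hsub)
  have d2 := (hasDerivAt_iff_tendsto_slope.1 (key ψ h')).mono_left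
    (nhdsWithin_mono 0 hsub)
  refine le_of_tendsto d2 ?_
  filter_upwards [d1.eventually (gt_mem_nhds hb), hlim.eventually h.2.2, hlim.eventually h'.2.2,
    self_mem_nhdsWithin] with s hs1 hs2 hs3 hs0
  have hs0' : (0 : ℝ) < s := hs0
  simp only [slope_def_field, zero_smul, add_zero, h0, h0', sub_zero] at hs1 ⊢
  have h5 : φ (p + s • b) < 0 := by
    rw [div_lt_iff₀ hs0'] at hs1; linarith
  have h6 := hs3.1 (hs2.2 h5)
  exact div_nonpos_of_nonpos_of_nonneg h6.le hs0'.le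

theorem norm_eq_one_of_isOuterNormal {Ω : Set E3} {p n : E3} (h : IsOuterNormal Ω p n) :
    ‖n‖ = 1 := by
  obtain ⟨φ, hφ, rfl⟩ := h
  rw [norm_smul, norm_inv, norm_norm, inv_mul_cancel₀ (norm_ne_zero_iff.2 hφ.2.1)]

theorem IsOuterNormal.unique {Ω : Set E3} (hΩ : IsOpen Ω) {p n n' : E3} (hp : p ∈ frontier Ω)
    (h : IsOuterNormal Ω p n) (h' : IsOuterNormal Ω p n') : n = n' := by
  have hn := norm_eq_one_of_isOuterNormal h
  have hn' := norm_eq_one_of_isOuterNormal h'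
  obtain ⟨φ, hφ, e⟩ := h
  obtain ⟨φ', hφ', e'⟩ := h'
  have g1 : 0 < ‖gradient φ p‖⁻¹ := inv_pos.2 (norm_pos_iff.2 hφ.2.1)
  have g2 : 0 < ‖gradient φ' p‖⁻¹ := inv_pos.2 (norm_pos_iff.2 hφ'.2.1)
  by_contra hne
  -- If the normals differed, the direction `n' - n` would point into `Ω` for one defining function
  -- and out of it for the other.
  have hlt : ⟪n, n'⟫ < 1 := inner_lt_one_iff_real_of_norm_eq_one hn hn' |>.2 hne
  have a1 : ⟪n, n' - n⟫ < 0 := by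
    rw [inner_sub_right, real_inner_self_eq_norm_sq, hn]; linarith
  have a2 : 0 < ⟪n', n' - n⟫ := by
    rw [inner_sub_right, real_inner_self_eq_norm_sq, hn', real_inner_comm]; linarith
  have b1 : ⟪gradient φ p, n' - n⟫ < 0 := by
    have : ⟪n, n' - n⟫ = ‖gradient φ p‖⁻¹ * ⟪gradient φ p, n' - n⟫ := by
      rw [← real_inner_smul_left, ← e]
    rw [this] at a1
    exact (pos_iff_neg_of_mul_neg a1).1 g1
  have b2 := hφ.inner_nonpos hφ' (hφ.nonneg_of_mem_frontier hΩ hp) (hφ'.nonneg_of_mem_frontier hΩ hp) b1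
  have : ⟪n', n' - n⟫ = ‖gradient φ' p‖⁻¹ * ⟪gradient φ' p, n' - n⟫ := by
    rw [← real_inner_smul_left, ← e']
  rw [this] at a2
  exact absurd b2 (not_le.2 ((pos_iff_pos_of_mul_pos a2).1 g2))

/-- One defining function works at all nearby boundary points. By uniqueness `N` is its normalized
gradient there, and this is continuous. -/
theorem continuousOn_outerNormal {Ω : Set E3} (hΩ : IsOpen Ω) {N : E3 → E3}
    (hN : ∀ x ∈ frontier Ω, IsOuterNormal Ω x (N x)) : ContinuousOn N (frontier Ω) := by
  intro p hp
  obtain ⟨φ, hφ, hφN⟩ := hN p hp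
  have hgc : ContinuousAt (gradient φ) p := by
    have h1 : ContinuousAt (fderiv ℝ φ) p :=
      (hφ.1.fderiv_right (m := 0) (by norm_num)).continuousAt
    exact (LinearIsometryEquiv.continuous _).continuousAt.comp h1
  have hev : ∀ᶠ x in 𝓝 p, IsDefiningFunction Ω x φ := by
    filter_upwards [hφ.1.eventually (by simp), hgc.eventually_ne hφ.2.1, hφ.2.2.eventually_nhds]
      with x h1 h2 h3 using ⟨h1, h2, h3⟩
  have hc : ContinuousAt (fun x => ‖gradient φ x‖⁻¹ • gradient φ x) p :=
    (hgc.norm.inv₀ (norm_ne_zero_iff.2 hφ.2.1)).smul hgc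
  refine hc.continuousWithinAt.congr_of_eventuallyEq ?_ hφN
  filter_upwards [nhdsWithin_le_nhds hev, self_mem_nhdsWithin] with x h1 h2
  exact (hN x h2).unique hΩ h2 ⟨φ, h1, rfl⟩

end LinearR13

namespace LinearR13

open scoped NNReal ENNReal RealInnerProductSpace

/-! ### The surface measure -/

theorem IsC1Domain.exists_normal {Ω : Set E3} (hΩ : IsC1Domain Ω) {p : E3} (hp : p ∈ frontier Ω) :
    ∃ n, IsOuterNormal Ω p n := by
  obtain ⟨φ, hφ⟩ := hΩ.boundary p hp
  exact ⟨_, φ, hφ, rfl⟩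

theorem IsC1Domain.isCompact_closure {Ω : Set E3} (hΩ : IsC1Domain Ω) : IsCompact (closure Ω) :=
  hΩ.isBounded.isCompact_closure

theorem IsC1Domain.isCompact_frontier {Ω : Set E3} (hΩ : IsC1Domain Ω) : IsCompact (frontier Ω) :=
  hΩ.isCompact_closure.of_isClosed_subset isClosed_frontier frontier_subset_closure

theorem real_inner_self_of_norm_one {n : E3} (h : ‖n‖ = 1) : ⟪n, n⟫ = 1 := by
  rw [real_inner_self_eq_norm_sq, h, one_pow]

/-- Boxes have finite surface measure by comparison with a disc, and the boundary is compact; the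
choices `a = n` and `ε = 1` are arbitrary. -/
theorem IsC1Domain.isFiniteMeasure {Ω : Set E3} (hΩ : IsC1Domain Ω) :
    IsFiniteMeasure (surfaceMeasure Ω) := by
  have h1 : surfaceMeasure Ω (frontier Ω) < ∞ := by
    refine hΩ.isCompact_frontier.measure_lt_top_of_nhdsWithin fun p hp => ?_
    obtain ⟨n, hn⟩ := hΩ.exists_normal hp
    obtain ⟨U, hU, hpU, hfin, -⟩ := exists_nhds_abs_integral_sub_le_of_inner_eq_one hΩ.isOpen hp hn
      (real_inner_self_of_norm_one (norm_eq_one_of_isOuterNormal hn)) (zero_lt_one (α := ℝ≥0))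
    exact ⟨U, mem_nhdsWithin_of_mem_nhds (hU.mem_nhds hpU), hfin⟩
  refine ⟨?_⟩
  rw [surfaceMeasure, Measure.restrict_apply_self] at h1
  rwa [surfaceMeasure, Measure.restrict_apply_univ]

theorem ae_surfaceMeasure_mem {Ω : Set E3} : ∀ᵐ x ∂surfaceMeasure Ω, x ∈ frontier Ω :=
  ae_restrict_mem isClosed_frontier.measurableSet

theorem IsC1Domain.aestronglyMeasurable {Ω : Set E3} {f : E3 → ℝ}
    (hf : ContinuousOn f (frontier Ω)) : AEStronglyMeasurable f (surfaceMeasure Ω) :=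
  hf.aestronglyMeasurable isClosed_frontier.measurableSet

theorem IsC1Domain.integrable {Ω : Set E3} (hΩ : IsC1Domain Ω) {f : E3 → ℝ}
    (hf : ContinuousOn f (frontier Ω)) : Integrable f (surfaceMeasure Ω) := by
  have := hΩ.isFiniteMeasure
  obtain ⟨C, hC⟩ := hΩ.isCompact_frontier.exists_bound_of_continuousOn hf
  exact Integrable.of_bound (IsC1Domain.aestronglyMeasurable hf) C
    (ae_surfaceMeasure_mem.mono fun x hx => hC x hx)

/-! ### The divergence theorem -/

/-- The divergence theorem in direction `b` holds for `f` up to an error `ε ∫ |f| ds`. -/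
def DivergenceUpTo (Ω : Set E3) (N : E3 → E3) (b : E3) (ε : ℝ) (f : E3 → ℝ) : Prop :=
  |(∫ x in Ω, fderiv ℝ f x b) - ∫ x, f x * ⟪N x, b⟫ ∂surfaceMeasure Ω|
    ≤ ε * ∫ x, |f x| ∂surfaceMeasure Ω

/-- An arbitrary `b` is a combination of two directions with normal component one, `b + (1 - β) n`
and `n`, where `β = ⟪n, b⟫`. This also covers tangential and inward directions. Continuity of the
normal then replaces the constant `β` by `⟪N x, b⟫`. -/
theorem IsC1Domain.exists_nhds_divergenceUpTo_of_mem_frontier {Ω : Set E3} (hΩ : IsC1Domain Ω)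
    {N : E3 → E3} (hN : ∀ x ∈ frontier Ω, IsOuterNormal Ω x (N x)) {p : E3} (hp : p ∈ frontier Ω)
    (b : E3) {ε : ℝ} (hε : 0 < ε) :
    ∃ U, IsOpen U ∧ p ∈ U ∧ ∀ f : E3 → ℝ, ContDiff ℝ 1 f → HasCompactSupport f → tsupport f ⊆ U →
      DivergenceUpTo Ω N b ε f := by
  have hn1 := norm_eq_one_of_isOuterNormal (hN p hp)
  set n := N p with hn
  set β := ⟪n, b⟫ with hβ
  have hD : 0 < 2 + |1 - β| := by positivity
  -- Three errors are to be absorbed: `δ` for `b + (1 - β) n`, `|1 - β| δ` for the multiple of `n`,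
  -- and `δ` for the variation of the normal.
  obtain ⟨δ, hδ⟩ : ∃ δ : ℝ≥0, (δ : ℝ) = ε / (2 + |1 - β|) := ⟨⟨_, by positivity⟩, rfl⟩
  have hδ0 : 0 < δ := by rw [← NNReal.coe_pos, hδ]; positivity
  have hnn := real_inner_self_of_norm_one hn1
  have ha : ⟪n, b + (1 - β) • n⟫ = 1 := by
    rw [inner_add_right, inner_smul_right, hnn]; ring
  obtain ⟨U₁, o₁, p₁, -, h₁⟩ := exists_nhds_abs_integral_sub_le_of_inner_eq_one hΩ.isOpen hp
    (hN p hp) hnn hδ0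
  obtain ⟨U₂, o₂, p₂, -, h₂⟩ := exists_nhds_abs_integral_sub_le_of_inner_eq_one hΩ.isOpen hp
    (hN p hp) ha hδ0
  have hNc := continuousOn_outerNormal hΩ.isOpen hN
  have hNb : ContinuousOn (fun x => ⟪N x, b⟫) (frontier Ω) := hNc.inner continuousOn_const
  have hev : ∀ᶠ x in 𝓝[frontier Ω] p, |⟪N x, b⟫ - β| < δ := by
    have := (hNb p hp).tendsto.sub_const β
    rw [sub_self] at this
    have := this.abs
    rw [abs_zero] at this
    exact this.eventually (gt_mem_nhds (NNReal.coe_pos.2 hδ0))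
  obtain ⟨U₃, o₃, p₃, h₃⟩ := mem_nhdsWithin.1 hev
  refine ⟨U₁ ∩ U₂ ∩ U₃, (o₁.inter o₂).inter o₃, ⟨⟨p₁, p₂⟩, p₃⟩, fun f hf hfc hs => ?_⟩
  have e₁ := h₁ f hf hfc (hs.trans (inter_subset_left.trans inter_subset_left))
  have e₂ := h₂ f hf hfc (hs.trans (inter_subset_left.trans inter_subset_right))
  have hsplit : (∫ x in Ω, fderiv ℝ f x b) = (∫ x in Ω, fderiv ℝ f x (b + (1 - β) • n))
      - (1 - β) * ∫ x in Ω, fderiv ℝ f x n := by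
    rw [← integral_const_mul, ← integral_sub (integrable_fderiv_apply hf hfc _).integrableOn
      ((integrable_fderiv_apply hf hfc _).integrableOn.const_mul _)]
    congr 1
    ext x
    simp
  have hfi : Integrable f (surfaceMeasure Ω) := hΩ.integrable hf.continuous.continuousOn
  have hfNi : Integrable (fun x => f x * ⟪N x, b⟫) (surfaceMeasure Ω) :=
    hΩ.integrable (hf.continuous.continuousOn.mul hNb)
  have e₃ : |β * (∫ x, f x ∂surfaceMeasure Ω) - ∫ x, f x * ⟪N x, b⟫ ∂surfaceMeasure Ω|
      ≤ δ * ∫ x, |f x| ∂surfaceMeasure Ω := by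
    rw [← integral_const_mul, ← integral_sub (hfi.const_mul _) hfNi, ← integral_const_mul]
    refine (abs_integral_le_integral_abs).trans
      (integral_mono_ae ((hfi.const_mul _).sub hfNi).abs (hfi.abs.const_mul _) ?_)
    filter_upwards [ae_surfaceMeasure_mem (Ω := Ω)] with x hx
    by_cases hxU : x ∈ U₃
    · have := h₃ ⟨hxU, hx⟩
      have heq : β * f x - f x * ⟪N x, b⟫ = -(f x * (⟪N x, b⟫ - β)) := by ring
      rw [heq, abs_neg, abs_mul, mul_comm]
      exact mul_le_mul_of_nonneg_right (le_of_lt this) (abs_nonneg _)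
    · have : f x = 0 := image_eq_zero_of_notMem_tsupport fun h' => hxU (hs h').2
      simp [this]
  have hM : 0 ≤ ∫ x, |f x| ∂surfaceMeasure Ω := integral_nonneg fun x => abs_nonneg _
  rw [DivergenceUpTo, hsplit]
  have hε' : ε = δ * (2 + |1 - β|) := by rw [hδ]; field_simp
  rw [hε']
  set A := ∫ x in Ω, fderiv ℝ f x (b + (1 - β) • n)
  set B := ∫ x in Ω, fderiv ℝ f x n
  set F := ∫ x, f x ∂surfaceMeasure Ω
  set G := ∫ x, f x * ⟪N x, b⟫ ∂surfaceMeasure Ω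
  set M := ∫ x, |f x| ∂surfaceMeasure Ω
  have : A - (1 - β) * B - G = (A - F) - (1 - β) * (B - F) + (β * F - G) := by ring
  rw [this]
  calc _ ≤ |A - F| + |(1 - β) * (B - F)| + |β * F - G| :=
        (abs_add_le _ _).trans (add_le_add_left (abs_sub _ _) _)
    _ ≤ δ * M + |1 - β| * (δ * M) + δ * M := by
        rw [abs_mul]
        exact add_le_add (add_le_add e₂ (mul_le_mul_of_nonneg_left e₁ (abs_nonneg _))) e₃
    _ = _ := by ring

theorem integral_fderiv_eq_zero {f : E3 → ℝ} (hf : ContDiff ℝ 1 f) (hfc : HasCompactSupport f)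
    (b : E3) : ∫ x, fderiv ℝ f x b = 0 := by
  have h1 := integral_mul_fderiv_eq_neg_fderiv_mul_of_integrable (μ := (volume : Measure E3))
    (f := fun _ => (1 : ℝ)) (g := f) (v := b) (by simp)
    (by simpa using integrable_fderiv_apply hf hfc b)
    (by simpa using hf.continuous.integrable_of_hasCompactSupport hfc)
    (by fun_prop) (fun _ _ => (hf.differentiable (by norm_num)).differentiableAt)
  simpa using h1

theorem divergenceUpTo_of_tsupport_subset {Ω : Set E3} (hΩ : IsOpen Ω) (N : E3 → E3) (b : E3)
    {ε : ℝ} (hε : 0 < ε) {f : E3 → ℝ} (hf : ContDiff ℝ 1 f) (hfc : HasCompactSupport f)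
    (hs : tsupport f ⊆ Ω) : DivergenceUpTo Ω N b ε f := by
  have h1 : (∫ x in Ω, fderiv ℝ f x b) = 0 := by
    rw [← integral_fderiv_eq_zero hf hfc b]
    refine setIntegral_eq_integral_of_forall_compl_eq_zero fun x hx => ?_
    rw [fderiv_of_notMem_tsupport (𝕜 := ℝ) (f := f) (fun h' => hx (hs h'))]; rfl
  have h2 : (∫ x, f x * ⟪N x, b⟫ ∂surfaceMeasure Ω) = 0 := by
    refine integral_eq_zero_of_ae (ae_surfaceMeasure_mem.mono fun x hx => ?_)
    have : f x = 0 := image_eq_zero_of_notMem_tsupport fun h' => by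
      rw [hΩ.frontier_eq] at hx
      exact hx.2 (hs h')
    simp [this]
  rw [DivergenceUpTo, h1, h2, sub_zero, abs_zero]
  exact mul_nonneg hε.le (integral_nonneg fun x => abs_nonneg _)

theorem contDiff_mul_of_tsupport {ρ f : E3 → ℝ} (hρ : ContDiff ℝ 1 ρ)
    (hf : ∀ x ∈ tsupport ρ, ContDiffAt ℝ 1 f x) : ContDiff ℝ 1 fun x => ρ x * f x := by
  refine contDiff_iff_contDiffAt.2 fun x => ?_
  by_cases hx : x ∈ tsupport ρ
  · exact hρ.contDiffAt.mul (hf x hx)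
  · have h0 : (fun x => ρ x * f x) =ᶠ[𝓝 x] fun _ => 0 := by
      filter_upwards [notMem_tsupport_iff_eventuallyEq.1 hx] with y hy
      simp [hy]
    exact contDiffAt_const.congr_of_eventuallyEq h0

/-- The error is measured by `∫ |f|` because this quantity is additive over a nonnegative partition
of unity. The number of patches, which depends on `ε`, does not enter. -/
theorem IsC1Domain.divergenceUpTo {Ω : Set E3} (hΩ : IsC1Domain Ω)
    {N : E3 → E3} (hN : ∀ x ∈ frontier Ω, IsOuterNormal Ω x (N x)) (b : E3) {f : E3 → ℝ}
    (hf : ∀ x ∈ closure Ω, ContDiffAt ℝ 1 f x) {ε : ℝ} (hε : 0 < ε) :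
    DivergenceUpTo Ω N b ε f := by
  have hloc : ∀ p ∈ closure Ω, ∃ U, IsOpen U ∧ p ∈ U ∧ (∀ x ∈ U, ContDiffAt ℝ 1 f x) ∧
      U ⊆ Metric.closedBall p 1 ∧
      ∀ g : E3 → ℝ, ContDiff ℝ 1 g → HasCompactSupport g → tsupport g ⊆ U →
        DivergenceUpTo Ω N b ε g := by
    intro p hp
    obtain ⟨V, hV, oV, pV⟩ := eventually_nhds_iff.1 ((hf p hp).eventually (by simp))
    obtain ⟨U, oU, pU, hU⟩ : ∃ U, IsOpen U ∧ p ∈ U ∧ ∀ g : E3 → ℝ, ContDiff ℝ 1 g →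
        HasCompactSupport g → tsupport g ⊆ U → DivergenceUpTo Ω N b ε g := by
      by_cases hpΩ : p ∈ Ω
      · exact ⟨Ω, hΩ.isOpen, hpΩ, fun g h1 h2 h3 =>
          divergenceUpTo_of_tsupport_subset hΩ.isOpen N b hε h1 h2 h3⟩
      · exact hΩ.exists_nhds_divergenceUpTo_of_mem_frontier hN
          (by rw [hΩ.isOpen.frontier_eq]; exact ⟨hp, hpΩ⟩) b hε
    refine ⟨U ∩ V ∩ Metric.ball p 1, (oU.inter oV).inter Metric.isOpen_ball,
      ⟨⟨pU, pV⟩, Metric.mem_ball_self one_pos⟩, fun x hx => hV x hx.1.2,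
      inter_subset_right.trans Metric.ball_subset_closedBall, fun g h1 h2 h3 =>
      hU g h1 h2 (h3.trans (inter_subset_left.trans inter_subset_left))⟩
  choose! U oU pU cU bU hU using hloc
  obtain ⟨t, ht, hcov⟩ := hΩ.isCompact_closure.elim_nhds_subcover U
    fun p hp => (oU p hp).mem_nhds (pU p hp)
  obtain ⟨ρ, hρ⟩ := SmoothPartitionOfUnity.exists_isSubordinate (modelWithCornersSelf ℝ E3)
    (isClosed_closure (s := Ω)) (fun i : t => U i) (fun i => oU i (ht i i.2))
    (by simpa only [iUnion_subtype] using hcov)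
  have hρc : ∀ i, ContDiff ℝ 1 (ρ i) := fun i =>
    (ρ i).contMDiff.contDiff.of_le (by exact_mod_cast le_top)
  set g : t → E3 → ℝ := fun i x => ρ i x * f x with hg
  have hgc : ∀ i, ContDiff ℝ 1 (g i) := fun i =>
    contDiff_mul_of_tsupport (hρc i) fun x hx => cU i (ht i i.2) x (hρ i hx)
  have hgs : ∀ i, tsupport (g i) ⊆ U i := fun i => tsupport_mul_subset_left.trans (hρ i)
  -- The patches were placed inside unit balls for this purpose.
  have hgcs : ∀ i, HasCompactSupport (g i) := fun i =>
    (isCompact_closedBall (i : E3) 1).of_isClosed_subset (isClosed_tsupport _)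
      ((hgs i).trans (bU i (ht i i.2)))
  have hone : ∀ x ∈ closure Ω, ∑ i, ρ i x = 1 := by
    intro x hx
    rw [← finsum_eq_sum_of_fintype]
    exact ρ.sum_eq_one hx
  have hsum : ∀ x ∈ closure Ω, f x = ∑ i, g i x := by
    intro x hx
    simp only [hg]
    rw [← Finset.sum_mul, hone x hx, one_mul]
  have hlhs : (∫ x in Ω, fderiv ℝ f x b) = ∑ i, ∫ x in Ω, fderiv ℝ (g i) x b := by
    rw [← integral_finsetSum _ fun i _ => (integrable_fderiv_apply (hgc i) (hgcs i) b).integrableOn]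
    refine setIntegral_congr_fun hΩ.isOpen.measurableSet fun x hx => ?_
    have h1 : f =ᶠ[𝓝 x] fun y => ∑ i, g i y := by
      filter_upwards [hΩ.isOpen.mem_nhds hx] with y hy using hsum y (subset_closure hy)
    rw [h1.fderiv_eq, fderiv_fun_sum fun i _ => ((hgc i).differentiable (by norm_num)).differentiableAt]
    simp
  have hNb : ContinuousOn (fun x => ⟪N x, b⟫) (frontier Ω) :=
    (continuousOn_outerNormal hΩ.isOpen hN).inner continuousOn_const
  have hrhs : (∫ x, f x * ⟪N x, b⟫ ∂surfaceMeasure Ω)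
      = ∑ i, ∫ x, g i x * ⟪N x, b⟫ ∂surfaceMeasure Ω := by
    have hint : ∀ i ∈ Finset.univ, Integrable (fun x => g i x * ⟪N x, b⟫) (surfaceMeasure Ω) :=
      fun i _ => hΩ.integrable ((hgc i).continuous.continuousOn.mul hNb)
    rw [← integral_finsetSum _ hint]
    refine integral_congr_ae (ae_surfaceMeasure_mem.mono fun x hx => ?_)
    simp only
    rw [hsum x (frontier_subset_closure hx), Finset.sum_mul]
  have habs : (∫ x, |f x| ∂surfaceMeasure Ω) = ∑ i, ∫ x, |g i x| ∂surfaceMeasure Ω := by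
    rw [← integral_finsetSum _ fun i _ => hΩ.integrable (hgc i).continuous.abs.continuousOn]
    refine integral_congr_ae (ae_surfaceMeasure_mem.mono fun x hx => ?_)
    simp only [hg, abs_mul, abs_of_nonneg (ρ.nonneg _ _)]
    rw [← Finset.sum_mul, hone x (frontier_subset_closure hx), one_mul]
  rw [DivergenceUpTo, hlhs, hrhs, habs, ← Finset.sum_sub_distrib, Finset.mul_sum]
  exact (Finset.abs_sum_le_sum_abs _ _).trans
    (Finset.sum_le_sum fun i _ => hU i (ht i i.2) (g i) (hgc i) (hgcs i) (hgs i))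

theorem IsC1Domain.integral_fderiv {Ω : Set E3} (hΩ : IsC1Domain Ω)
    {N : E3 → E3} (hN : ∀ x ∈ frontier Ω, IsOuterNormal Ω x (N x)) (b : E3) {f : E3 → ℝ}
    (hf : ∀ x ∈ closure Ω, ContDiffAt ℝ 1 f x) :
    (∫ x in Ω, fderiv ℝ f x b) = ∫ x, f x * ⟪N x, b⟫ ∂surfaceMeasure Ω := by
  set M := ∫ x, |f x| ∂surfaceMeasure Ω with hM
  have hM0 : 0 ≤ M := integral_nonneg fun x => abs_nonneg _
  rw [← sub_eq_zero, ← abs_eq_zero]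
  refine le_antisymm (le_of_forall_pos_le_add fun ε hε => ?_) (abs_nonneg _)
  have h1 := hΩ.divergenceUpTo hN b hf (ε := ε / (M + 1)) (by positivity)
  refine h1.trans ?_
  rw [← hM, zero_add, div_mul_eq_mul_div, div_le_iff₀ (by positivity)]
  nlinarith

end LinearR13

namespace LinearR13

/-! ### Semidefinite forms and Schur complements -/

theorem eq_zero_of_forall_mul_add_nonpos {b d : ℝ} (h : ∀ t : ℝ, t * b + d ≤ 0) : b = 0 := by
  by_contra hb
  have := h ((1 - d) / b)
  rw [div_mul_cancel₀ _ hb] at this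
  linarith

/-- If `u = X Q f` with `X ≥ 0` and a negative semidefinite form `Q`, then `⟪u, f - g⟫` is bounded
by an expression that is linear in `g` and that contains `f₀` only through `u₀`. -/
theorem schur_bound {a b c d e k X : ℝ} (hX : 0 ≤ X)
    (hQ : ∀ x y z : ℝ, a * x ^ 2 + d * y ^ 2 + k * z ^ 2 + 2 * b * x * y + 2 * c * x * z
      + 2 * e * y * z ≤ 0)
    {u₀ u₁ u₂ f₀ g₀ g₁ g₂ e₁ e₂ : ℝ}
    (h0 : u₀ = X * (a * f₀ + b * (g₁ - e₁) + c * (g₂ - e₂)))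
    (h1 : u₁ = X * (b * f₀ + d * (g₁ - e₁) + e * (g₂ - e₂)))
    (h2 : u₂ = X * (c * f₀ + e * (g₁ - e₁) + k * (g₂ - e₂))) :
    u₀ * (f₀ - g₀) + u₁ * -e₁ + u₂ * -e₂ ≤
      -u₀ * (g₀ + (b * g₁ + c * g₂) / a)
      - X * (g₁ * ((d - b * b / a) * e₁ + (e - b * c / a) * e₂)
        + g₂ * ((e - b * c / a) * e₁ + (k - c * c / a) * e₂)) := by
  have ha : a ≤ 0 := by simpa using hQ 1 0 0
  -- In the degenerate case semidefiniteness forces the whole first row to vanish, so `u₀ = 0`, and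
  -- the convention `x / 0 = 0` gives the right statement.
  by_cases ha0 : a = 0
  · subst ha0
    have hb : b = 0 := by
      have : 2 * b = 0 := eq_zero_of_forall_mul_add_nonpos (d := d) fun t => by
        have := hQ t 1 0; linarith
      linarith
    have hc : c = 0 := by
      have : 2 * c = 0 := eq_zero_of_forall_mul_add_nonpos (d := k) fun t => by
        have := hQ t 0 1; linarith
      linarith
    subst hb hc
    have := mul_nonpos_of_nonneg_of_nonpos hX (hQ 0 e₁ e₂)
    simp only [div_zero, zero_mul, mul_zero, add_zero, sub_zero, zero_add] at *
    subst h0 h1 h2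
    nlinarith
  -- This first coordinate annihilates the first row of the form, so the value of `hQ` is the Schur
  -- complement at `(e₁, e₂)`. Together with `u₀ ^ 2 / a`, up to powers of `X`, it is all that is
  -- discarded.
  · have hS := hQ (-(b * e₁ + c * e₂) / a) e₁ e₂
    have hSX := mul_nonpos_of_nonneg_of_nonpos hX hS
    have hsq : X * ((a * f₀ + b * (g₁ - e₁) + c * (g₂ - e₂)) ^ 2 / a) ≤ 0 :=
      mul_nonpos_of_nonneg_of_nonpos hX (div_nonpos_of_nonneg_of_nonpos (sq_nonneg _) ha)
    have key : u₀ * (f₀ - g₀) + u₁ * -e₁ + u₂ * -e₂ -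
      (-u₀ * (g₀ + (b * g₁ + c * g₂) / a)
      - X * (g₁ * ((d - b * b / a) * e₁ + (e - b * c / a) * e₂)
        + g₂ * ((e - b * c / a) * e₁ + (k - c * c / a) * e₂)))
      = X * ((a * f₀ + b * (g₁ - e₁) + c * (g₂ - e₂)) ^ 2 / a)
       + X * (a * (-(b * e₁ + c * e₂) / a) ^ 2 + d * e₁ ^ 2 + k * e₂ ^ 2
         + 2 * b * (-(b * e₁ + c * e₂) / a) * e₁ + 2 * c * (-(b * e₁ + c * e₂) / a) * e₂
         + 2 * e * e₁ * e₂) := by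
      subst h0 h1 h2
      field_simp
      ring
    linarith

theorem quadratic_nonpos_of_neg_posSemidef {Q : Matrix (Fin 3) (Fin 3) ℝ} (h : (-Q).PosSemidef)
    (x y z : ℝ) :
    Q 0 0 * x ^ 2 + Q 1 1 * y ^ 2 + Q 2 2 * z ^ 2 + 2 * Q 0 1 * x * y + 2 * Q 0 2 * x * z
      + 2 * Q 1 2 * y * z ≤ 0 := by
  have hs := h.isHermitian
  have s10 : Q 1 0 = Q 0 1 := by simpa using hs.apply 0 1
  have s20 : Q 2 0 = Q 0 2 := by simpa using hs.apply 0 2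
  have s21 : Q 2 1 = Q 1 2 := by simpa using hs.apply 1 2
  have := h.dotProduct_mulVec_nonneg ![x, y, z]
  simp [dotProduct, Matrix.mulVec, Fin.sum_univ_three] at this
  rw [s10, s20, s21] at this
  nlinarith

theorem symm_of_neg_posSemidef {Q : Matrix (Fin 3) (Fin 3) ℝ} (h : (-Q).PosSemidef) (i j : Fin 3) :
    Q i j = Q j i := by
  simpa using h.isHermitian.apply j i

/-! ### Symmetric trace-free tensors -/

theorem stf2_symm (A : Fin 3 → Fin 3 → ℝ) (i j : Fin 3) : stf2 A i j = stf2 A j i := by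
  simp only [stf2, delta, eq_comm (a := i)]; ring

theorem sym3_swap (T : Fin 3 → Fin 3 → Fin 3 → ℝ) (i j k : Fin 3) : sym3 T i j k = sym3 T j i k := by
  simp only [sym3]; ring

theorem sym3_swap' (T : Fin 3 → Fin 3 → Fin 3 → ℝ) (i j k : Fin 3) :
    sym3 T i j k = sym3 T i k j := by
  simp only [sym3]; ring

theorem delta_comm (i j : Fin 3) : delta i j = delta j i := by
  simp only [delta, eq_comm]

theorem stf3_swap (T : Fin 3 → Fin 3 → Fin 3 → ℝ) (i j k : Fin 3) : stf3 T i j k = stf3 T j i k := by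
  simp only [stf3]; rw [sym3_swap, delta_comm i j]; ring

theorem stf3_swap' (T : Fin 3 → Fin 3 → Fin 3 → ℝ) (i j k : Fin 3) :
    stf3 T i j k = stf3 T i k j := by
  simp only [stf3]; rw [sym3_swap', delta_comm j k]; ring

theorem stf3_trace (T : Fin 3 → Fin 3 → Fin 3 → ℝ) (k : Fin 3) : ∑ i, stf3 T i i k = 0 := by
  have h : ∀ l, sym3 T l l k = sym3 T k l l := fun l => by rw [sym3_swap', sym3_swap]
  fin_cases k <;> simp [stf3, delta, Fin.sum_univ_three] <;> simp only [sym3] <;> ring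

/-! ### Radicals -/

/-- This and the next three identities express the radicals through `√2` and `√15`, so that wall
identities become polynomial. -/
theorem sqrt_two_fifteen : √(2 / 15 : ℝ) = √2 * √15 / 15 := by
  rw [Real.sqrt_eq_iff_mul_self_eq (by positivity) (by positivity)]
  have h1 : √2 * √2 = (2 : ℝ) := Real.mul_self_sqrt (by norm_num)
  have h2 : √15 * √15 = (15 : ℝ) := Real.mul_self_sqrt (by norm_num)
  linear_combination -(1 / 225) * √15 * √15 * h1 - (2 / 225) * h2

theorem sqrt_five_sixths : √(5 / 6 : ℝ) = √2 * √15 / 6 := by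
  rw [Real.sqrt_eq_iff_mul_self_eq (by positivity) (by positivity)]
  have h1 : √2 * √2 = (2 : ℝ) := Real.mul_self_sqrt (by norm_num)
  have h2 : √15 * √15 = (15 : ℝ) := Real.mul_self_sqrt (by norm_num)
  linear_combination -(1 / 36) * √15 * √15 * h1 - (2 / 36) * h2

theorem sqrt_fifteen_halves : √(15 / 2 : ℝ) = √2 * √15 / 2 := by
  rw [Real.sqrt_eq_iff_mul_self_eq (by positivity) (by positivity)]
  have h1 : √2 * √2 = (2 : ℝ) := Real.mul_self_sqrt (by norm_num)
  have h2 : √15 * √15 = (15 : ℝ) := Real.mul_self_sqrt (by norm_num)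
  linear_combination -(1 / 4) * √15 * √15 * h1 - (2 / 4) * h2

theorem one_div_sqrt_fifteen : 1 / √15 = √15 / (15 : ℝ) := by
  have h2 : √15 * √15 = (15 : ℝ) := Real.mul_self_sqrt (by norm_num)
  have : √15 ≠ (0 : ℝ) := by positivity
  field_simp
  linarith

/-! ### The entropy flux at the wall -/

namespace MomentCoeffs

variable (D : MomentCoeffs) (w : WallState)

/-- The part of the entropy flux in direction `j` that does not involve the pressure `ρ + θ`. -/
noncomputable def flux (j : Fin 3) : ℝ :=
  D.c11 * w.θ * w.q j - √(15 / 2) * w.θ * ∑ m, D.c1 m * D.uV w j m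
    + ∑ a, w.v a * (D.c200 * w.σ a j + √15 * ∑ m, D.c2 m * D.uT w a j m)
    - √2 / 15 * D.A45 * ∑ a, w.q a * w.σ a j
    - √(2 / 15) * ((∑ a, w.q a * ∑ m, D.a4 m * D.uT w a j m) + D.A46 * w.q j * D.uS w)
    + 1 / √15 * ((∑ a, w.σ a j * ∑ m, D.a5 m * D.uV w a m)
      + D.A511 * ∑ a, ∑ b, w.σ a b * D.uTT w a b j)

variable {D w}

theorem uTT_swap (a b c : Fin 3) : D.uTT w a b c = D.uTT w b a c := by
  simp only [uTT, WallState.Dσ, stf3_swap _ a b c]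

theorem uTT_swap' (a b c : Fin 3) : D.uTT w a b c = D.uTT w a c b := by
  simp only [uTT, WallState.Dσ, stf3_swap' _ a b c]

theorem uTT_trace : D.uTT w 0 0 0 + D.uTT w 1 1 0 + D.uTT w 2 2 0 = 0 := by
  have := stf3_trace w.dσ 0
  rw [Fin.sum_univ_three] at this
  simp only [uTT, WallState.Dσ]
  linear_combination (1 / √15 * D.A511 / D.L3) * this

/-- The degeneracy assumption is needed when `c21 = 0`, where `κ` is zero by convention. -/
theorem IsAdmissible.c31_eq (hD : D.IsAdmissible) : D.c31 = D.κ * D.c21 := by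
  by_cases h : D.c21 = 0
  · rw [h, (hD.degenerate h).1, mul_zero]
  · rw [κ, div_mul_cancel₀ _ h]

theorem IsAdmissible.A511_mul_μ (hD : D.IsAdmissible) :
    D.A511 * D.μ * (1 + D.κ ^ 2) = 2 / 3 * (D.A58 - D.κ * D.A57) := by
  have h1 := hD.A511_ne
  have h2 : 1 + D.κ ^ 2 ≠ 0 := by positivity
  rw [μ]
  field_simp

theorem IsAdmissible.fluxN_one (hD : D.IsAdmissible) (w : WallState) :
    D.fluxN w 1 / D.normN 1 = -(√2 * √15 / 2) * D.c21 * w.θW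
      - (-(√2 * √15 / 2) * D.c21 * w.θ
        + √15 / 15 * (D.A57 + D.κ * D.A58) / (1 + D.κ ^ 2) * w.σ 0 0) := by
  have h2 : 1 + D.κ ^ 2 ≠ 0 := by positivity
  simp only [fluxN, normN, U2n, U3n, Matrix.cons_val_one, Matrix.cons_val_zero, hD.c31_eq]
  field_simp
  ring

/-- The temperature jump cancels because it enters with the factor `c31 - κ c21`. The value of `μ`
is the one for which the two `σ̄_nn` contributions stand in the same ratio to the two parts of the
norm. -/
theorem IsAdmissible.fluxN_two (hD : D.IsAdmissible) (w : WallState) :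
    D.fluxN w 2 / D.normN 2 = -(√15 / 10 * D.A511 * w.σ 0 0) := by
  have h2 : 4 / 175 + D.μ ^ 2 * (1 + D.κ ^ 2) / 3 ≠ 0 := by positivity
  simp only [fluxN, normN, U2n, U3n, Unnn, Matrix.cons_val, hD.c31_eq]
  rw [div_eq_iff h2]
  linear_combination (√15 / 30 * D.μ * w.σ 0 0) * hD.A511_mul_μ

/-- Every term of the normal flux contains one factor with an odd number of normal indices and one
with an even number. Grouping by odd moments gives exactly the fluxes of the Onsager conditions,
normalized, with the wall data subtracted. The last line is the contribution of the shear components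
of `u⁰`. -/
theorem neg_flux_eq (hD : D.IsAdmissible) (hw : w.IsAdmissible) (hv : w.v 0 = 0) :
    -D.flux w 0 =
      (D.oddN w 0 * (D.fluxN w 0 / D.normN 0 - D.c11 * w.θW)
        + D.oddN w 1 * -(-(√2 * √15 / 2) * D.c21 * w.θ
          + √15 / 15 * (D.A57 + D.κ * D.A58) / (1 + D.κ ^ 2) * w.σ 0 0)
        + D.oddN w 2 * -(√15 / 10 * D.A511 * w.σ 0 0))
      + (D.oddT w 1 0 * (D.fluxT w 1 0 / normT 0 - D.c200 * w.vW 1)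
        + D.oddT w 1 1 * -(√15 * D.c210 * w.v 1 - √2 * √15 / 15 * D.A49 * w.q 1)
        + D.oddT w 1 2 * -(√15 * D.c220 * w.v 1 - √2 * √15 / 15 * D.A410 * w.q 1))
      + (D.oddT w 2 0 * (D.fluxT w 2 0 / normT 0 - D.c200 * w.vW 2)
        + D.oddT w 2 1 * -(√15 * D.c210 * w.v 2 - √2 * √15 / 15 * D.A49 * w.q 2)
        + D.oddT w 2 2 * -(√15 * D.c220 * w.v 2 - √2 * √15 / 15 * D.A410 * w.q 2))
      - 2 * √15 / 15 * D.A511 * ((w.σ 1 1 + 1 / 2 * w.σ 0 0) * (D.uTT w 1 1 0 + 1 / 2 * D.uTT w 0 0 0)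
        + w.σ 1 2 * D.uTT w 1 2 0) := by
  have h2 : 1 + D.κ ^ 2 ≠ 0 := by positivity
  have hμ := hD.A511_mul_μ
  -- The vector `(A57, A58)` is expanded in the orthogonal basis `(1, κ)`, `(-κ, 1)`; the second
  -- coefficient is proportional to `A511 μ`.
  have hδ : √15 / 15 * (D.A57 + D.κ * D.A58) / (1 + D.κ ^ 2) * (D.uV w 0 0 + D.κ * D.uV w 0 1)
      + √15 / 10 * D.A511 * (D.μ * (D.uV w 0 1 - D.κ * D.uV w 0 0))
      = √15 / 15 * (D.A57 * D.uV w 0 0 + D.A58 * D.uV w 0 1) := by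
    have : D.A511 * D.μ = 2 / 3 * (D.A58 - D.κ * D.A57) / (1 + D.κ ^ 2) := by
      rw [eq_div_iff h2]; exact hμ
    rw [← mul_assoc (√15 / 10 * D.A511), mul_assoc (√15 / 10), this]
    field_simp
    ring
  have hσ : w.σ 2 2 = -w.σ 0 0 - w.σ 1 1 := by
    have := hw.1.2; rw [Fin.sum_univ_three] at this; linarith
  have s01 := hw.1.1 0 1
  have s02 := hw.1.1 0 2
  have s12 := hw.1.1 2 1
  have hu : D.uTT w 2 2 0 = -D.uTT w 0 0 0 - D.uTT w 1 1 0 := by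
    linarith [uTT_trace (D := D) (w := w)]
  have u010 : D.uTT w 0 1 0 = D.uTT w 1 0 0 := uTT_swap _ _ _
  have u020 : D.uTT w 0 2 0 = D.uTT w 2 0 0 := uTT_swap _ _ _
  have u120 : D.uTT w 2 1 0 = D.uTT w 1 2 0 := uTT_swap _ _ _
  simp only [flux, oddN, oddT, fluxN, fluxT, normN, normT, Fin.sum_univ_three, Fin.sum_univ_two,
    Matrix.cons_val, c1, c2, a4, a5, hv, hD.c31_eq, s01, s02, s12, hσ, hu,
    u010, u020, u120, sqrt_two_fifteen, sqrt_five_sixths, sqrt_fifteen_halves, one_div_sqrt_fifteen]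
  linear_combination w.σ 0 0 * hδ

/-- The Schur estimate is applied once to the normal block and once per tangential direction. Since
both tangential blocks share `QT`, the constants `C₄, C₅, C₆` are common. -/
theorem exists_neg_flux_le (hD : D.IsAdmissible) {QN QT : Matrix (Fin 3) (Fin 3) ℝ}
    {s₇ s₈ χ : ℝ} (hQN : (-QN).PosSemidef) (hQT : (-QT).PosSemidef) (hs₇ : s₇ ≤ 0) (hs₈ : s₈ ≤ 0)
    (hχ : 0 ≤ chiT χ) :
    ∃ C₁ C₂ C₃ C₄ C₅ C₆ : ℝ, ∀ w : WallState, w.IsAdmissible → D.OnsagerBC w QN QT s₇ s₈ χ →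
      -D.flux w 0 ≤ w.θW * (C₁ * w.θ + C₂ * w.q 0 + C₃ * w.σ 0 0)
        + (w.vW 1 * (C₄ * w.v 1 + C₅ * w.q 1 + C₆ * w.σ 0 1)
        + w.vW 2 * (C₄ * w.v 2 + C₅ * w.q 2 + C₆ * w.σ 0 2)) := by
  set X := chiT χ
  set γ := -(√2 * √15 / 2) * D.c21 with hγ
  set δ := √15 / 15 * (D.A57 + D.κ * D.A58) / (1 + D.κ ^ 2) with hδ
  set η := √15 / 10 * D.A511 with hη
  set S := fun (Q : Matrix (Fin 3) (Fin 3) ℝ) i j => Q i j - Q 0 i * Q 0 j / Q 0 0 with hS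
  set p := √15 * D.c210 with hp
  set r := √15 * D.c220 with hr
  -- The witnesses are read off from the right-hand sides of `schur_bound`; `S` is the Schur
  -- complement of the upper left entry. In the normal block only the first two fluxes involve `θW`,
  -- hence `g₂ = 0` below.
  refine ⟨-X * γ * (S QN 1 1 * γ), -(D.c11 + (QN 0 1 * γ) / QN 0 0),
    -X * γ * (S QN 1 1 * δ + S QN 1 2 * η),
    -X * (p * (S QT 1 1 * p + S QT 1 2 * r) + r * (S QT 1 2 * p + S QT 2 2 * r)),
    X * (√2 * √15 / 15) * (p * (S QT 1 1 * D.A49 + S QT 1 2 * D.A410)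
      + r * (S QT 1 2 * D.A49 + S QT 2 2 * D.A410)),
    -(D.c200 + (QT 0 1 * p + QT 0 2 * r) / QT 0 0), fun w hw hbc => ?_⟩
  rw [neg_flux_eq hD hw hbc.mass]
  have hN := schur_bound (g₀ := D.c11 * w.θW) (g₁ := γ * w.θW) (g₂ := 0)
    (e₁ := γ * w.θ + δ * w.σ 0 0) (e₂ := η * w.σ 0 0)
    (u₀ := D.oddN w 0) (u₁ := D.oddN w 1) (u₂ := D.oddN w 2) (f₀ := D.fluxN w 0 / D.normN 0)
    hχ (quadratic_nonpos_of_neg_posSemidef hQN)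
    (by rw [hbc.normal 0, Fin.sum_univ_three, hD.fluxN_one, hD.fluxN_two]; ring)
    (by rw [hbc.normal 1, Fin.sum_univ_three, hD.fluxN_one, hD.fluxN_two,
          symm_of_neg_posSemidef hQN 1 0]; ring)
    (by rw [hbc.normal 2, Fin.sum_univ_three, hD.fluxN_one, hD.fluxN_two,
          symm_of_neg_posSemidef hQN 2 0, symm_of_neg_posSemidef hQN 2 1]; ring)
  have f1 : ∀ i, D.fluxT w i 1 / normT 1 = p * w.vW i
      - (p * w.v i - √2 * √15 / 15 * D.A49 * w.q i) := fun i => by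
    simp only [fluxT, normT, Matrix.cons_val, hp]; ring
  have f2 : ∀ i, D.fluxT w i 2 / normT 2 = r * w.vW i
      - (r * w.v i - √2 * √15 / 15 * D.A410 * w.q i) := fun i => by
    simp only [fluxT, normT, Matrix.cons_val, hr]; ring
  have hT := fun (i : Fin 3) (hi : i ≠ 0) =>
    schur_bound (g₀ := D.c200 * w.vW i) (g₁ := p * w.vW i) (g₂ := r * w.vW i)
    (e₁ := p * w.v i - √2 * √15 / 15 * D.A49 * w.q i)
    (e₂ := r * w.v i - √2 * √15 / 15 * D.A410 * w.q i)
    (u₀ := D.oddT w i 0) (u₁ := D.oddT w i 1) (u₂ := D.oddT w i 2) (f₀ := D.fluxT w i 0 / normT 0)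
    hχ (quadratic_nonpos_of_neg_posSemidef hQT)
    (by rw [hbc.tangential i hi 0, Fin.sum_univ_three, f1, f2])
    (by rw [hbc.tangential i hi 1, Fin.sum_univ_three, f1, f2, symm_of_neg_posSemidef hQT 1 0])
    (by rw [hbc.tangential i hi 2, Fin.sum_univ_three, f1, f2,
          symm_of_neg_posSemidef hQT 2 0, symm_of_neg_posSemidef hQT 2 1])
  have hT1 := hT 1 (by decide)
  have hT2 := hT 2 (by decide)
  have z2 : √15 * √15 = (15 : ℝ) := Real.mul_self_sqrt (by norm_num)
  -- The shear fluxes are negative multiples of `A511 * (σ̄_ττ + σ̄_nn / 2)` and `A511 * σ̄_τ₁τ₂`.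
  -- Multiplied by `s₇` and `s₈` they give nonpositive squares without wall data. One diagonal
  -- condition suffices, since `u⁰` and `σ̄` are trace-free.
  have hs : -(2 * √15 / 15 * D.A511 * ((w.σ 1 1 + 1 / 2 * w.σ 0 0)
      * (D.uTT w 1 1 0 + 1 / 2 * D.uTT w 0 0 0) + w.σ 1 2 * D.uTT w 1 2 0)) ≤ 0 := by
    rw [hbc.shear 1 (by decide), hbc.shear']
    simp only [Uttn, Unnn, delta]
    have a1 : 0 ≤ -s₇ * X * (D.A511 * (w.σ 1 1 + 1 / 2 * w.σ 0 0)) ^ 2 :=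
      mul_nonneg (mul_nonneg (by linarith) hχ) (sq_nonneg _)
    have a2 : 0 ≤ -s₈ * X * (D.A511 * w.σ 1 2) ^ 2 :=
      mul_nonneg (mul_nonneg (by linarith) hχ) (sq_nonneg _)
    have : -(2 * √15 / 15 * D.A511 * ((w.σ 1 1 + 1 / 2 * w.σ 0 0) * (X * s₇ *
        (2 * √15 / 1575 * D.A511 * (2 / 5 * 1 * w.σ 0 0 - w.σ 1 1)
          + 1 / 2 * (-(2 * √15 / 875) * D.A511 * w.σ 0 0)))
        + w.σ 1 2 * (X * s₈ * (2 * √15 / 1575 * D.A511 * (2 / 5 * 0 * w.σ 0 0 - w.σ 1 2)))))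
        = -(4 / 1575) * (-s₇ * X * (D.A511 * (w.σ 1 1 + 1 / 2 * w.σ 0 0)) ^ 2)
          - 4 / 1575 * (-s₈ * X * (D.A511 * w.σ 1 2) ^ 2) := by
      linear_combination (4 / 23625 * D.A511 ^ 2 * X * (s₇ * (w.σ 1 1 + 1 / 2 * w.σ 0 0) ^ 2
        + s₈ * w.σ 1 2 ^ 2)) * z2
    simp only [if_true, show ((1 : Fin 3) = 2) = False by decide, if_false]
    rw [this]
    linarith
  have o0 : D.oddN w 0 = w.q 0 := rfl
  have o1 : ∀ i, D.oddT w i 0 = w.σ 0 i := fun i => hw.1.1 i 0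
  rw [o0] at hN ⊢
  rw [o1] at hT1 hT2
  rw [o1, o1]
  refine (add_le_add (add_le_add (add_le_add hN hT1) hT2) hs).trans (le_of_eq ?_)
  simp only [hS]
  ring

end MomentCoeffs

end LinearR13

namespace LinearR13

/-! ### Change of frame -/

section Frame

variable {e : Fin 3 → E3}

theorem sum_mul_eq_delta_of_orthonormal (he : Orthonormal ℝ e) (a b : Fin 3) :
    ∑ i, e a i * e b i = delta a b := by
  have := orthonormal_iff_ite.1 he a b
  rw [PiLp.inner_apply] at this
  simp only [delta, ← this]
  exact Finset.sum_congr rfl fun i _ => by simp [mul_comm]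

theorem sum_mul_eq_delta_of_orthonormal' (he : Orthonormal ℝ e) (i j : Fin 3) :
    ∑ a, e a i * e a j = delta i j := by
  set A : Matrix (Fin 3) (Fin 3) ℝ := Matrix.of fun a i => e a i with hA
  have h1 : A * A.transpose = 1 := by
    ext a b
    simp only [hA, Matrix.mul_apply, Matrix.transpose_apply, Matrix.of_apply, Matrix.one_apply]
    exact sum_mul_eq_delta_of_orthonormal he a b
  have h2 : A.transpose * A = 1 := mul_eq_one_comm.1 h1
  have h2 := congrFun (congrFun h2 i) j
  simpa only [hA, Matrix.mul_apply, Matrix.transpose_apply, Matrix.of_apply, Matrix.one_apply, delta] using h2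

theorem sum_delta_mul (f : Fin 3 → ℝ) (i : Fin 3) : ∑ j, delta i j * f j = f i := by
  simp [delta]

theorem compV_const_mul (c : ℝ) (x : Fin 3 → ℝ) (a : Fin 3) :
    compV e (fun i => c * x i) a = c * compV e x a := by
  simp only [compV, Finset.mul_sum, mul_assoc]

theorem compV_add (x y : Fin 3 → ℝ) (a : Fin 3) :
    compV e (fun i => x i + y i) a = compV e x a + compV e y a := by
  simp only [compV, add_mul, Finset.sum_add_distrib]

theorem compV_sum {ι : Type*} (s : Finset ι) (x : ι → Fin 3 → ℝ) (a : Fin 3) :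
    compV e (fun i => ∑ m ∈ s, x m i) a = ∑ m ∈ s, compV e (x m) a := by
  simp only [compV, Finset.sum_mul]
  exact Finset.sum_comm

theorem compT_const_mul (c : ℝ) (x : Fin 3 → Fin 3 → ℝ) (a b : Fin 3) :
    compT e (fun i j => c * x i j) a b = c * compT e x a b := by
  simp only [compT, Finset.mul_sum, mul_assoc]

theorem compT_add (x y : Fin 3 → Fin 3 → ℝ) (a b : Fin 3) :
    compT e (fun i j => x i j + y i j) a b = compT e x a b + compT e y a b := by
  simp only [compT, add_mul, Finset.sum_add_distrib]

theorem compT_sum {ι : Type*} (s : Finset ι) (x : ι → Fin 3 → Fin 3 → ℝ) (a b : Fin 3) :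
    compT e (fun i j => ∑ m ∈ s, x m i j) a b = ∑ m ∈ s, compT e (x m) a b := by
  simp only [compT, Finset.sum_mul]
  rw [Finset.sum_comm (s := s)]
  exact Finset.sum_congr rfl fun i _ => Finset.sum_comm

theorem compT3_const_mul (c : ℝ) (x : Fin 3 → Fin 3 → Fin 3 → ℝ) (a b d : Fin 3) :
    compT3 e (fun i j k => c * x i j k) a b d = c * compT3 e x a b d := by
  simp only [compT3, Finset.mul_sum, mul_assoc]

theorem compT_eq_compV (T : Fin 3 → Fin 3 → ℝ) (a b : Fin 3) :
    compT e T a b = compV e (fun i => compV e (T i) b) a := by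
  simp only [compT, compV, Finset.sum_mul]
  exact Finset.sum_congr rfl fun i _ => Finset.sum_congr rfl fun j _ => by ring

theorem compT3_eq_compT (T : Fin 3 → Fin 3 → Fin 3 → ℝ) (a b c : Fin 3) :
    compT3 e T a b c = compT e (fun i j => compV e (T i j) c) a b := by
  simp only [compT3, compT, compV, Finset.sum_mul]
  exact Finset.sum_congr rfl fun i _ => Finset.sum_congr rfl fun j _ =>
    Finset.sum_congr rfl fun k _ => by ring

theorem compT3_eq_compV (T : Fin 3 → Fin 3 → Fin 3 → ℝ) (a b c : Fin 3) :
    compT3 e T a b c = compV e (fun i => compT e (T i) b c) a := by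
  rw [compT3_eq_compT, compT_eq_compV]
  simp only [compT_eq_compV]

theorem compT_swap (T : Fin 3 → Fin 3 → ℝ) (a b : Fin 3) :
    compT e T a b = compT e (fun i j => T j i) b a := by
  rw [compT, compT, Finset.sum_comm]
  exact Finset.sum_congr rfl fun i _ => Finset.sum_congr rfl fun j _ => by ring

theorem compT3_swap (T : Fin 3 → Fin 3 → Fin 3 → ℝ) (a b c : Fin 3) :
    compT3 e T a b c = compT3 e (fun i j k => T j i k) b a c := by
  rw [compT3_eq_compT, compT_swap, compT3_eq_compT]

theorem compT3_swap' (T : Fin 3 → Fin 3 → Fin 3 → ℝ) (a b c : Fin 3) :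
    compT3 e T a b c = compT3 e (fun i j k => T i k j) a c b := by
  rw [compT3_eq_compV, compT3_eq_compV]
  congr 1
  ext i
  rw [compT_swap]

theorem sum_compV_mul_compV (he : Orthonormal ℝ e) (x y : Fin 3 → ℝ) :
    ∑ a, compV e x a * compV e y a = ∑ i, x i * y i := by
  have h := sum_mul_eq_delta_of_orthonormal' he
  calc _ = ∑ i, ∑ j, x i * y j * ∑ a, e a i * e a j := by
        simp only [compV, Fin.sum_univ_three]; ring
    _ = _ := by
        simp only [h]
        exact Finset.sum_congr rfl fun i _ => by
          rw [← sum_delta_mul y i, Finset.mul_sum]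
          exact Finset.sum_congr rfl fun j _ => by ring

theorem sum_compT_diag (he : Orthonormal ℝ e) (T : Fin 3 → Fin 3 → ℝ) :
    ∑ a, compT e T a a = ∑ i, T i i := by
  have h := sum_mul_eq_delta_of_orthonormal' he
  calc _ = ∑ i, ∑ j, (∑ a, e a i * e a j) * T i j := by
        simp only [compT, Fin.sum_univ_three]; ring
    _ = _ := by simp only [h, sum_delta_mul]

theorem sum_compV_mul_compT (he : Orthonormal ℝ e) (x : Fin 3 → ℝ) (T : Fin 3 → Fin 3 → ℝ)
    (b : Fin 3) :
    ∑ a, compV e x a * compT e T a b = compV e (fun j => ∑ i, x i * T i j) b := by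
  simp only [compT_eq_compV]
  rw [sum_compV_mul_compV he, compV_sum]
  exact Finset.sum_congr rfl fun i _ => (compV_const_mul _ _ _).symm

theorem sum_compT_mul_compV (he : Orthonormal ℝ e) (x : Fin 3 → ℝ) (T : Fin 3 → Fin 3 → ℝ)
    (b : Fin 3) :
    ∑ a, compT e T a b * compV e x a = compV e (fun j => ∑ i, T i j * x i) b := by
  simp only [mul_comm (compT e _ _ _), sum_compV_mul_compT he, mul_comm (x _)]

theorem sum_compT_mul_compT3 (he : Orthonormal ℝ e) (S : Fin 3 → Fin 3 → ℝ)
    (P : Fin 3 → Fin 3 → Fin 3 → ℝ) (c : Fin 3) :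
    ∑ a, ∑ b, compT e S a b * compT3 e P a b c = compV e (fun k => ∑ i, ∑ j, S i j * P i j k) c := by
  have h1 : ∀ a b, compT3 e P a b c = compV e (fun j => compV e (fun i => compV e (P i j) c) a) b := by
    intro a b
    rw [compT3_eq_compT, compT_swap, compT_eq_compV]
  have h2 : ∀ a b, compT e S a b = compV e (fun j => compV e (fun i => S i j) a) b := by
    intro a b
    rw [compT_swap, compT_eq_compV]
  simp only [h1, h2, sum_compV_mul_compV he]
  rw [Finset.sum_comm]
  simp only [sum_compV_mul_compV he]
  rw [Finset.sum_comm, compV_sum]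
  refine Finset.sum_congr rfl fun i _ => ?_
  rw [compV_sum]
  exact Finset.sum_congr rfl fun j _ => (compV_const_mul _ _ _).symm

theorem compT_delta (he : Orthonormal ℝ e) (a b : Fin 3) : compT e delta a b = delta a b := by
  rw [← sum_mul_eq_delta_of_orthonormal he, compT]
  refine Finset.sum_congr rfl fun i _ => ?_
  rw [← sum_delta_mul (fun j => e b j) i, Finset.mul_sum]
  exact Finset.sum_congr rfl fun j _ => by ring

theorem stf2_compT (he : Orthonormal ℝ e) (A : Fin 3 → Fin 3 → ℝ) (a b : Fin 3) :
    stf2 (compT e A) a b = compT e (stf2 A) a b := by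
  have h : compT e (stf2 A) a b = compT e (fun i j => 1 / 2 * A i j + (1 / 2 * A j i
      + -((∑ k, A k k) / 3) * delta i j)) a b := by
    congr 1; ext i j; simp only [stf2]; ring
  rw [h, compT_add, compT_add, compT_const_mul, compT_const_mul, compT_const_mul, compT_delta he,
    ← compT_swap A b a, stf2, sum_compT_diag he]
  ring

theorem sym3_compT3 (T : Fin 3 → Fin 3 → Fin 3 → ℝ) (a b c : Fin 3) :
    sym3 (compT3 e T) a b c = compT3 e (sym3 T) a b c := by
  have h : sym3 T = fun i j k => 1 / 6 * T i j k + (1 / 6 * T i k j + (1 / 6 * T j i k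
      + (1 / 6 * T j k i + (1 / 6 * T k i j + 1 / 6 * T k j i)))) := by
    ext i j k; simp only [sym3]; ring
  have p1 : compT3 e T a c b = compT3 e (fun i j k => T i k j) a b c := compT3_swap' _ _ _ _
  have p2 : compT3 e T b a c = compT3 e (fun i j k => T j i k) a b c := compT3_swap _ _ _ _
  have p3 : compT3 e T b c a = compT3 e (fun i j k => T j k i) a b c := by
    rw [compT3_swap', compT3_swap]
  have p4 : compT3 e T c a b = compT3 e (fun i j k => T k i j) a b c := by
    rw [compT3_swap, compT3_swap']
  have p5 : compT3 e T c b a = compT3 e (fun i j k => T k j i) a b c := by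
    rw [compT3_swap, compT3_swap', compT3_swap]
  rw [h]
  simp only [sym3, p1, p2, p3, p4, p5]
  simp only [compT3, add_mul, mul_assoc, Finset.sum_add_distrib, ← Finset.mul_sum]
  ring

theorem sum_compT3_diag (he : Orthonormal ℝ e) (T : Fin 3 → Fin 3 → Fin 3 → ℝ) (a : Fin 3) :
    ∑ l, compT3 e T a l l = compV e (fun i => ∑ l, T i l l) a := by
  simp only [compT3_eq_compV]
  rw [← compV_sum]
  simp only [sum_compT_diag he]

theorem compT3_mul_delta (he : Orthonormal ℝ e) (V : Fin 3 → ℝ) (a b c : Fin 3) :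
    compT3 e (fun i j k => delta j k * V i) a b c = delta b c * compV e V a := by
  rw [compT3_eq_compV, ← compV_const_mul]
  congr 1
  ext i
  have : (fun j k => delta j k * V i) = fun j k => V i * delta j k := by ext; ring
  rw [this, compT_const_mul, compT_delta he, mul_comm]

theorem stf3_compT3 (he : Orthonormal ℝ e) (T : Fin 3 → Fin 3 → Fin 3 → ℝ) (a b c : Fin 3) :
    stf3 (compT3 e T) a b c = compT3 e (stf3 T) a b c := by
  have htr : ∀ a, ∑ l, sym3 (compT3 e T) a l l = compV e (fun i => ∑ l, sym3 T i l l) a := by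
    intro a
    simp only [sym3_compT3, sum_compT3_diag he]
  set V : Fin 3 → ℝ := fun i => ∑ l, sym3 T i l l with hV
  have h : stf3 T = fun i j k => sym3 T i j k + -(1 / 5) * (delta j k * V i)
      + -(1 / 5) * (delta i k * V j) + -(1 / 5) * (delta i j * V k) := by
    ext i j k; simp only [stf3, hV]; ring
  have q1 := compT3_mul_delta he V a b c
  have q2 : compT3 e (fun i j k => delta i k * V j) a b c = delta a c * compV e V b := by
    rw [compT3_swap]; exact compT3_mul_delta he V b a c
  have q3 : compT3 e (fun i j k => delta i j * V k) a b c = delta a b * compV e V c := by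
    rw [compT3_swap', compT3_swap]; exact compT3_mul_delta he V c a b
  have hadd : ∀ A B : Fin 3 → Fin 3 → Fin 3 → ℝ, compT3 e (fun i j k => A i j k + B i j k) a b c
      = compT3 e A a b c + compT3 e B a b c := by
    intro A B
    simp only [compT3, add_mul, Finset.sum_add_distrib]
  rw [h, hadd, hadd, hadd, compT3_const_mul, compT3_const_mul, compT3_const_mul, q1, q2, q3, stf3,
    htr, htr, htr, sym3_compT3]
  ring

theorem isStf_compT (he : Orthonormal ℝ e) {A : Fin 3 → Fin 3 → ℝ} (hA : IsStf A) :
    IsStf (compT e A) := by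
  refine ⟨fun a b => ?_, by rw [sum_compT_diag he, hA.2]⟩
  rw [compT_swap]
  congr 1
  ext i j
  exact hA.1 j i

theorem isStf_compT3 (he : Orthonormal ℝ e) {A : Fin 3 → Fin 3 → Fin 3 → ℝ}
    (hA : ∀ i, IsStf (A i)) (a : Fin 3) : IsStf (compT3 e A a) := by
  refine ⟨fun b c => ?_, ?_⟩
  · rw [compT3_swap']
    congr 1
    ext i j k
    exact (hA i).1 k j
  · rw [sum_compT3_diag he]
    simp only [(hA _).2, compV, zero_mul, Finset.sum_const_zero]

end Frame

/-- The state `w` in components with respect to another frame `e`. -/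
noncomputable def WallState.rotate (e : Fin 3 → E3) (w : WallState) : WallState where
  θ := w.θ
  θW := w.θW
  v := compV e w.v
  vW := compV e w.vW
  q := compV e w.q
  dθ := compV e w.dθ
  dv := compT e w.dv
  dq := compT e w.dq
  σ := compT e w.σ
  dσ := compT3 e w.dσ

namespace WallState

variable {e : Fin 3 → E3} {w : WallState}

theorem IsAdmissible.rotate (he : Orthonormal ℝ e) (hw : w.IsAdmissible) : (w.rotate e).IsAdmissible :=
  ⟨isStf_compT he hw.1, isStf_compT3 he hw.2⟩

theorem divσ_rotate (he : Orthonormal ℝ e) (a : Fin 3) : (w.rotate e).divσ a = compV e w.divσ a := by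
  have h : ∀ j, compT3 e w.dσ j a j = compT3 e (fun i j k => w.dσ j i k) a j j :=
    fun j => compT3_swap _ _ _ _
  simp only [divσ, WallState.rotate, h]
  exact sum_compT3_diag he _ a

end WallState

namespace MomentCoeffs

variable (D : MomentCoeffs) {e : Fin 3 → E3} (w : WallState)

theorem uS_rotate (he : Orthonormal ℝ e): D.uS (w.rotate e) = D.uS w := by
  simp only [uS, WallState.divq, WallState.rotate, sum_compT_diag he]

theorem uV_rotate (he : Orthonormal ℝ e) (a : Fin 3) (m : Fin 2) :
    D.uV (w.rotate e) a m = compV e (fun i => D.uV w i m) a := by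
  have h : ∀ m, -√(15 / 2) * D.c1 m * (w.rotate e).dθ a + 1 / √15 * D.a5 m * (w.rotate e).divσ a
      + √(2 / 15) * D.r1 m * (w.rotate e).q a = compV e (fun i => -√(15 / 2) * D.c1 m * w.dθ i
      + 1 / √15 * D.a5 m * w.divσ i + √(2 / 15) * D.r1 m * w.q i) a := by
    intro m
    rw [compV_add, compV_add, compV_const_mul, compV_const_mul, compV_const_mul,
      WallState.divσ_rotate he]
    rfl
  simp only [uV, h, Matrix.mulVec, dotProduct]
  rw [compV_sum]
  simp only [compV_const_mul]

theorem uT_rotate (he : Orthonormal ℝ e) (a b : Fin 3) (m : Fin 2) :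
    D.uT (w.rotate e) a b m = compT e (fun i j => D.uT w i j m) a b := by
  have h : ∀ m, √15 * D.c2 m * (w.rotate e).Dv a b - √(2 / 15) * D.a4 m * (w.rotate e).Dq a b
      - 1 / √15 * D.r2 m * (w.rotate e).σ a b = compT e (fun i j => √15 * D.c2 m * w.Dv i j
      + -(√(2 / 15) * D.a4 m) * w.Dq i j + -(1 / √15 * D.r2 m) * w.σ i j) a b := by
    intro m
    rw [compT_add, compT_add, compT_const_mul, compT_const_mul, compT_const_mul]
    simp only [WallState.Dv, WallState.Dq, WallState.rotate]
    rw [stf2_compT he, stf2_compT he]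
    change _ = √15 * D.c2 m * compT e (stf2 w.dv) a b + -(√(2 / 15) * D.a4 m) * compT e (stf2 w.dq) a b
      + -(1 / √15 * D.r2 m) * compT e w.σ a b
    ring
  simp only [uT, h, Matrix.mulVec, dotProduct]
  rw [compT_sum]
  simp only [compT_const_mul, sub_eq_add_neg, neg_mul]

theorem uTT_rotate (he : Orthonormal ℝ e) (a b c : Fin 3) : D.uTT (w.rotate e) a b c = compT3 e (D.uTT w) a b c := by
  have h : D.uTT w = fun i j k => (1 / √15 * D.A511 / D.L3) * stf3 w.dσ i j k := by
    ext i j k; simp only [uTT, WallState.Dσ]; ring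
  rw [h, compT3_const_mul, uTT, WallState.Dσ, WallState.rotate, stf3_compT3 he]
  ring

/-- The flux is built from tensors by contraction alone, hence covariant under orthogonal changes of
frame. This connects the Cartesian flux of the divergence theorem with the wall conditions. -/
theorem flux_rotate (he : Orthonormal ℝ e) (a : Fin 3) : D.flux (w.rotate e) a = compV e (D.flux w) a := by
  have hV : ∀ (x : Fin 2 → ℝ) a, ∑ m, x m * D.uV (w.rotate e) a m
      = compV e (fun i => ∑ m, x m * D.uV w i m) a := by
    intro x a
    simp only [D.uV_rotate w he, compV_sum, compV_const_mul]
  have hT : ∀ (x : Fin 2 → ℝ) a b, ∑ m, x m * D.uT (w.rotate e) a b m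
      = compT e (fun i j => ∑ m, x m * D.uT w i j m) a b := by
    intro x a b
    simp only [D.uT_rotate w he, compT_sum, compT_const_mul]
  have h1 : ∑ b, compV e w.v b * (D.c200 * compT e w.σ b a
      + √15 * compT e (fun i j => ∑ m, D.c2 m * D.uT w i j m) b a)
      = compV e (fun j => ∑ i, w.v i * (D.c200 * w.σ i j + √15 * ∑ m, D.c2 m * D.uT w i j m)) a := by
    rw [← sum_compV_mul_compT he]
    simp only [compT_add, compT_const_mul]
  have h2 := sum_compV_mul_compT he w.q w.σ a
  have h3 := sum_compV_mul_compT he w.q (fun i j => ∑ m, D.a4 m * D.uT w i j m) a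
  have h4 := sum_compT_mul_compV he (fun i => ∑ m, D.a5 m * D.uV w i m) w.σ a
  have h5 := sum_compT_mul_compT3 he w.σ (D.uTT w) a
  have h : D.flux w = fun j =>
      ((((((D.c11 * w.θ) * w.q j + (-√(15 / 2) * w.θ) * ∑ m, D.c1 m * D.uV w j m)
      + ∑ a, w.v a * (D.c200 * w.σ a j + √15 * ∑ m, D.c2 m * D.uT w a j m))
      + (-(√2 / 15 * D.A45)) * ∑ a, w.q a * w.σ a j)
      + (-√(2 / 15)) * ((∑ a, w.q a * ∑ m, D.a4 m * D.uT w a j m) + (D.A46 * D.uS w) * w.q j))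
      + 1 / √15 * ((∑ a, w.σ a j * ∑ m, D.a5 m * D.uV w a m)
      + D.A511 * ∑ a, ∑ b, w.σ a b * D.uTT w a b j)) := by
    ext j; simp only [flux]; ring
  rw [h]
  simp only [flux, hV, hT, D.uTT_rotate w he, D.uS_rotate w he, compV_add, compV_const_mul]
  simp only [WallState.rotate, h1, h2, h3, h4, h5]
  ring

end MomentCoeffs

end LinearR13

namespace LinearR13

/-! ### Entropy production -/

/-- A principal block of a definite matrix is definite, so `R1` and `R2` are true inverses and the
eliminated moments satisfy their defining relations. -/
theorem mulVec_inv_submatrix {L : Matrix (Fin 3) (Fin 3) ℝ} (h : (-L).PosDef) (y : Fin 2 → ℝ) :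
    (L.submatrix Fin.succ Fin.succ).mulVec ((L.submatrix Fin.succ Fin.succ)⁻¹.mulVec y) = y := by
  have h1 : (-(L.submatrix Fin.succ Fin.succ)).PosDef := h.submatrix (Fin.succ_injective 2)
  have h2 : IsUnit (L.submatrix Fin.succ Fin.succ).det := by
    rw [← Matrix.isUnit_iff_isUnit_det]
    exact (IsUnit.neg_iff _).1 h1.isUnit
  rw [Matrix.mulVec_mulVec, Matrix.mul_nonsing_inv _ h2, Matrix.one_mulVec]

namespace MomentCoeffs

variable (D : MomentCoeffs) (w : WallState)

theorem bil_symm {R : Matrix (Fin 2) (Fin 2) ℝ} (hR : R.IsSymm) (x y : Fin 2 → ℝ) :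
    bil x R y = bil y R x := by
  have h := hR.apply 0 1
  simp only [bil, Fin.sum_univ_two, h]
  ring

theorem IsAdmissible.isSymm_R1 {D : MomentCoeffs} (hD : D.IsAdmissible) : D.R1.IsSymm := by
  have h : D.L1.IsSymm := by
    ext i j
    exact symm_of_neg_posSemidef hD.L1_neg.posSemidef j i
  exact Matrix.IsSymm.inv (h.submatrix _)

theorem IsAdmissible.isSymm_R2 {D : MomentCoeffs} (hD : D.IsAdmissible) : D.R2.IsSymm := by
  have h : D.L2.IsSymm := by
    ext i j
    exact symm_of_neg_posSemidef hD.L2_neg.posSemidef j i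
  exact Matrix.IsSymm.inv (h.submatrix _)

theorem sum_mul_uV (x : Fin 2 → ℝ) (a : Fin 3) :
    ∑ m, x m * D.uV w a m = -√(15 / 2) * bil x D.R1 D.c1 * w.dθ a
      + 1 / √15 * bil x D.R1 D.a5 * w.divσ a + √(2 / 15) * bil x D.R1 D.r1 * w.q a := by
  simp only [uV, bil, Matrix.mulVec, dotProduct, Fin.sum_univ_two]
  ring

theorem sum_mul_uT (x : Fin 2 → ℝ) (a b : Fin 3) :
    ∑ m, x m * D.uT w a b m = √15 * bil x D.R2 D.c2 * w.Dv a b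
      - √(2 / 15) * bil x D.R2 D.a4 * w.Dq a b - 1 / √15 * bil x D.R2 D.r2 * w.σ a b := by
  simp only [uT, bil, Matrix.mulVec, dotProduct, Fin.sum_univ_two]
  ring

/-- The entropy production, multiplied by the Knudsen number. -/
noncomputable def production : ℝ :=
  (∑ a, (2 / 15 * D.L1 0 0 * w.q a ^ 2 - √(2 / 15) * w.q a * ∑ m, D.r1 m * D.uV w a m
      - √(15 / 2) * (∑ m, D.c1 m * D.uV w a m) * w.dθ a
      + 1 / √15 * (∑ m, D.a5 m * D.uV w a m) * w.divσ a))
    + (∑ a, ∑ b, (1 / 15 * D.L2 0 0 * w.σ a b ^ 2 + 1 / √15 * w.σ a b * ∑ m, D.r2 m * D.uT w a b m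
      + √15 * (∑ m, D.c2 m * D.uT w a b m) * w.Dv a b
      - √(2 / 15) * (∑ m, D.a4 m * D.uT w a b m) * w.Dq a b))
    - √(2 / 15) * D.A46 * w.divq * D.uS w
    + ∑ a, ∑ b, ∑ c, 1 / √15 * D.A511 * w.Dσ a b c * D.uTT w a b c

/-- The moment relations replace gradients by collision terms. The sum becomes `L1` at `(-√(2 / 15)
q̄, u², u³)`, `L2` at `(σ̄ / √15, u¹, u²)`, and the scalars `L0`, `L3` times squares. -/
theorem IsAdmissible.production_nonpos {D : MomentCoeffs} (hD : D.IsAdmissible) (w : WallState) :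
    D.production w ≤ 0 := by
  have s15 : √(2 / 15) ^ 2 = (2 / 15 : ℝ) := Real.sq_sqrt (by norm_num)
  have z15 : (1 / √15) ^ 2 = (1 / 15 : ℝ) := by
    rw [div_pow, Real.sq_sqrt (by norm_num), one_pow]
  have hV : ∀ a, 2 / 15 * D.L1 0 0 * w.q a ^ 2 - √(2 / 15) * w.q a * ∑ m, D.r1 m * D.uV w a m
      - √(15 / 2) * (∑ m, D.c1 m * D.uV w a m) * w.dθ a
      + 1 / √15 * (∑ m, D.a5 m * D.uV w a m) * w.divσ a ≤ 0 := by
    intro a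
    have h := quadratic_nonpos_of_neg_posSemidef hD.L1_neg.posSemidef (-√(2 / 15) * w.q a)
      (D.uV w a 0) (D.uV w a 1)
    have hy := mulVec_inv_submatrix hD.L1_neg (fun m => -√(15 / 2) * D.c1 m * w.dθ a
      + 1 / √15 * D.a5 m * w.divσ a + √(2 / 15) * D.r1 m * w.q a)
    have y0 := congrFun hy 0
    have y1 := congrFun hy 1
    change (D.L1.submatrix Fin.succ Fin.succ).mulVec (D.uV w a) 0 = _ at y0
    change (D.L1.submatrix Fin.succ Fin.succ).mulVec (D.uV w a) 1 = _ at y1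
    simp only [Matrix.mulVec, dotProduct, Fin.sum_univ_two, Matrix.submatrix_apply,
      show Fin.succ (0 : Fin 2) = 1 from rfl, show Fin.succ (1 : Fin 2) = 2 from rfl] at y0 y1
    have e1 := symm_of_neg_posSemidef hD.L1_neg.posSemidef 1 0
    have e2 := symm_of_neg_posSemidef hD.L1_neg.posSemidef 2 0
    have e3 := symm_of_neg_posSemidef hD.L1_neg.posSemidef 2 1
    simp only [Fin.sum_univ_two]
    have r0 : D.r1 0 = D.L1 0 1 := e1
    have r1 : D.r1 1 = D.L1 0 2 := e2
    rw [r0] at y0 ⊢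
    rw [r1] at y1 ⊢
    rw [e3] at y1
    refine le_of_eq_of_le ?_ h
    linear_combination -D.uV w a 0 * y0 - D.uV w a 1 * y1 - D.L1 0 0 * w.q a ^ 2 * s15
  have hT : ∀ a b, 1 / 15 * D.L2 0 0 * w.σ a b ^ 2 + 1 / √15 * w.σ a b * ∑ m, D.r2 m * D.uT w a b m
      + √15 * (∑ m, D.c2 m * D.uT w a b m) * w.Dv a b
      - √(2 / 15) * (∑ m, D.a4 m * D.uT w a b m) * w.Dq a b ≤ 0 := by
    intro a b
    have h := quadratic_nonpos_of_neg_posSemidef hD.L2_neg.posSemidef (1 / √15 * w.σ a b)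
      (D.uT w a b 0) (D.uT w a b 1)
    have hy := mulVec_inv_submatrix hD.L2_neg (fun m => √15 * D.c2 m * w.Dv a b
      - √(2 / 15) * D.a4 m * w.Dq a b - 1 / √15 * D.r2 m * w.σ a b)
    have y0 := congrFun hy 0
    have y1 := congrFun hy 1
    change (D.L2.submatrix Fin.succ Fin.succ).mulVec (D.uT w a b) 0 = _ at y0
    change (D.L2.submatrix Fin.succ Fin.succ).mulVec (D.uT w a b) 1 = _ at y1
    simp only [Matrix.mulVec, dotProduct, Fin.sum_univ_two, Matrix.submatrix_apply,
      show Fin.succ (0 : Fin 2) = 1 from rfl, show Fin.succ (1 : Fin 2) = 2 from rfl] at y0 y1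
    have e1 := symm_of_neg_posSemidef hD.L2_neg.posSemidef 1 0
    have e2 := symm_of_neg_posSemidef hD.L2_neg.posSemidef 2 0
    have e3 := symm_of_neg_posSemidef hD.L2_neg.posSemidef 2 1
    simp only [Fin.sum_univ_two]
    have r0 : D.r2 0 = D.L2 0 1 := e1
    have r1 : D.r2 1 = D.L2 0 2 := e2
    rw [r0] at y0 ⊢
    rw [r1] at y1 ⊢
    rw [e3] at y1
    refine le_of_eq_of_le ?_ h
    linear_combination -D.uT w a b 0 * y0 - D.uT w a b 1 * y1 - D.L2 0 0 * w.σ a b ^ 2 * z15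
  have hS : -(√(2 / 15) * D.A46 * w.divq * D.uS w) ≤ 0 := by
    have : -(√(2 / 15) * D.A46 * w.divq * D.uS w) = D.L0 * D.uS w ^ 2 := by
      have := hD.L0_neg.ne
      simp only [uS]
      field_simp
    rw [this]
    exact mul_nonpos_of_nonpos_of_nonneg hD.L0_neg.le (sq_nonneg _)
  have hTT : ∀ a b c, 1 / √15 * D.A511 * w.Dσ a b c * D.uTT w a b c ≤ 0 := by
    intro a b c
    have : 1 / √15 * D.A511 * w.Dσ a b c * D.uTT w a b c = D.L3 * D.uTT w a b c ^ 2 := by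
      have := hD.L3_neg.ne
      simp only [uTT]
      field_simp
    rw [this]
    exact mul_nonpos_of_nonpos_of_nonneg hD.L3_neg.le (sq_nonneg _)
  have k1 := Finset.sum_nonpos fun a (_ : a ∈ Finset.univ) => hV a
  have k2 := Finset.sum_nonpos fun a (_ : a ∈ Finset.univ) =>
    Finset.sum_nonpos fun b (_ : b ∈ Finset.univ) => hT a b
  have k3 := Finset.sum_nonpos fun a (_ : a ∈ Finset.univ) =>
    Finset.sum_nonpos fun b (_ : b ∈ Finset.univ) =>
    Finset.sum_nonpos fun c (_ : c ∈ Finset.univ) => hTT a b c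
  rw [production]
  linarith

end MomentCoeffs

/-! ### Contractions -/

theorem sum_mul_stf2 {B : Fin 3 → Fin 3 → ℝ} (hB : IsStf B) (A : Fin 3 → Fin 3 → ℝ) :
    ∑ i, ∑ j, B i j * stf2 A i j = ∑ i, ∑ j, B i j * A i j := by
  have h := hB.2
  have h1 := hB.1 1 0
  have h2 := hB.1 2 0
  have h3 := hB.1 2 1
  simp only [Fin.sum_univ_three] at h
  have h22 : B 2 2 = -B 0 0 - B 1 1 := by linarith
  simp [Fin.sum_univ_three, stf2, delta, h1, h2, h3, h22]
  ring

theorem isStf_stf2 (A : Fin 3 → Fin 3 → ℝ) : IsStf (stf2 A) := by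
  refine ⟨stf2_symm A, ?_⟩
  simp [Fin.sum_univ_three, stf2, delta]
  ring

theorem sum_mul_stf3 {P : Fin 3 → Fin 3 → Fin 3 → ℝ} (h1 : ∀ i j k, P i j k = P j i k)
    (h2 : ∀ i j k, P i j k = P i k j) (h3 : ∀ k, ∑ i, P i i k = 0) (A : Fin 3 → Fin 3 → Fin 3 → ℝ) :
    ∑ i, ∑ j, ∑ k, P i j k * stf3 A i j k = ∑ i, ∑ j, ∑ k, P i j k * A i j k := by
  have t0 := h3 0
  have t1 := h3 1
  have t2 := h3 2
  simp only [Fin.sum_univ_three] at t0 t1 t2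
  have p010 : P 0 1 0 = P 0 0 1 := h2 _ _ _
  have p100 : P 1 0 0 = P 0 0 1 := by rw [h1, h2]
  have p020 : P 0 2 0 = P 0 0 2 := h2 _ _ _
  have p200 : P 2 0 0 = P 0 0 2 := by rw [h1, h2]
  have p101 : P 1 0 1 = P 1 1 0 := h2 _ _ _
  have p011 : P 0 1 1 = P 1 1 0 := by rw [h1, h2]
  have p121 : P 1 2 1 = P 1 1 2 := h2 _ _ _
  have p211 : P 2 1 1 = P 1 1 2 := by rw [h1, h2]
  have p202 : P 2 0 2 = P 2 2 0 := h2 _ _ _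
  have p022 : P 0 2 2 = P 2 2 0 := by rw [h1, h2]
  have p212 : P 2 1 2 = P 2 2 1 := h2 _ _ _
  have p122 : P 1 2 2 = P 2 2 1 := by rw [h1, h2]
  have p021 : P 0 2 1 = P 0 1 2 := h2 _ _ _
  have p102 : P 1 0 2 = P 0 1 2 := h1 _ _ _
  have p120 : P 1 2 0 = P 0 1 2 := by rw [h2, h1]
  have p201 : P 2 0 1 = P 0 1 2 := by rw [h1, h2]
  have p210 : P 2 1 0 = P 0 1 2 := by rw [h2, h1, h2]
  have q0 : P 2 2 0 = -P 0 0 0 - P 1 1 0 := by linarith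
  have q1 : P 2 2 1 = -P 0 0 1 - P 1 1 1 := by linarith
  have q2 : P 2 2 2 = -P 0 0 2 - P 1 1 2 := by linarith
  simp [Fin.sum_univ_three, stf3, delta, p010, p100, p020, p200, p101, p011, p121, p211, p202,
    p022, p212, p122, p021, p102, p120, p201, p210, q0, q1, q2]
  simp only [sym3]
  ring

/-! ### Differential operators -/

section Calculus

variable {f g : E3 → ℝ} {x : E3}

theorem pd_add (i : Fin 3) (hf : DifferentiableAt ℝ f x) (hg : DifferentiableAt ℝ g x) :
    pd i (fun y => f y + g y) x = pd i f x + pd i g x := by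
  simp only [pd, fderiv_fun_add hf hg, add_apply]

theorem pd_mul (i : Fin 3) (hf : DifferentiableAt ℝ f x) (hg : DifferentiableAt ℝ g x) :
    pd i (fun y => f y * g y) x = f x * pd i g x + g x * pd i f x := by
  simp only [pd, fderiv_fun_mul hf hg, add_apply, smul_apply, smul_eq_mul]

theorem pd_const_mul (i : Fin 3) (c : ℝ) (hf : DifferentiableAt ℝ f x) :
    pd i (fun y => c * f y) x = c * pd i f x := by
  simp only [pd, fderiv_const_mul hf, smul_apply, smul_eq_mul]

theorem pd_sum {ι : Type*} (s : Finset ι) (i : Fin 3) {F : ι → E3 → ℝ}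
    (hF : ∀ k ∈ s, DifferentiableAt ℝ (F k) x) :
    pd i (fun y => ∑ k ∈ s, F k y) x = ∑ k ∈ s, pd i (F k) x := by
  simp only [pd, fderiv_fun_sum hF, sum_apply]

theorem contDiffAt_pd (i : Fin 3) (hf : ContDiffAt ℝ 2 f x) :
    ContDiffAt ℝ 1 (fun y => pd i f y) x := by
  have h : ContDiffAt ℝ 1 (fderiv ℝ f) x := hf.fderiv_right (by norm_num)
  exact h.clm_apply contDiffAt_const

theorem pd_congr (i : Fin 3) (h : f =ᶠ[𝓝 x] g) : pd i f x = pd i g x := by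
  simp only [pd, h.fderiv_eq]

variable {w w' : E3 → Fin 3 → ℝ} {T : E3 → Fin 3 → Fin 3 → ℝ} {P : E3 → Fin 3 → Fin 3 → Fin 3 → ℝ}

theorem divV_add (hw : ∀ i, DifferentiableAt ℝ (fun y => w y i) x)
    (hw' : ∀ i, DifferentiableAt ℝ (fun y => w' y i) x) :
    divV (fun y i => w y i + w' y i) x = divV w x + divV w' x := by
  simp only [divV, pd_add _ (hw _) (hw' _), Finset.sum_add_distrib]

theorem divV_const_mul (c : ℝ) (hw : ∀ i, DifferentiableAt ℝ (fun y => w y i) x) :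
    divV (fun y i => c * w y i) x = c * divV w x := by
  simp only [divV, pd_const_mul _ _ (hw _), Finset.mul_sum]

theorem divV_smul (hf : DifferentiableAt ℝ f x) (hw : ∀ i, DifferentiableAt ℝ (fun y => w y i) x) :
    divV (fun y i => f y * w y i) x = f x * divV w x + ∑ i, w x i * pd i f x := by
  simp only [divV, pd_mul _ hf (hw _), Finset.sum_add_distrib, Finset.mul_sum]

theorem divV_contract (hw : ∀ i, DifferentiableAt ℝ (fun y => w y i) x)
    (hT : ∀ i j, DifferentiableAt ℝ (fun y => T y i j) x) :
    divV (fun y j => ∑ i, w y i * T y i j) x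
      = ∑ i, w x i * divT T x i + ∑ i, ∑ j, T x i j * gradV w x j i := by
  have h : ∀ j, pd j (fun y => ∑ i, w y i * T y i j) x
      = ∑ i, (w x i * pd j (fun y => T y i j) x + T x i j * pd j (fun y => w y i) x) := by
    intro j
    rw [pd_sum _ _ fun k _ => (hw k).fun_mul (hT k j)]
    exact Finset.sum_congr rfl fun i _ => pd_mul _ (hw i) (hT i j)
  simp only [divV, h, divT, gradV, Finset.mul_sum, Finset.sum_add_distrib]
  congr 1
  · exact Finset.sum_comm
  · exact Finset.sum_comm

theorem divV_contract3 (hT : ∀ i j, DifferentiableAt ℝ (fun y => T y i j) x)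
    (hP : ∀ i j k, DifferentiableAt ℝ (fun y => P y i j k) x) :
    divV (fun y k => ∑ i, ∑ j, T y i j * P y i j k) x
      = ∑ i, ∑ j, T x i j * divT3 P x i j + ∑ i, ∑ j, ∑ k, P x i j k * gradT T x k i j := by
  have h : ∀ k, pd k (fun y => ∑ i, ∑ j, T y i j * P y i j k) x
      = ∑ i, ∑ j, (T x i j * pd k (fun y => P y i j k) x + P x i j k * pd k (fun y => T y i j) x) := by
    intro k
    rw [pd_sum _ _ fun i _ => DifferentiableAt.fun_sum fun j _ => (hT i j).fun_mul (hP i j k)]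
    refine Finset.sum_congr rfl fun i _ => ?_
    rw [pd_sum _ _ fun j _ => (hT i j).fun_mul (hP i j k)]
    exact Finset.sum_congr rfl fun j _ => pd_mul _ (hT i j) (hP i j k)
  simp only [divV, h, divT3, gradT, Finset.mul_sum, Finset.sum_add_distrib]
  congr 1
  · rw [Finset.sum_comm]
    exact Finset.sum_congr rfl fun i _ => Finset.sum_comm
  · rw [Finset.sum_comm]
    exact Finset.sum_congr rfl fun i _ => Finset.sum_comm

end Calculus

end LinearR13

namespace LinearR13

/-! ### The divergence of the entropy flux -/

/-- The vector field `w` is differentiable at `x` with divergence `d`. -/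
structure HasDivAt (w : E3 → Fin 3 → ℝ) (d : ℝ) (x : E3) : Prop where
  diff : ∀ i, DifferentiableAt ℝ (fun y => w y i) x
  div : divV w x = d

section HasDivAt

variable {x : E3} {f : E3 → ℝ} {w w' : E3 → Fin 3 → ℝ} {d d' : ℝ}
  {T : E3 → Fin 3 → Fin 3 → ℝ} {P : E3 → Fin 3 → Fin 3 → Fin 3 → ℝ}

theorem HasDivAt.add (h : HasDivAt w d x) (h' : HasDivAt w' d' x) :
    HasDivAt (fun y i => w y i + w' y i) (d + d') x :=
  ⟨fun i => (h.diff i).fun_add (h'.diff i), by rw [divV_add h.diff h'.diff, h.div, h'.div]⟩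

theorem HasDivAt.const_mul (c : ℝ) (h : HasDivAt w d x) :
    HasDivAt (fun y i => c * w y i) (c * d) x :=
  ⟨fun i => (h.diff i).const_mul c, by rw [divV_const_mul c h.diff, h.div]⟩

theorem hasDivAt_smul (hf : DifferentiableAt ℝ f x)
    (hw : ∀ i, DifferentiableAt ℝ (fun y => w y i) x) :
    HasDivAt (fun y i => f y * w y i) (f x * divV w x + ∑ i, w x i * pd i f x) x :=
  ⟨fun i => hf.fun_mul (hw i), divV_smul hf hw⟩

theorem hasDivAt_contract (hw : ∀ i, DifferentiableAt ℝ (fun y => w y i) x)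
    (hT : ∀ i j, DifferentiableAt ℝ (fun y => T y i j) x) :
    HasDivAt (fun y j => ∑ i, w y i * T y i j)
      (∑ i, w x i * divT T x i + ∑ i, ∑ j, T x i j * gradV w x j i) x :=
  ⟨fun j => DifferentiableAt.fun_sum fun i _ => (hw i).fun_mul (hT i j), divV_contract hw hT⟩

theorem hasDivAt_contract3 (hT : ∀ i j, DifferentiableAt ℝ (fun y => T y i j) x)
    (hP : ∀ i j k, DifferentiableAt ℝ (fun y => P y i j k) x) :
    HasDivAt (fun y k => ∑ i, ∑ j, T y i j * P y i j k)
      (∑ i, ∑ j, T x i j * divT3 P x i j + ∑ i, ∑ j, ∑ k, P x i j k * gradT T x k i j) x :=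
  ⟨fun k => DifferentiableAt.fun_sum fun i _ => DifferentiableAt.fun_sum fun j _ =>
    (hT i j).fun_mul (hP i j k), divV_contract3 hT hP⟩

end HasDivAt

theorem stf2_const_mul (c : ℝ) (A : Fin 3 → Fin 3 → ℝ) (i j : Fin 3) :
    stf2 (fun i j => c * A i j) i j = c * stf2 A i j := by
  simp only [stf2, ← Finset.mul_sum]; ring

theorem stf3_const_mul (c : ℝ) (A : Fin 3 → Fin 3 → Fin 3 → ℝ) (i j k : Fin 3) :
    stf3 (fun i j k => c * A i j k) i j k = c * stf3 A i j k := by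
  have h : sym3 (fun i j k => c * A i j k) = fun i j k => c * sym3 A i j k := by
    ext i j k; simp only [sym3]; ring
  simp only [stf3, h, ← Finset.mul_sum]; ring

/-! ### Regularity of first-order derivative tensors -/

section Regularity

variable {x : E3} {w : E3 → Fin 3 → ℝ} {T : E3 → Fin 3 → Fin 3 → ℝ}

theorem contDiffAt_divV (hw : ∀ i, ContDiffAt ℝ 2 (fun y => w y i) x) :
    ContDiffAt ℝ 1 (divV w) x :=
  ContDiffAt.sum fun i _ => contDiffAt_pd i (hw i)

theorem contDiffAt_divT (hT : ∀ i j, ContDiffAt ℝ 2 (fun y => T y i j) x) (i : Fin 3) :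
    ContDiffAt ℝ 1 (fun y => divT T y i) x :=
  ContDiffAt.sum fun j _ => contDiffAt_pd j (hT i j)

theorem contDiffAt_gradV (hw : ∀ i, ContDiffAt ℝ 2 (fun y => w y i) x) (i j : Fin 3) :
    ContDiffAt ℝ 1 (fun y => gradV w y i j) x :=
  contDiffAt_pd i (hw j)

theorem contDiffAt_gradT (hT : ∀ i j, ContDiffAt ℝ 2 (fun y => T y i j) x) (i j k : Fin 3) :
    ContDiffAt ℝ 1 (fun y => gradT T y i j k) x :=
  contDiffAt_pd i (hT j k)

theorem contDiffAt_stf2 {A : E3 → Fin 3 → Fin 3 → ℝ}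
    (hA : ∀ i j, ContDiffAt ℝ 1 (fun y => A y i j) x) (i j : Fin 3) :
    ContDiffAt ℝ 1 (fun y => stf2 (A y) i j) x := by
  simp only [stf2, Fin.sum_univ_three]
  fun_prop

theorem contDiffAt_stf3 {A : E3 → Fin 3 → Fin 3 → Fin 3 → ℝ}
    (hA : ∀ i j k, ContDiffAt ℝ 1 (fun y => A y i j k) x) (i j k : Fin 3) :
    ContDiffAt ℝ 1 (fun y => stf3 (A y) i j k) x := by
  have h : ∀ i j k, ContDiffAt ℝ 1 (fun y => sym3 (A y) i j k) x := by
    intro i j k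
    simp only [sym3]
    fun_prop
  simp only [stf3, Fin.sum_univ_three]
  fun_prop

end Regularity

/-- The state of `S` at `x`, in Cartesian components. -/
noncomputable def pointState (Kn : ℝ) (S : Fields) (θW : ℝ → E3 → ℝ) (vW : ℝ → E3 → Fin 3 → ℝ)
    (t : ℝ) (x : E3) : WallState where
  θ := S.θ t x
  θW := θW t x
  v := S.v t x
  vW := vW t x
  q := S.q t x
  dθ := fun i => Kn * pd i (S.θ t) x
  dv := fun i j => Kn * gradV (S.v t) x i j
  dq := fun i j => Kn * gradV (S.q t) x i j
  σ := S.σ t x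
  dσ := fun i j k => Kn * gradT (S.σ t) x i j k

theorem wallState_eq_rotate (Kn : ℝ) (S : Fields) (θW : ℝ → E3 → ℝ) (vW : ℝ → E3 → Fin 3 → ℝ)
    (e : E3 → Fin 3 → E3) (t : ℝ) (x : E3) :
    wallState Kn S θW vW e t x = (pointState Kn S θW vW t x).rotate (e x) := rfl

section PointState

variable (Kn : ℝ) (S : Fields) (θW : ℝ → E3 → ℝ) (vW : ℝ → E3 → Fin 3 → ℝ) (t : ℝ) (x : E3)

theorem pointState_divq : (pointState Kn S θW vW t x).divq = Kn * divV (S.q t) x := by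
  simp only [WallState.divq, pointState, gradV, divV, Finset.mul_sum]

theorem pointState_divσ (a : Fin 3) :
    (pointState Kn S θW vW t x).divσ a = Kn * divT (S.σ t) x a := by
  simp only [WallState.divσ, pointState, gradT, divT, Finset.mul_sum]

theorem pointState_Dv (a b : Fin 3) :
    (pointState Kn S θW vW t x).Dv a b = Kn * stf2 (gradV (S.v t) x) a b :=
  stf2_const_mul _ _ _ _

theorem pointState_Dq (a b : Fin 3) :
    (pointState Kn S θW vW t x).Dq a b = Kn * stf2 (gradV (S.q t) x) a b :=
  stf2_const_mul _ _ _ _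

theorem pointState_Dσ (a b c : Fin 3) :
    (pointState Kn S θW vW t x).Dσ a b c = Kn * stf3 (gradT (S.σ t) x) a b c :=
  stf3_const_mul _ _ _ _ _

end PointState

/-- The entropy flux `-J`. -/
noncomputable def fluxField (D : MomentCoeffs) (Kn : ℝ) (S : Fields) (θW : ℝ → E3 → ℝ)
    (vW : ℝ → E3 → Fin 3 → ℝ) (t : ℝ) (x : E3) (j : Fin 3) : ℝ :=
  (S.ρ t x + S.θ t x) * S.v t x j + D.flux (pointState Kn S θW vW t x) j

namespace IsSolution

variable {K : EqCoeffs} {Kn : ℝ} {I : Set ℝ} {Ω : Set E3} {S : Fields}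
  {θW : ℝ → E3 → ℝ} {vW : ℝ → E3 → Fin 3 → ℝ} {t : ℝ} {x : E3}

theorem contDiffAt_sum_uV (D : MomentCoeffs) (hS : IsSolution K Kn I Ω S) (ht : t ∈ I)
    (hx : x ∈ closure Ω) (c : Fin 2 → ℝ) (i : Fin 3) :
    ContDiffAt ℝ 1 (fun y => ∑ m, c m * D.uV (pointState Kn S θW vW t y) i m) x := by
  simp only [D.sum_mul_uV, pointState_divσ]
  have h1 := contDiffAt_pd i (hS.reg_θ.space t ht x hx)
  have h2 := contDiffAt_divT (fun i j => (hS.reg_σ i j).space t ht x hx) i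
  have h3 := ((hS.reg_q i).space t ht x hx).of_le one_le_two
  simp only [pointState]
  fun_prop

theorem contDiffAt_sum_uT (D : MomentCoeffs) (hS : IsSolution K Kn I Ω S) (ht : t ∈ I)
    (hx : x ∈ closure Ω) (c : Fin 2 → ℝ) (i j : Fin 3) :
    ContDiffAt ℝ 1 (fun y => ∑ m, c m * D.uT (pointState Kn S θW vW t y) i j m) x := by
  simp only [D.sum_mul_uT, pointState_Dv, pointState_Dq]
  have h1 := contDiffAt_stf2 (contDiffAt_gradV (fun i => (hS.reg_v i).space t ht x hx)) i j
  have h2 := contDiffAt_stf2 (contDiffAt_gradV (fun i => (hS.reg_q i).space t ht x hx)) i j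
  have h3 := ((hS.reg_σ i j).space t ht x hx).of_le one_le_two
  simp only [pointState]
  fun_prop

theorem contDiffAt_uS (D : MomentCoeffs) (hS : IsSolution K Kn I Ω S) (ht : t ∈ I)
    (hx : x ∈ closure Ω) : ContDiffAt ℝ 1 (fun y => D.uS (pointState Kn S θW vW t y)) x := by
  simp only [MomentCoeffs.uS, pointState_divq]
  have h1 := contDiffAt_divV (fun i => (hS.reg_q i).space t ht x hx)
  fun_prop

theorem contDiffAt_uTT (D : MomentCoeffs) (hS : IsSolution K Kn I Ω S) (ht : t ∈ I)
    (hx : x ∈ closure Ω) (i j k : Fin 3) :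
    ContDiffAt ℝ 1 (fun y => D.uTT (pointState Kn S θW vW t y) i j k) x := by
  simp only [MomentCoeffs.uTT, pointState_Dσ]
  have h1 := contDiffAt_stf3 (contDiffAt_gradT (fun i j => (hS.reg_σ i j).space t ht x hx)) i j k
  fun_prop

/-- The second-order moments contain first derivatives of the fields, so `C²` fields give exactly
the `C¹` flux that the divergence theorem requires. -/
theorem contDiffAt_fluxField (D : MomentCoeffs) (hS : IsSolution K Kn I Ω S) (ht : t ∈ I)
    (hx : x ∈ closure Ω) (j : Fin 3) :
    ContDiffAt ℝ 1 (fun y => fluxField D Kn S θW vW t y j) x := by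
  have hρ := (hS.reg_ρ.space t ht x hx).of_le one_le_two
  have hθ := (hS.reg_θ.space t ht x hx).of_le one_le_two
  have hv := fun i => ((hS.reg_v i).space t ht x hx).of_le one_le_two
  have hq := fun i => ((hS.reg_q i).space t ht x hx).of_le one_le_two
  have hσ := fun i j => ((hS.reg_σ i j).space t ht x hx).of_le one_le_two
  have hU := fun c i => hS.contDiffAt_sum_uV (θW := θW) (vW := vW) D ht hx c i
  have hT := fun c i j => hS.contDiffAt_sum_uT (θW := θW) (vW := vW) D ht hx c i j
  have hs := hS.contDiffAt_uS (θW := θW) (vW := vW) D ht hx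
  have hP := fun i j k => hS.contDiffAt_uTT (θW := θW) (vW := vW) D ht hx i j k
  have e1 : ∀ y, (pointState Kn S θW vW t y).θ = S.θ t y := fun _ => rfl
  have e2 : ∀ y, (pointState Kn S θW vW t y).v = S.v t y := fun _ => rfl
  have e3 : ∀ y, (pointState Kn S θW vW t y).q = S.q t y := fun _ => rfl
  have e4 : ∀ y, (pointState Kn S θW vW t y).σ = S.σ t y := fun _ => rfl
  simp only [fluxField, MomentCoeffs.flux, e1, e2, e3, e4]
  refine ((hρ.add hθ).mul (hv j)).add ?_
  refine ContDiffAt.add (ContDiffAt.sub (ContDiffAt.sub (ContDiffAt.add (ContDiffAt.sub ?_ ?_) ?_) ?_) ?_) ?_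
  · exact (contDiffAt_const.mul hθ).mul (hq j)
  · exact (contDiffAt_const.mul hθ).mul (hU _ j)
  · exact ContDiffAt.sum fun a _ => (hv a).mul
      ((contDiffAt_const.mul (hσ a j)).add (contDiffAt_const.mul (hT _ a j)))
  · exact contDiffAt_const.mul (ContDiffAt.sum fun a _ => (hq a).mul (hσ a j))
  · exact contDiffAt_const.mul ((ContDiffAt.sum fun a _ => (hq a).mul (hT _ a j)).add
      ((contDiffAt_const.mul (hq j)).mul hs))
  · exact contDiffAt_const.mul ((ContDiffAt.sum fun a _ => (hσ a j).mul (hU _ a)).add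
      (contDiffAt_const.mul (ContDiffAt.sum fun a _ => ContDiffAt.sum fun b _ =>
        (hσ a b).mul (hP a b j))))

end IsSolution

end LinearR13

namespace LinearR13

/-! ### The local entropy balance -/

theorem pd_lincomb {f g h : E3 → ℝ} {x : E3} (k : Fin 3) (a b c : ℝ) (hf : DifferentiableAt ℝ f x)
    (hg : DifferentiableAt ℝ g x) (hh : DifferentiableAt ℝ h x) :
    pd k (fun y => a * f y + b * g y + c * h y) x = a * pd k f x + b * pd k g x + c * pd k h x := by
  rw [pd_add _ ((hf.const_mul a).fun_add (hg.const_mul b)) (hh.const_mul c),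
    pd_add _ (hf.const_mul a) (hg.const_mul b), pd_const_mul _ _ hf, pd_const_mul _ _ hg,
    pd_const_mul _ _ hh]

/-- Divergence of an entropy flux composed of abstract moments. -/
theorem hasDivAt_flux {x : E3} {ρ θ s : E3 → ℝ} {v q cU aU : E3 → Fin 3 → ℝ}
    {σ cT aT : E3 → Fin 3 → Fin 3 → ℝ} {P : E3 → Fin 3 → Fin 3 → Fin 3 → ℝ}
    (hρ : DifferentiableAt ℝ ρ x) (hθ : DifferentiableAt ℝ θ x) (hs : DifferentiableAt ℝ s x)
    (hv : ∀ i, DifferentiableAt ℝ (fun y => v y i) x)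
    (hq : ∀ i, DifferentiableAt ℝ (fun y => q y i) x)
    (hcU : ∀ i, DifferentiableAt ℝ (fun y => cU y i) x)
    (haU : ∀ i, DifferentiableAt ℝ (fun y => aU y i) x)
    (hσ : ∀ i j, DifferentiableAt ℝ (fun y => σ y i j) x)
    (hcT : ∀ i j, DifferentiableAt ℝ (fun y => cT y i j) x)
    (haT : ∀ i j, DifferentiableAt ℝ (fun y => aT y i j) x)
    (hP : ∀ i j k, DifferentiableAt ℝ (fun y => P y i j k) x)
    (c₁ c₂ c₃ c₄ c₅ c₆ c₇ c₈ c₉ : ℝ) :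
    divV (fun y j => (ρ y + θ y) * v y j + (c₁ * θ y * q y j - c₂ * θ y * cU y j
      + ∑ a, v y a * (c₃ * σ y a j + c₄ * cT y a j) - c₅ * ∑ a, q y a * σ y a j
      - c₆ * ((∑ a, q y a * aT y a j) + c₇ * q y j * s y)
      + c₈ * ((∑ a, σ y a j * aU y a) + c₉ * ∑ a, ∑ b, σ y a b * P y a b j))) x =
    (ρ x + θ x) * divV v x + ∑ j, v x j * pd j ρ x + ∑ j, v x j * pd j θ x
      + c₁ * (θ x * divV q x + ∑ j, q x j * pd j θ x)
      - c₂ * (θ x * divV cU x + ∑ j, cU x j * pd j θ x)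
      + c₃ * (∑ i, v x i * divT σ x i + ∑ i, ∑ j, σ x i j * gradV v x j i)
      + c₄ * (∑ i, v x i * divT cT x i + ∑ i, ∑ j, cT x i j * gradV v x j i)
      - c₅ * (∑ i, q x i * divT σ x i + ∑ i, ∑ j, σ x i j * gradV q x j i)
      - c₆ * (∑ i, q x i * divT aT x i + ∑ i, ∑ j, aT x i j * gradV q x j i)
      - c₆ * c₇ * (s x * divV q x + ∑ j, q x j * pd j s x)
      + c₈ * (∑ i, aU x i * divT σ x i + ∑ i, ∑ j, σ x i j * gradV aU x j i)
      + c₈ * c₉ * (∑ i, ∑ j, σ x i j * divT3 P x i j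
        + ∑ i, ∑ j, ∑ k, P x i j k * gradT σ x k i j) := by
  have hrt : DifferentiableAt ℝ (fun y => ρ y + θ y) x := hρ.fun_add hθ
  have key := ((((((((((hasDivAt_smul hrt hv).add ((hasDivAt_smul hθ hq).const_mul c₁)).add
    ((hasDivAt_smul hθ hcU).const_mul (-c₂))).add ((hasDivAt_contract hv hσ).const_mul c₃)).add
    ((hasDivAt_contract hv hcT).const_mul c₄)).add ((hasDivAt_contract hq hσ).const_mul (-c₅))).add
    ((hasDivAt_contract hq haT).const_mul (-c₆))).add ((hasDivAt_smul hs hq).const_mul (-(c₆ * c₇)))).add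
    ((hasDivAt_contract haU hσ).const_mul c₈)).add ((hasDivAt_contract3 hσ hP).const_mul (c₈ * c₉))).div
  -- The flux is regrouped into products of the three shapes for which the product rule is
  -- available.
  have hfun : (fun y j => (ρ y + θ y) * v y j + (c₁ * θ y * q y j - c₂ * θ y * cU y j
      + ∑ a, v y a * (c₃ * σ y a j + c₄ * cT y a j) - c₅ * ∑ a, q y a * σ y a j
      - c₆ * ((∑ a, q y a * aT y a j) + c₇ * q y j * s y)
      + c₈ * ((∑ a, σ y a j * aU y a) + c₉ * ∑ a, ∑ b, σ y a b * P y a b j))) =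
      fun y j => (ρ y + θ y) * v y j + c₁ * (θ y * q y j) + -c₂ * (θ y * cU y j)
        + c₃ * ∑ a, v y a * σ y a j + c₄ * ∑ a, v y a * cT y a j + -c₅ * ∑ a, q y a * σ y a j
        + -c₆ * ∑ a, q y a * aT y a j + -(c₆ * c₇) * (s y * q y j) + c₈ * ∑ a, aU y a * σ y a j
        + c₈ * c₉ * ∑ a, ∑ b, σ y a b * P y a b j := by
    ext y j
    simp only [Fin.sum_univ_three]
    ring
  rw [hfun, key]
  simp only [pd_add _ hρ hθ, mul_add, Finset.sum_add_distrib]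
  ring

theorem sum_mul_lincomb₃ (v A B C : Fin 3 → ℝ) (a b c : ℝ) :
    ∑ i, v i * (a * A i + b * B i + c * C i)
      = a * ∑ i, v i * A i + b * ∑ i, v i * B i + c * ∑ i, v i * C i := by
  simp only [Fin.sum_univ_three]; ring

theorem sum_sum_mul_lincomb₃ (v A B C : Fin 3 → Fin 3 → ℝ) (a b c : ℝ) :
    ∑ i, ∑ j, v i j * (a * A i j + b * B i j + c * C i j)
      = a * ∑ i, ∑ j, v i j * A i j + b * ∑ i, ∑ j, v i j * B i j + c * ∑ i, ∑ j, v i j * C i j := by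
  simp only [Fin.sum_univ_three]; ring

theorem sum_sum_mul_transpose {B : Fin 3 → Fin 3 → ℝ} (hB : ∀ i j, B i j = B j i)
    (A : Fin 3 → Fin 3 → ℝ) : ∑ i, ∑ j, B i j * A j i = ∑ i, ∑ j, B i j * A i j := by
  rw [Finset.sum_comm]
  exact Finset.sum_congr rfl fun i _ => Finset.sum_congr rfl fun j _ => by rw [hB]

theorem sum_mul_cycle {P : Fin 3 → Fin 3 → Fin 3 → ℝ} (h1 : ∀ i j k, P i j k = P j i k)
    (h2 : ∀ i j k, P i j k = P i k j) (A : Fin 3 → Fin 3 → Fin 3 → ℝ) :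
    ∑ i, ∑ j, ∑ k, P i j k * A k i j = ∑ i, ∑ j, ∑ k, P i j k * A i j k := by
  have h : ∀ i j k, P i j k = P k i j := fun i j k => by rw [h2, h1]
  calc _ = ∑ i, ∑ k, ∑ j, P i j k * A k i j := Finset.sum_congr rfl fun i _ => Finset.sum_comm
    _ = ∑ k, ∑ i, ∑ j, P i j k * A k i j := Finset.sum_comm
    _ = _ := Finset.sum_congr rfl fun k _ => Finset.sum_congr rfl fun i _ =>
        Finset.sum_congr rfl fun j _ => by rw [h i j k]

theorem isStf_lincomb {A B C : Fin 3 → Fin 3 → ℝ} (hA : IsStf A) (hB : IsStf B) (hC : IsStf C)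
    (a b c : ℝ) : IsStf fun i j => a * A i j + b * B i j + c * C i j := by
  refine ⟨fun i j => by simp only [hA.1 i j, hB.1 i j, hC.1 i j], ?_⟩
  simp only [Finset.sum_add_distrib, ← Finset.mul_sum, hA.2, hB.2, hC.2]
  ring

theorem MomentCoeffs.sum_uTT (D : MomentCoeffs) (w : WallState) (k : Fin 3) :
    ∑ i, D.uTT w i i k = 0 := by
  simp only [MomentCoeffs.uTT, WallState.Dσ]
  rw [← Finset.sum_div, ← Finset.mul_sum, stf3_trace, mul_zero, zero_div]

namespace IsSolution

variable {D : MomentCoeffs} {Kn : ℝ} {I : Set ℝ} {Ω : Set E3} {S : Fields}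
  {θW : ℝ → E3 → ℝ} {vW : ℝ → E3 → Fin 3 → ℝ} {t : ℝ} {x : E3}

theorem pd_sum_uV {K : EqCoeffs} (D : MomentCoeffs) (hS : IsSolution K Kn I Ω S) (ht : t ∈ I)
    (hx : x ∈ closure Ω) (c : Fin 2 → ℝ) (i k : Fin 3) :
    pd k (fun y => ∑ m, c m * D.uV (pointState Kn S θW vW t y) i m) x =
      (-√(15 / 2) * MomentCoeffs.bil c D.R1 D.c1 * Kn) * pd k (fun y => pd i (S.θ t) y) x
      + (1 / √15 * MomentCoeffs.bil c D.R1 D.a5 * Kn) * pd k (fun y => divT (S.σ t) y i) x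
      + (√(2 / 15) * MomentCoeffs.bil c D.R1 D.r1) * pd k (fun y => S.q t y i) x := by
  have h1 := (contDiffAt_pd i (hS.reg_θ.space t ht x hx)).differentiableAt one_ne_zero
  have h2 := (contDiffAt_divT (fun i j => (hS.reg_σ i j).space t ht x hx) i).differentiableAt one_ne_zero
  have h3 := ((hS.reg_q i).space t ht x hx).differentiableAt two_ne_zero
  rw [← pd_lincomb k _ _ _ h1 h2 h3]
  congr 1
  ext y
  rw [D.sum_mul_uV, pointState_divσ]
  simp only [pointState]
  ring

theorem pd_sum_uT {K : EqCoeffs} (D : MomentCoeffs) (hS : IsSolution K Kn I Ω S) (ht : t ∈ I)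
    (hx : x ∈ closure Ω) (c : Fin 2 → ℝ) (i j k : Fin 3) :
    pd k (fun y => ∑ m, c m * D.uT (pointState Kn S θW vW t y) i j m) x =
      (√15 * MomentCoeffs.bil c D.R2 D.c2 * Kn) * pd k (fun y => stf2 (gradV (S.v t) y) i j) x
      + (-√(2 / 15) * MomentCoeffs.bil c D.R2 D.a4 * Kn) * pd k (fun y => stf2 (gradV (S.q t) y) i j) x
      + (-(1 / √15) * MomentCoeffs.bil c D.R2 D.r2) * pd k (fun y => S.σ t y i j) x := by
  have h1 := (contDiffAt_stf2 (contDiffAt_gradV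
    (fun i => (hS.reg_v i).space t ht x hx)) i j).differentiableAt one_ne_zero
  have h2 := (contDiffAt_stf2 (contDiffAt_gradV
    (fun i => (hS.reg_q i).space t ht x hx)) i j).differentiableAt one_ne_zero
  have h3 := ((hS.reg_σ i j).space t ht x hx).differentiableAt two_ne_zero
  rw [← pd_lincomb k _ _ _ h1 h2 h3]
  congr 1
  ext y
  rw [D.sum_mul_uT, pointState_Dv, pointState_Dq]
  simp only [pointState]
  ring

theorem divT_sum_uT {K : EqCoeffs} (D : MomentCoeffs) (hS : IsSolution K Kn I Ω S) (ht : t ∈ I)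
    (hx : x ∈ closure Ω) (c : Fin 2 → ℝ) (i : Fin 3) :
    divT (fun y i j => ∑ m, c m * D.uT (pointState Kn S θW vW t y) i j m) x i =
      (√15 * MomentCoeffs.bil c D.R2 D.c2 * Kn) * divT (fun y => stf2 (gradV (S.v t) y)) x i
      + (-√(2 / 15) * MomentCoeffs.bil c D.R2 D.a4 * Kn) * divT (fun y => stf2 (gradV (S.q t) y)) x i
      + (-(1 / √15) * MomentCoeffs.bil c D.R2 D.r2) * divT (S.σ t) x i := by
  simp only [divT, hS.pd_sum_uT D ht hx, Finset.sum_add_distrib, Finset.mul_sum]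

theorem pd_uS {K : EqCoeffs} (D : MomentCoeffs) (hS : IsSolution K Kn I Ω S) (ht : t ∈ I)
    (hx : x ∈ closure Ω) (k : Fin 3) :
    pd k (fun y => D.uS (pointState Kn S θW vW t y)) x
      = -√(2 / 15) * D.A46 / D.L0 * Kn * pd k (divV (S.q t)) x := by
  have h1 := (contDiffAt_divV (fun i => (hS.reg_q i).space t ht x hx)).differentiableAt one_ne_zero
  rw [← pd_const_mul _ _ h1]
  congr 1
  ext y
  rw [MomentCoeffs.uS, pointState_divq]
  ring

theorem divT3_uTT {K : EqCoeffs} (D : MomentCoeffs) (hS : IsSolution K Kn I Ω S) (ht : t ∈ I)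
    (hx : x ∈ closure Ω) (i j : Fin 3) :
    divT3 (fun y => D.uTT (pointState Kn S θW vW t y)) x i j
      = 1 / √15 * D.A511 / D.L3 * Kn * divT3 (fun y => stf3 (gradT (S.σ t) y)) x i j := by
  have h1 := fun k => (contDiffAt_stf3 (contDiffAt_gradT
    (fun i j => (hS.reg_σ i j).space t ht x hx)) i j k).differentiableAt one_ne_zero
  rw [divT3, divT3, Finset.mul_sum]
  refine Finset.sum_congr rfl fun k _ => ?_
  rw [← pd_const_mul _ _ (h1 k)]
  congr 1
  ext y
  rw [MomentCoeffs.uTT, pointState_Dσ]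
  ring

/-- Production of entropy in terms of the gradients of the fields. -/
theorem production_pointState {K : EqCoeffs} (D : MomentCoeffs) (hS : IsSolution K Kn I Ω S)
    (ht : t ∈ I) (hx : x ∈ closure Ω) :
    D.production (pointState Kn S θW vW t x) =
      2 / 15 * (D.L1 0 0 - MomentCoeffs.bil D.r1 D.R1 D.r1) * ∑ i, S.q t x i * S.q t x i
      + MomentCoeffs.bil D.r1 D.R1 D.c1 * Kn * ∑ i, S.q t x i * pd i (S.θ t) x
      - √2 / 15 * MomentCoeffs.bil D.r1 D.R1 D.a5 * Kn * ∑ i, S.q t x i * divT (S.σ t) x i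
      - √(15 / 2) * Kn * ∑ j, (∑ m, D.c1 m * D.uV (pointState Kn S θW vW t x) j m) * pd j (S.θ t) x
      + 1 / √15 * Kn * ∑ i, (∑ m, D.a5 m * D.uV (pointState Kn S θW vW t x) i m) * divT (S.σ t) x i
      + 1 / 15 * (D.L2 0 0 - MomentCoeffs.bil D.r2 D.R2 D.r2)
        * ∑ i, ∑ j, S.σ t x i j * S.σ t x i j
      + MomentCoeffs.bil D.r2 D.R2 D.c2 * Kn * ∑ i, ∑ j, S.σ t x i j * gradV (S.v t) x i j
      - √2 / 15 * MomentCoeffs.bil D.r2 D.R2 D.a4 * Kn * ∑ i, ∑ j, S.σ t x i j * gradV (S.q t) x i j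
      + √15 * Kn * ∑ i, ∑ j, (∑ m, D.c2 m * D.uT (pointState Kn S θW vW t x) i j m)
        * gradV (S.v t) x i j
      - √(2 / 15) * Kn * ∑ i, ∑ j, (∑ m, D.a4 m * D.uT (pointState Kn S θW vW t x) i j m)
        * gradV (S.q t) x i j
      - √(2 / 15) * D.A46 * Kn * (D.uS (pointState Kn S θW vW t x) * divV (S.q t) x)
      + 1 / √15 * D.A511 * Kn * ∑ i, ∑ j, ∑ k, D.uTT (pointState Kn S θW vW t x) i j k
        * gradT (S.σ t) x i j k := by
  -- The state is made opaque so that its moments stay atoms in the algebra below.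
  obtain ⟨w, hw⟩ : ∃ w, w = pointState Kn S θW vW t x := ⟨_, rfl⟩
  have hdθ : ∀ i, w.dθ i = Kn * pd i (S.θ t) x := fun i => by rw [hw]; rfl
  have hdσ : ∀ i, w.divσ i = Kn * divT (S.σ t) x i := fun i => by rw [hw, pointState_divσ]
  have hDv : ∀ i j, w.Dv i j = Kn * stf2 (gradV (S.v t) x) i j :=
    fun i j => by rw [hw, pointState_Dv]
  have hDq : ∀ i j, w.Dq i j = Kn * stf2 (gradV (S.q t) x) i j :=
    fun i j => by rw [hw, pointState_Dq]
  have hDσ : ∀ i j k, w.Dσ i j k = Kn * stf3 (gradT (S.σ t) x) i j k :=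
    fun i j k => by rw [hw, pointState_Dσ]
  have hdq : w.divq = Kn * divV (S.q t) x := by rw [hw, pointState_divq]
  have hwq : w.q = S.q t x := by rw [hw]; rfl
  have hwσ : w.σ = S.σ t x := by rw [hw]; rfl
  have hσ := hS.stf_σ t ht x hx
  have r1 : √(2 / 15) * √(15 / 2) = (1 : ℝ) := by
    rw [← Real.sqrt_mul (by norm_num)]; norm_num
  have r2 : √(2 / 15) * (1 / √15) = √2 / 15 := by
    rw [sqrt_two_fifteen, one_div_sqrt_fifteen]
    have : √15 * √15 = (15 : ℝ) := Real.mul_self_sqrt (by norm_num)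
    linear_combination √2 / 225 * this
  have r3 : √(2 / 15) * √(2 / 15) = (2 / 15 : ℝ) := Real.mul_self_sqrt (by norm_num)
  have r4 : 1 / √15 * √15 = (1 : ℝ) := by
    rw [one_div_mul_cancel (by positivity)]
  have r5 : 1 / √15 * (1 / √15) = (1 / 15 : ℝ) := by
    rw [one_div_mul_one_div, Real.mul_self_sqrt (by norm_num)]
  -- Contraction with a symmetric trace-free tensor does not see the symmetrization of gradients;
  -- this allows the full gradients on the right-hand side.
  have hcT : ∀ c : Fin 2 → ℝ, IsStf fun i j => ∑ m, c m * D.uT w i j m := by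
    intro c
    have := isStf_lincomb (isStf_stf2 (gradV (S.v t) x)) (isStf_stf2 (gradV (S.q t) x)) hσ
      (√15 * MomentCoeffs.bil c D.R2 D.c2 * Kn) (-√(2 / 15) * MomentCoeffs.bil c D.R2 D.a4 * Kn)
      (-(1 / √15) * MomentCoeffs.bil c D.R2 D.r2)
    refine (congrArg IsStf ?_).mp this
    ext i j
    rw [D.sum_mul_uT, hDv, hDq, hwσ]
    ring
  have hPP := sum_mul_stf3 (P := D.uTT w) D.uTT_swap D.uTT_swap' (D.sum_uTT w)
    (gradT (S.σ t) x)
  have hV : ∀ a, 2 / 15 * D.L1 0 0 * w.q a ^ 2 - √(2 / 15) * w.q a * ∑ m, D.r1 m * D.uV w a m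
      = 2 / 15 * (D.L1 0 0 - MomentCoeffs.bil D.r1 D.R1 D.r1) * (w.q a * w.q a)
      + MomentCoeffs.bil D.r1 D.R1 D.c1 * (w.q a * w.dθ a)
      - √2 / 15 * MomentCoeffs.bil D.r1 D.R1 D.a5 * (w.q a * w.divσ a) := by
    intro a
    rw [D.sum_mul_uV]
    linear_combination MomentCoeffs.bil D.r1 D.R1 D.c1 * (w.q a * w.dθ a) * r1
      - MomentCoeffs.bil D.r1 D.R1 D.a5 * (w.q a * w.divσ a) * r2
      - MomentCoeffs.bil D.r1 D.R1 D.r1 * (w.q a * w.q a) * r3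
  have hT : ∀ a b, 1 / 15 * D.L2 0 0 * w.σ a b ^ 2
      + 1 / √15 * w.σ a b * ∑ m, D.r2 m * D.uT w a b m
      = 1 / 15 * (D.L2 0 0 - MomentCoeffs.bil D.r2 D.R2 D.r2) * (w.σ a b * w.σ a b)
      + MomentCoeffs.bil D.r2 D.R2 D.c2 * (w.σ a b * w.Dv a b)
      - √2 / 15 * MomentCoeffs.bil D.r2 D.R2 D.a4 * (w.σ a b * w.Dq a b) := by
    intro a b
    rw [D.sum_mul_uT]
    linear_combination MomentCoeffs.bil D.r2 D.R2 D.c2 * (w.σ a b * w.Dv a b) * r4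
      - MomentCoeffs.bil D.r2 D.R2 D.a4 * (w.σ a b * w.Dq a b) * r2
      - MomentCoeffs.bil D.r2 D.R2 D.r2 * (w.σ a b * w.σ a b) * r5
  have k1 := sum_mul_stf2 hσ (gradV (S.v t) x)
  have k2 := sum_mul_stf2 hσ (gradV (S.q t) x)
  have k3 := sum_mul_stf2 (hcT D.c2) (gradV (S.v t) x)
  have k4 := sum_mul_stf2 (hcT D.a4) (gradV (S.q t) x)
  obtain ⟨gc, hgc⟩ : ∃ g : Fin 3 → ℝ, ∀ a, ∑ m, D.c1 m * D.uV w a m = g a := ⟨_, fun _ => rfl⟩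
  obtain ⟨ga, hga⟩ : ∃ g : Fin 3 → ℝ, ∀ a, ∑ m, D.a5 m * D.uV w a m = g a := ⟨_, fun _ => rfl⟩
  obtain ⟨hc, hhc⟩ : ∃ g : Fin 3 → Fin 3 → ℝ, ∀ a b, ∑ m, D.c2 m * D.uT w a b m = g a b :=
    ⟨_, fun _ _ => rfl⟩
  obtain ⟨ha, hha⟩ : ∃ g : Fin 3 → Fin 3 → ℝ, ∀ a b, ∑ m, D.a4 m * D.uT w a b m = g a b :=
    ⟨_, fun _ _ => rfl⟩
  rw [← hw, MomentCoeffs.production, ← hPP, ← k1, ← k2, ← k3, ← k4]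
  simp only [hV, hT, hgc, hga, hhc, hha]
  simp only [hdθ, hdσ, hDv, hDq, hDσ, hdq, hwq, hwσ, Fin.sum_univ_three]
  ring

end IsSolution

end LinearR13

/-! ### Weighted field equations and the divergence of the flux -/

namespace LinearR13

namespace IsSolution

open MomentCoeffs (bil)

variable {K : EqCoeffs} {D : MomentCoeffs} {Kn : ℝ} {I : Set ℝ} {Ω : Set E3} {S : Fields}
  {θW : ℝ → E3 → ℝ} {vW : ℝ → E3 → Fin 3 → ℝ} {t : ℝ} {x : E3}

/-- The momentum equation, multiplied by the velocity. -/
theorem sum_v_mul_eq_v (hS : IsSolution K Kn I Ω S) (ht : t ∈ I) (hx : x ∈ Ω) :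
    ∑ i, S.v t x i * deriv (fun s => S.v s x i) t =
      -(∑ i, S.v t x i * pd i (S.ρ t) x) - ∑ i, S.v t x i * pd i (S.θ t) x
      + K.k3 * Kn * ∑ i, S.v t x i * divT (fun y => stf2 (gradV (S.v t) y)) x i
      + K.k4 * Kn * ∑ i, S.v t x i * divT (fun y => stf2 (gradV (S.q t) y)) x i
      - K.k5 * ∑ i, S.v t x i * divT (S.σ t) x i := by
  have h := hS.eq_v t ht x hx
  simp only [Fin.sum_univ_three]
  linear_combination S.v t x 0 * h 0 + S.v t x 1 * h 1 + S.v t x 2 * h 2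

/-- The heat flux equation, multiplied by the heat flux. -/
theorem sum_q_mul_eq_q (hS : IsSolution K Kn I Ω S) (ht : t ∈ I) (hx : x ∈ Ω) :
    ∑ i, S.q t x i * deriv (fun s => S.q s x i) t =
      -(5 / 2 * K.k0 * ∑ i, S.q t x i * pd i (S.θ t) x)
      + 5 / 2 * K.k4 * Kn * ∑ i, S.q t x i * divT (fun y => stf2 (gradV (S.v t) y)) x i
      + 2 * K.k6 * Kn * ∑ i, S.q t x i * pd i (divV (S.q t)) x
      + 12 / 5 * K.k7 * Kn * ∑ i, S.q t x i * divT (fun y => stf2 (gradV (S.q t) y)) x i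
      - K.k8 * (∑ i, S.q t x i * divT (S.σ t) x i)
      - 1 / Kn * (2 / 3) * K.l1 * ∑ i, S.q t x i * S.q t x i := by
  have h := hS.eq_q t ht x hx
  simp only [Fin.sum_univ_three]
  linear_combination S.q t x 0 * h 0 + S.q t x 1 * h 1 + S.q t x 2 * h 2

/-- The stress equation, multiplied by the stress. -/
theorem sum_σ_mul_eq_σ (hS : IsSolution K Kn I Ω S) (ht : t ∈ I) (hx : x ∈ Ω) :
    ∑ i, ∑ j, S.σ t x i j * deriv (fun s => S.σ s x i j) t =
      -(3 * K.k2 * Kn * ∑ i, ∑ j, S.σ t x i j * hess (S.θ t) x i j)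
      - 2 * K.k5 * (∑ i, ∑ j, S.σ t x i j * gradV (S.v t) x i j)
      - 4 / 5 * K.k8 * (∑ i, ∑ j, S.σ t x i j * gradV (S.q t) x i j)
      + 2 * K.k9 * Kn
        * (∑ i, ∑ j, S.σ t x i j * divT3 (fun y => stf3 (gradT (S.σ t) y)) x i j)
      + K.k10 * Kn * (∑ i, ∑ j, S.σ t x i j * gradV (divT (S.σ t)) x i j)
      - 1 / Kn * K.l2 * ∑ i, ∑ j, S.σ t x i j * S.σ t x i j := by
  have hσ := hS.stf_σ t ht x (subset_closure hx)
  have h := hS.eq_σ t ht x hx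
  rw [← sum_mul_stf2 hσ (hess (S.θ t) x), ← sum_mul_stf2 hσ (gradV (S.v t) x),
    ← sum_mul_stf2 hσ (gradV (S.q t) x), ← sum_mul_stf2 hσ (gradV (divT (S.σ t)) x)]
  have h' : ∀ i j, deriv (fun s => S.σ s x i j) t = -(3 * K.k2 * Kn * stf2 (hess (S.θ t) x) i j)
      - 2 * K.k5 * stf2 (gradV (S.v t) x) i j - 4 / 5 * K.k8 * stf2 (gradV (S.q t) x) i j
      + 2 * K.k9 * Kn * divT3 (fun y => stf3 (gradT (S.σ t) y)) x i j
      + K.k10 * Kn * stf2 (gradV (divT (S.σ t)) x) i j - 1 / Kn * K.l2 * S.σ t x i j :=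
    fun i j => by linear_combination h i j
  simp only [h', Fin.sum_univ_three]
  ring

/-- The product rule gives two kinds of terms. Fields times derivatives of moments match the
weighted equations; moments times gradients of fields match the production. -/
theorem divV_fluxField (hS : IsSolution K Kn I Ω S) (D : MomentCoeffs) (ht : t ∈ I)
    (hx : x ∈ closure Ω) : divV (fun y => fluxField D Kn S θW vW t y) x =
      (S.ρ t x + S.θ t x) * divV (S.v t) x + ∑ j, S.v t x j * pd j (S.ρ t) x
      + ∑ j, S.v t x j * pd j (S.θ t) x
      + D.c11 * (S.θ t x * divV (S.q t) x + ∑ j, S.q t x j * pd j (S.θ t) x)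
      - √(15 / 2) * (S.θ t x * (-√(15 / 2) * bil D.c1 D.R1 D.c1 * Kn * laplacian (S.θ t) x
        + 1 / √15 * bil D.c1 D.R1 D.a5 * Kn * divV (divT (S.σ t)) x
        + √(2 / 15) * bil D.c1 D.R1 D.r1 * divV (S.q t) x)
        + ∑ j, (∑ m, D.c1 m * D.uV (pointState Kn S θW vW t x) j m) * pd j (S.θ t) x)
      + D.c200 * (∑ i, S.v t x i * divT (S.σ t) x i + ∑ i, ∑ j, S.σ t x i j * gradV (S.v t) x i j)
      + √15 * (√15 * bil D.c2 D.R2 D.c2 * Kn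
          * (∑ i, S.v t x i * divT (fun y => stf2 (gradV (S.v t) y)) x i)
        - √(2 / 15) * bil D.c2 D.R2 D.a4 * Kn
          * (∑ i, S.v t x i * divT (fun y => stf2 (gradV (S.q t) y)) x i)
        - 1 / √15 * bil D.c2 D.R2 D.r2 * (∑ i, S.v t x i * divT (S.σ t) x i)
        + ∑ i, ∑ j, (∑ m, D.c2 m * D.uT (pointState Kn S θW vW t x) i j m) * gradV (S.v t) x i j)
      - √2 / 15 * D.A45 * (∑ i, S.q t x i * divT (S.σ t) x i
        + ∑ i, ∑ j, S.σ t x i j * gradV (S.q t) x i j)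
      - √(2 / 15) * (√15 * bil D.a4 D.R2 D.c2 * Kn
          * (∑ i, S.q t x i * divT (fun y => stf2 (gradV (S.v t) y)) x i)
        - √(2 / 15) * bil D.a4 D.R2 D.a4 * Kn
          * (∑ i, S.q t x i * divT (fun y => stf2 (gradV (S.q t) y)) x i)
        - 1 / √15 * bil D.a4 D.R2 D.r2 * (∑ i, S.q t x i * divT (S.σ t) x i)
        + ∑ i, ∑ j, (∑ m, D.a4 m * D.uT (pointState Kn S θW vW t x) i j m) * gradV (S.q t) x i j)
      - √(2 / 15) * D.A46 * (D.uS (pointState Kn S θW vW t x) * divV (S.q t) x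
        - √(2 / 15) * D.A46 / D.L0 * Kn * ∑ j, S.q t x j * pd j (divV (S.q t)) x)
      + 1 / √15 * (∑ i, (∑ m, D.a5 m * D.uV (pointState Kn S θW vW t x) i m) * divT (S.σ t) x i
        - √(15 / 2) * bil D.a5 D.R1 D.c1 * Kn * (∑ i, ∑ j, S.σ t x i j * hess (S.θ t) x i j)
        + 1 / √15 * bil D.a5 D.R1 D.a5 * Kn
          * (∑ i, ∑ j, S.σ t x i j * gradV (divT (S.σ t)) x i j)
        + √(2 / 15) * bil D.a5 D.R1 D.r1 * (∑ i, ∑ j, S.σ t x i j * gradV (S.q t) x i j))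
      + 1 / √15 * D.A511 * (1 / √15 * D.A511 / D.L3 * Kn
          * (∑ i, ∑ j, S.σ t x i j * divT3 (fun y => stf3 (gradT (S.σ t) y)) x i j)
        + ∑ i, ∑ j, ∑ k, D.uTT (pointState Kn S θW vW t x) i j k * gradT (S.σ t) x i j k) := by
  have h1 := fun c i =>
    (hS.contDiffAt_sum_uV (θW := θW) (vW := vW) D ht hx c i).differentiableAt one_ne_zero
  have h2 := fun c i j =>
    (hS.contDiffAt_sum_uT (θW := θW) (vW := vW) D ht hx c i j).differentiableAt one_ne_zero
  refine (hasDivAt_flux ((hS.reg_ρ.space t ht x hx).differentiableAt two_ne_zero)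
    ((hS.reg_θ.space t ht x hx).differentiableAt two_ne_zero)
    ((hS.contDiffAt_uS (θW := θW) (vW := vW) D ht hx).differentiableAt one_ne_zero)
    (fun i => ((hS.reg_v i).space t ht x hx).differentiableAt two_ne_zero)
    (fun i => ((hS.reg_q i).space t ht x hx).differentiableAt two_ne_zero)
    (h1 D.c1) (h1 D.a5)
    (fun i j => ((hS.reg_σ i j).space t ht x hx).differentiableAt two_ne_zero)
    (h2 D.c2) (h2 D.a4)
    (fun i j k =>
      (hS.contDiffAt_uTT (θW := θW) (vW := vW) D ht hx i j k).differentiableAt one_ne_zero)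
    D.c11 (√(15 / 2)) D.c200 (√15) (√2 / 15 * D.A45) (√(2 / 15)) D.A46 (1 / √15) D.A511).trans ?_
  have hσ := hS.stf_σ t ht x hx
  have hT : ∀ (c : Fin 2 → ℝ) i j, ∑ m, c m * D.uT (pointState Kn S θW vW t x) i j m
      = ∑ m, c m * D.uT (pointState Kn S θW vW t x) j i m := by
    intro c i j
    rw [D.sum_mul_uT, D.sum_mul_uT, pointState_Dv, pointState_Dq, pointState_Dv, pointState_Dq,
      stf2_symm _ i j, stf2_symm _ i j]
    simp only [pointState, hσ.1 i j]
  have e1 : divV (fun y i => ∑ m, D.c1 m * D.uV (pointState Kn S θW vW t y) i m) x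
      = -√(15 / 2) * bil D.c1 D.R1 D.c1 * Kn * laplacian (S.θ t) x
        + 1 / √15 * bil D.c1 D.R1 D.a5 * Kn * divV (divT (S.σ t)) x
        + √(2 / 15) * bil D.c1 D.R1 D.r1 * divV (S.q t) x := by
    simp only [divV, hS.pd_sum_uV D ht hx, laplacian, Finset.sum_add_distrib, Finset.mul_sum]
  have e2 : gradV (fun y i => ∑ m, D.a5 m * D.uV (pointState Kn S θW vW t y) i m) x
      = fun i j => -√(15 / 2) * bil D.a5 D.R1 D.c1 * Kn * hess (S.θ t) x i j
        + 1 / √15 * bil D.a5 D.R1 D.a5 * Kn * gradV (divT (S.σ t)) x i j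
        + √(2 / 15) * bil D.a5 D.R1 D.r1 * gradV (S.q t) x i j := by
    ext i j
    exact hS.pd_sum_uV D ht hx _ _ _
  have e3 := sum_mul_cycle (P := D.uTT (pointState Kn S θW vW t x)) MomentCoeffs.uTT_swap
    MomentCoeffs.uTT_swap' (gradT (S.σ t) x)
  rw [sum_sum_mul_transpose (hT D.c2) (gradV (S.v t) x),
    sum_sum_mul_transpose (hT D.a4) (gradV (S.q t) x),
    sum_sum_mul_transpose hσ.1 (gradV (S.v t) x), sum_sum_mul_transpose hσ.1 (gradV (S.q t) x),
    sum_sum_mul_transpose hσ.1 (gradV (fun y i => ∑ m, D.a5 m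
      * D.uV (pointState Kn S θW vW t y) i m) x), e1, e2, e3, sum_sum_mul_lincomb₃]
  simp only [hS.divT_sum_uT D ht hx, hS.pd_uS D ht hx,
    hS.divT3_uTT D ht hx, sum_mul_lincomb₃]
  have e4 : ∑ j, S.q t x j * (-√(2 / 15) * D.A46 / D.L0 * Kn * pd j (divV (S.q t)) x)
      = -√(2 / 15) * D.A46 / D.L0 * Kn * ∑ j, S.q t x j * pd j (divV (S.q t)) x := by
    rw [Finset.mul_sum]
    exact Finset.sum_congr rfl fun j _ => by ring
  have e5 : ∑ i, ∑ j, S.σ t x i j * (1 / √15 * D.A511 / D.L3 * Kn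
        * divT3 (fun y => stf3 (gradT (S.σ t) y)) x i j)
      = 1 / √15 * D.A511 / D.L3 * Kn
        * ∑ i, ∑ j, S.σ t x i j * divT3 (fun y => stf3 (gradT (S.σ t) y)) x i j := by
    simp only [Finset.mul_sum]
    exact Finset.sum_congr rfl fun i _ => Finset.sum_congr rfl fun j _ => by ring
  rw [e4, e5]
  ring

/-- The local entropy balance. -/
theorem entropy_balance (hS : IsSolution D.eqCoeffs Kn I Ω S) (hD : D.IsAdmissible) (hKn : 0 < Kn)
    (ht : t ∈ I) (hx : x ∈ Ω) :
    S.ρ t x * deriv (fun s => S.ρ s x) t + 3 / 2 * (S.θ t x * deriv (fun s => S.θ s x) t)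
      + ∑ i, S.v t x i * deriv (fun s => S.v s x i) t
      + 2 / 5 * ∑ i, S.q t x i * deriv (fun s => S.q s x i) t
      + 1 / 2 * ∑ i, ∑ j, S.σ t x i j * deriv (fun s => S.σ s x i j) t
      = 1 / Kn * D.production (pointState Kn S θW vW t x)
        - divV (fun y => fluxField D Kn S θW vW t y) x := by
  have hx' := subset_closure hx
  -- Symmetry of `R1` and `R2` identifies the two coefficients of each coupling, for instance those
  -- of `θ` with `σ̄`; without it the cross terms would not form divergences.
  rw [hS.sum_v_mul_eq_v ht hx, hS.sum_q_mul_eq_q ht hx, hS.sum_σ_mul_eq_σ ht hx,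
    hS.divV_fluxField D ht hx', hS.production_pointState D ht hx',
    MomentCoeffs.bil_symm hD.isSymm_R1 D.r1 D.c1, MomentCoeffs.bil_symm hD.isSymm_R1 D.r1 D.a5,
    MomentCoeffs.bil_symm hD.isSymm_R1 D.a5 D.c1, MomentCoeffs.bil_symm hD.isSymm_R2 D.r2 D.c2,
    MomentCoeffs.bil_symm hD.isSymm_R2 D.r2 D.a4, MomentCoeffs.bil_symm hD.isSymm_R2 D.c2 D.a4]
  have kk : 1 / Kn * Kn = 1 := one_div_mul_cancel hKn.ne'
  have SS : √(15 / 2) * √(15 / 2) = (15 / 2 : ℝ) := Real.mul_self_sqrt (by norm_num)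
  have ss : √(2 / 15) * √(2 / 15) = (2 / 15 : ℝ) := Real.mul_self_sqrt (by norm_num)
  have bb : √15 * √15 = (15 : ℝ) := Real.mul_self_sqrt (by norm_num)
  have aa : √2 * √2 = (2 : ℝ) := Real.mul_self_sqrt (by norm_num)
  have zb : 1 / √15 * √15 = (1 : ℝ) := one_div_mul_cancel (by positivity)
  have zz : 1 / √15 * (1 / √15) = (1 / 15 : ℝ) := by rw [one_div_mul_one_div, bb]
  have Ss : √(15 / 2) * √(2 / 15) = (1 : ℝ) := by
    rw [sqrt_fifteen_halves, sqrt_two_fifteen]; linear_combination √2 * √2 / 30 * bb + aa / 2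
  have Sz : √(15 / 2) * (1 / √15) = √2 / 2 := by
    rw [sqrt_fifteen_halves]; linear_combination √2 / 2 * zb
  have sz : √(2 / 15) * (1 / √15) = √2 / 15 := by
    rw [sqrt_two_fifteen]; linear_combination √2 / 15 * zb
  have sb : √(2 / 15) * √15 = √2 := by
    rw [sqrt_two_fifteen]; linear_combination √2 / 15 * bb
  have eρ := hS.eq_ρ t ht x hx
  have eθ := hS.eq_θ t ht x hx
  simp only [MomentCoeffs.eqCoeffs] at eθ ⊢
  -- Radicals, `1 / Kn` and all contractions become indeterminates. Only the product relations of
  -- the radicals and `1 / Kn * Kn = 1` are needed from here on.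
  generalize 1 / √15 = z at *
  generalize 1 / Kn = k at *
  generalize √(15 / 2) = c at *
  generalize √(2 / 15) = s at *
  generalize √15 = b at *
  generalize √2 = a at *
  generalize (∑ i, S.v t x i * divT (fun y => stf2 (gradV (S.v t) y)) x i) = X3 at *
  generalize (∑ i, S.v t x i * divT (fun y => stf2 (gradV (S.q t) y)) x i) = X4 at *
  generalize (∑ i, S.v t x i * divT (S.σ t) x i) = X5 at *
  generalize (∑ i, S.q t x i * pd i (S.θ t) x) = Y1 at *
  generalize (∑ i, S.q t x i * divT (fun y => stf2 (gradV (S.v t) y)) x i) = Y2 at *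
  generalize (∑ i, S.q t x i * pd i (divV (S.q t)) x) = Y3 at *
  generalize (∑ i, S.q t x i * divT (fun y => stf2 (gradV (S.q t) y)) x i) = Y4 at *
  generalize (∑ i, S.q t x i * divT (S.σ t) x i) = Y5 at *
  generalize (∑ i, ∑ j, S.σ t x i j * hess (S.θ t) x i j) = S1 at *
  generalize (∑ i, ∑ j, S.σ t x i j * gradV (S.v t) x i j) = S2 at *
  generalize (∑ i, ∑ j, S.σ t x i j * gradV (S.q t) x i j) = S3 at *
  generalize (∑ i, ∑ j, S.σ t x i j * divT3 (fun y => stf3 (gradT (S.σ t) y)) x i j) = S4 at *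
  generalize (∑ i, ∑ j, S.σ t x i j * gradV (divT (S.σ t)) x i j) = S5 at *
  generalize (∑ j, (∑ m, D.c1 m * D.uV (pointState Kn S θW vW t x) j m) * pd j (S.θ t) x) = Gc
    at *
  generalize (∑ i, (∑ m, D.a5 m * D.uV (pointState Kn S θW vW t x) i m) * divT (S.σ t) x i) = Ga
    at *
  generalize (∑ i, ∑ j, (∑ m, D.c2 m * D.uT (pointState Kn S θW vW t x) i j m)
    * gradV (S.v t) x i j) = Hc at *
  generalize (∑ i, ∑ j, (∑ m, D.a4 m * D.uT (pointState Kn S θW vW t x) i j m)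
    * gradV (S.q t) x i j) = Ha at *
  generalize (∑ i, ∑ j, ∑ k, D.uTT (pointState Kn S θW vW t x) i j k * gradT (S.σ t) x i j k) = E
    at *
  linear_combination S.ρ t x * eρ + 3 / 2 * S.θ t x * eθ
    + S.θ t x * bil D.c1 D.R1 D.c1 * Kn * laplacian (S.θ t) x * SS
    - S.θ t x * bil D.c1 D.R1 D.a5 * Kn * divV (divT (S.σ t)) x * Sz
    - S.θ t x * bil D.c1 D.R1 D.r1 * divV (S.q t) x * Ss
    + bil D.c2 D.R2 D.c2 * Kn * X3 * bb - bil D.a4 D.R2 D.c2 * Kn * X4 * sb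
    - bil D.c2 D.R2 D.r2 * X5 * zb - bil D.a4 D.R2 D.c2 * Kn * Y2 * sb
    + bil D.a4 D.R2 D.a4 * Kn * Y4 * ss + bil D.a4 D.R2 D.r2 * Y5 * sz
    + D.A46 ^ 2 / D.L0 * Kn * Y3 * ss - bil D.c1 D.R1 D.a5 * Kn * S1 * Sz
    + bil D.a5 D.R1 D.a5 * Kn * S5 * zz + bil D.a5 D.R1 D.r1 * S3 * sz
    + D.A511 ^ 2 / D.L3 * Kn * S4 * zz
    - (bil D.c1 D.R1 D.r1 * Y1 - a / 15 * bil D.a5 D.R1 D.r1 * Y5 - c * Gc + z * Ga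
      + bil D.c2 D.R2 D.r2 * S2 - a / 15 * bil D.a4 D.R2 D.r2 * S3 + b * Hc - s * Ha
      - s * D.A46 * (D.uS (pointState Kn S θW vW t x) * divV (S.q t) x) + z * D.A511 * E) * kk

end IsSolution
end LinearR13

namespace LinearR13

/-! ### Differentiation of the total entropy -/

/-- Joint continuity is not part of the regularity assumption. It holds because the time derivative
is bounded on compact sets, so `u` is Lipschitz in time uniformly in `x`, and it is continuous in
`x` for each time. -/
theorem IsRegular.continuousOn {I : Set ℝ} {Ω : Set E3} {u : ℝ → E3 → ℝ} (hu : IsRegular I Ω u)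
    (hI : IsOpen I) (hΩ : IsCompact (closure Ω)) :
    ContinuousOn (fun p : ℝ × E3 => u p.1 p.2) (I ×ˢ closure Ω) := by
  rintro ⟨t, x⟩ ⟨ht, hx⟩
  obtain ⟨ε, hε, hball⟩ := Metric.nhds_basis_closedBall.mem_iff.1 (hI.mem_nhds ht)
  have hsub : Metric.closedBall t ε ×ˢ closure Ω ⊆ I ×ˢ closure Ω := prod_mono hball subset_rfl
  obtain ⟨C, hC⟩ := ((isCompact_closedBall t ε).prod hΩ).exists_bound_of_continuousOn
    (hu.time_cont.mono hsub)
  have key : ContinuousOn (fun p : ℝ × E3 => u p.1 p.2) (Metric.closedBall t ε ×ˢ closure Ω) := by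
    refine continuousOn_prod_of_continuousOn_lipschitzOnWith _ (Real.toNNReal C)
      (fun s hs y hy => ((hu.space s (hball hs) y hy).continuousAt).continuousWithinAt)
      fun y hy => ?_
    refine Convex.lipschitzOnWith_of_nnnorm_deriv_le (fun s hs => hu.time s (hball hs) y hy)
      (fun s hs => ?_) (convex_closedBall t ε)
    rw [← NNReal.coe_le_coe, coe_nnnorm]
    exact (hC (s, y) ⟨hs, hy⟩).trans (Real.le_coe_toNNReal C)
  have hmem : Metric.closedBall t ε ×ˢ closure Ω ∈ 𝓝[I ×ˢ closure Ω] (t, x) := by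
    rw [nhdsWithin_prod_eq]
    exact Filter.prod_mem_prod (mem_nhdsWithin_of_mem_nhds (Metric.closedBall_mem_nhds t hε))
      self_mem_nhdsWithin
  exact (key (t, x) ⟨Metric.mem_closedBall_self hε.le, hx⟩).mono_of_mem_nhdsWithin hmem

theorem hasDerivAt_setIntegral {I : Set ℝ} {Ω : Set E3} {F F' : ℝ → E3 → ℝ} (hI : IsOpen I)
    (hΩ : IsOpen Ω) (hc : IsCompact (closure Ω))
    (hF : ContinuousOn (fun p : ℝ × E3 => F p.1 p.2) (I ×ˢ closure Ω))
    (hF' : ContinuousOn (fun p : ℝ × E3 => F' p.1 p.2) (I ×ˢ closure Ω))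
    (hd : ∀ t ∈ I, ∀ x ∈ Ω, HasDerivAt (fun s => F s x) (F' t x) t) {t : ℝ} (ht : t ∈ I) :
    IntegrableOn (F' t) Ω ∧ HasDerivAt (fun s => ∫ x in Ω, F s x) (∫ x in Ω, F' t x) t := by
  obtain ⟨ε, hε, hball⟩ := Metric.nhds_basis_closedBall.mem_iff.1 (hI.mem_nhds ht)
  have hsub : Metric.closedBall t ε ×ˢ closure Ω ⊆ I ×ˢ closure Ω := prod_mono hball subset_rfl
  obtain ⟨C, hC⟩ := ((isCompact_closedBall t ε).prod hc).exists_bound_of_continuousOn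
    (hF'.mono hsub)
  have slice : ∀ {G : ℝ → E3 → ℝ},
      ContinuousOn (fun p : ℝ × E3 => G p.1 p.2) (I ×ˢ closure Ω) →
      ∀ s ∈ I, ContinuousOn (G s) (closure Ω) := fun hG s hs =>
    hG.comp (continuous_const.prodMk continuous_id).continuousOn fun x hx => ⟨hs, hx⟩
  have hfin : volume Ω ≠ ⊤ := ((measure_mono subset_closure).trans_lt hc.measure_lt_top).ne
  refine hasDerivAt_integral_of_dominated_loc_of_deriv_le (bound := fun _ => C)
    (Metric.closedBall_mem_nhds t hε) ?_ ?_ ?_ ?_ ?_ ?_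
  · filter_upwards [hI.mem_nhds ht] with s hs
    exact ((slice hF s hs).mono subset_closure).aestronglyMeasurable hΩ.measurableSet
  · exact ((slice hF t ht).integrableOn_compact hc).mono_set subset_closure
  · exact ((slice hF' t ht).mono subset_closure).aestronglyMeasurable hΩ.measurableSet
  · filter_upwards [ae_restrict_mem hΩ.measurableSet] with x hx s hs
    exact hC (s, x) ⟨hs, subset_closure hx⟩
  · exact integrableOn_const hfin
  · filter_upwards [ae_restrict_mem hΩ.measurableSet] with x hx s hs
    exact hd s (hball hs) x hx

/-- The time derivative of the entropy density. -/
noncomputable def entropyRate (S : Fields) (t : ℝ) (x : E3) : ℝ :=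
  -(S.ρ t x * deriv (fun s => S.ρ s x) t + 3 / 2 * (S.θ t x * deriv (fun s => S.θ s x) t)
    + ∑ i, S.v t x i * deriv (fun s => S.v s x i) t
    + 2 / 5 * ∑ i, S.q t x i * deriv (fun s => S.q s x i) t
    + 1 / 2 * ∑ i, ∑ j, S.σ t x i j * deriv (fun s => S.σ s x i j) t)

theorem IsSolution.hasDerivAt_integral_entropy {K : EqCoeffs} {Kn : ℝ} {I : Set ℝ} {Ω : Set E3}
    {S : Fields} (hS : IsSolution K Kn I Ω S) (hI : IsOpen I) (hΩ : IsC1Domain Ω) (H₀ : ℝ) {t : ℝ}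
    (ht : t ∈ I) :
    IntegrableOn (entropyRate S t) Ω ∧
      HasDerivAt (fun s => ∫ x in Ω, entropy H₀ S s x) (∫ x in Ω, entropyRate S t x) t := by
  have hc := hΩ.isCompact_closure
  have cρ := hS.reg_ρ.continuousOn hI hc
  have cθ := hS.reg_θ.continuousOn hI hc
  have cv := fun i => (hS.reg_v i).continuousOn hI hc
  have cq := fun i => (hS.reg_q i).continuousOn hI hc
  have cσ := fun i j => (hS.reg_σ i j).continuousOn hI hc
  have dρ := hS.reg_ρ.time_cont
  have dθ := hS.reg_θ.time_cont
  have dv := fun i => (hS.reg_v i).time_cont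
  have dq := fun i => (hS.reg_q i).time_cont
  have dσ := fun i j => (hS.reg_σ i j).time_cont
  refine hasDerivAt_setIntegral hI hΩ.isOpen hc (F := entropy H₀ S) (F' := entropyRate S) ?_ ?_ ?_ ht
  · simp only [entropy]
    fun_prop
  · simp only [entropyRate]
    fun_prop
  · intro t ht x hx
    have hx' := subset_closure hx
    have eρ := (hS.reg_ρ.time t ht x hx').hasDerivAt
    have eθ := (hS.reg_θ.time t ht x hx').hasDerivAt
    have ev := fun i => ((hS.reg_v i).time t ht x hx').hasDerivAt
    have eq := fun i => ((hS.reg_q i).time t ht x hx').hasDerivAt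
    have eσ := fun i j => ((hS.reg_σ i j).time t ht x hx').hasDerivAt
    have key := (((((eρ.fun_pow 2).fun_add ((eθ.fun_pow 2).const_mul (3 / 2))).fun_add
      (HasDerivAt.fun_sum fun i (_ : i ∈ Finset.univ) => (ev i).fun_pow 2)).fun_add
      ((HasDerivAt.fun_sum fun i (_ : i ∈ Finset.univ) => (eq i).fun_pow 2).const_mul
        (2 / 5))).fun_add ((HasDerivAt.fun_sum fun i (_ : i ∈ Finset.univ) =>
        HasDerivAt.fun_sum fun j (_ : j ∈ Finset.univ) => (eσ i j).fun_pow 2).const_mul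
        (1 / 2))).const_mul (1 / 2) |>.const_sub H₀
    refine key.congr_deriv ?_
    simp only [entropyRate, Fin.sum_univ_three]
    norm_num
    ring

end LinearR13

namespace LinearR13

/-! ### The entropy inequality -/

/-- The algebraic identities can be differentiated inside `Ω` only, since outside the closure `T` is
unrestricted. Continuity of the gradient carries the result to the boundary, where it is used. -/
theorem isStf_of_isStf_on {Ω : Set E3} {T : E3 → Fin 3 → Fin 3 → ℝ} (hΩ : IsOpen Ω)
    (hT : ∀ x ∈ closure Ω, ∀ i j, ContDiffAt ℝ 1 (fun y => T y i j) x)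
    (hs : ∀ x ∈ Ω, IsStf (T x)) {x : E3} (hx : x ∈ closure Ω) (a : Fin 3) :
    IsStf (gradT T x a) := by
  have hcont : ∀ i j, ContinuousOn (fun y => gradT T y a i j) (closure Ω) := fun i j y hy =>
    (((hT y hy i j).fderiv_right (m := 0) (by norm_num)).continuousAt.clm_apply
      continuousAt_const).continuousWithinAt
  constructor
  · intro i j
    have h : EqOn (fun y => gradT T y a i j) (fun y => gradT T y a j i) Ω := fun y hy =>
      pd_congr a <| by filter_upwards [hΩ.mem_nhds hy] with z hz using (hs z hz).1 i j
    exact h.of_subset_closure (hcont i j) (hcont j i) subset_closure subset_rfl hx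
  · have h : EqOn (fun y => ∑ k, gradT T y a k k) (fun _ => 0) Ω := by
      intro y hy
      have h1 : ∑ k, gradT T y a k k = pd a (fun z => ∑ k, T z k k) y := (pd_sum _ _ fun k _ =>
        (hT y (subset_closure hy) k k).differentiableAt one_ne_zero).symm
      have h2 : pd a (fun z => ∑ k, T z k k) y = pd a (fun _ => 0) y :=
        pd_congr a <| by filter_upwards [hΩ.mem_nhds hy] with z hz using (hs z hz).2
      change ∑ k, gradT T y a k k = 0
      rw [h1, h2]
      simp [pd]
    exact h.of_subset_closure (continuousOn_finsetSum _ fun k _ => hcont k k) continuousOn_const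
      subset_closure subset_rfl hx

theorem IsSolution.isAdmissible_pointState {K : EqCoeffs} {Kn : ℝ} {I : Set ℝ} {Ω : Set E3}
    {S : Fields} (hS : IsSolution K Kn I Ω S) (hΩ : IsOpen Ω) (θW : ℝ → E3 → ℝ)
    (vW : ℝ → E3 → Fin 3 → ℝ) {t : ℝ} (ht : t ∈ I) {x : E3} (hx : x ∈ closure Ω) :
    (pointState Kn S θW vW t x).IsAdmissible := by
  refine ⟨hS.stf_σ t ht x hx, fun a => ?_⟩
  have h := isStf_of_isStf_on hΩ
    (fun y hy i j => ((hS.reg_σ i j).space t ht y hy).of_le one_le_two)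
    (fun y hy => hS.stf_σ t ht y (subset_closure hy)) hx a
  refine ⟨fun i j => ?_, ?_⟩
  · simp only [pointState, h.1 i j]
  · simp only [pointState, ← Finset.mul_sum, h.2, mul_zero]

/-- The divergence theorem for a vector field given by its components. -/
theorem IsC1Domain.integral_divV {Ω : Set E3} (hΩ : IsC1Domain Ω) {e : E3 → Fin 3 → E3}
    (he : IsWallFrame Ω e) {w : E3 → Fin 3 → ℝ}
    (hw : ∀ x ∈ closure Ω, ∀ j, ContDiffAt ℝ 1 (fun y => w y j) x) :
    IntegrableOn (divV w) Ω ∧ ContinuousOn (fun x => compV (e x) (w x) 0) (frontier Ω) ∧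
      ∫ x in Ω, divV w x = ∫ x, compV (e x) (w x) 0 ∂surfaceMeasure Ω := by
  have hN := fun x hx => (he x hx).2
  have hNc : ∀ j, ContinuousOn (fun x => e x 0 j) (frontier Ω) := fun j =>
    (EuclideanSpace.proj (𝕜 := ℝ) j).continuous.comp_continuousOn
      (continuousOn_outerNormal hΩ.isOpen hN)
  have hwc : ∀ j, ContinuousOn (fun x => w x j) (frontier Ω) := fun j x hx =>
    (hw x (frontier_subset_closure hx) j).continuousAt.continuousWithinAt
  have hpd : ∀ j, IntegrableOn (fun x => pd j (fun y => w y j) x) Ω := by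
    intro j
    refine IntegrableOn.mono_set (t := closure Ω) ?_ subset_closure
    refine ContinuousOn.integrableOn_compact hΩ.isCompact_closure fun x hx => ?_
    exact (((hw x hx j).fderiv_right (m := 0) (by norm_num)).continuousAt.clm_apply
      continuousAt_const).continuousWithinAt
  refine ⟨integrable_finsetSum _ fun j _ => hpd j,
    continuousOn_finsetSum _ fun j _ => (hwc j).mul (hNc j), ?_⟩
  simp only [divV, compV]
  rw [integral_finsetSum _ fun j _ => hpd j,
    integral_finsetSum _ fun j _ => hΩ.integrable ((hwc j).fun_mul (hNc j))]
  refine Finset.sum_congr rfl fun j _ => ?_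
  have h := hΩ.integral_fderiv hN (EuclideanSpace.single j 1) (fun x hx => hw x hx j)
  simpa [EuclideanSpace.inner_single_right, pd] using h

theorem IsC1Domain.integrable_mul {Ω : Set E3} (hΩ : IsC1Domain Ω) {f g : E3 → ℝ}
    (hf : Integrable f (surfaceMeasure Ω)) (hg : ContinuousOn g (frontier Ω)) :
    Integrable (fun x => f x * g x) (surfaceMeasure Ω) := by
  obtain ⟨C, hC⟩ := hΩ.isCompact_frontier.exists_bound_of_continuousOn hg
  exact hf.mul_bdd (IsC1Domain.aestronglyMeasurable hg) (ae_surfaceMeasure_mem.mono hC)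

/-- The frame vectors `τ₁`, `τ₂` are arbitrary at each point and need not be measurable. Summed over
both, they enter only through the projection orthogonal to `n`, and `n` is continuous. -/
theorem sum_tangential {e : Fin 3 → E3} (he : Orthonormal ℝ e) (u v q : Fin 3 → ℝ)
    (σ : Fin 3 → Fin 3 → ℝ) (hσ : ∀ i j, σ i j = σ j i) (C₄ C₅ C₆ : ℝ) :
    compV e u 1 * (C₄ * compV e v 1 + C₅ * compV e q 1 + C₆ * compT e σ 0 1)
      + compV e u 2 * (C₄ * compV e v 2 + C₅ * compV e q 2 + C₆ * compT e σ 0 2)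
      = ∑ k, u k * (C₄ * v k + C₅ * q k + C₆ * compV e (σ k) 0
        - e 0 k * compV e (fun l => C₄ * v l + C₅ * q l + C₆ * compV e (σ l) 0) 0) := by
  have h := sum_compV_mul_compV he u (fun l => C₄ * v l + C₅ * q l + C₆ * compV e (σ l) 0)
  have h1 : ∀ a, compV e (fun l => C₄ * v l + C₅ * q l + C₆ * compV e (σ l) 0) a
      = C₄ * compV e v a + C₅ * compV e q a + C₆ * compT e σ 0 a := by
    intro a
    rw [compT_swap, compT_eq_compV]
    simp only [compV_add, compV_const_mul, fun i j => hσ j i]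
  have h2 : ∑ k, u k * (C₄ * v k + C₅ * q k + C₆ * compV e (σ k) 0
        - e 0 k * compV e (fun l => C₄ * v l + C₅ * q l + C₆ * compV e (σ l) 0) 0)
      = ∑ k, u k * (C₄ * v k + C₅ * q k + C₆ * compV e (σ k) 0)
        - compV e u 0 * compV e (fun l => C₄ * v l + C₅ * q l + C₆ * compV e (σ l) 0) 0 := by
    simp only [compV, mul_sub, Finset.sum_sub_distrib, ← mul_assoc, ← Finset.sum_mul]
  rw [h2, ← h, Fin.sum_univ_three]
  simp only [h1]
  ring

end LinearR13

/-! ### Integrability of the wall terms -/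

namespace LinearR13

section WallData

variable {K : EqCoeffs} {Kn : ℝ} {I : Set ℝ} {Ω : Set E3} {S : Fields} {e : E3 → Fin 3 → E3}
  {t : ℝ}

theorem IsWallFrame.continuousOn_normal (he : IsWallFrame Ω e) (hΩ : IsOpen Ω) (j : Fin 3) :
    ContinuousOn (fun x => e x 0 j) (frontier Ω) :=
  (EuclideanSpace.proj (𝕜 := ℝ) j).continuous.comp_continuousOn
    (continuousOn_outerNormal hΩ fun x hx => (he x hx).2)

theorem IsRegular.continuousOn_frontier {u : ℝ → E3 → ℝ} (hu : IsRegular I Ω u) (ht : t ∈ I) :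
    ContinuousOn (u t) (frontier Ω) := fun x hx =>
  (hu.space t ht x (frontier_subset_closure hx)).continuousAt.continuousWithinAt

theorem IsC1Domain.integrable_wall_normal (hΩ : IsC1Domain Ω) (he : IsWallFrame Ω e)
    (hS : IsSolution K Kn I Ω S) (ht : t ∈ I) {θW : ℝ → E3 → ℝ}
    (hθW : Integrable (θW t) (surfaceMeasure Ω)) (C₁ C₂ C₃ : ℝ) :
    Integrable (fun x => θW t x * (C₁ * S.θ t x + C₂ * compV (e x) (S.q t x) 0
      + C₃ * compT (e x) (S.σ t x) 0 0)) (surfaceMeasure Ω) := by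
  refine hΩ.integrable_mul hθW ?_
  have hn := he.continuousOn_normal hΩ.isOpen
  have hθ := hS.reg_θ.continuousOn_frontier ht
  have hq := fun i => (hS.reg_q i).continuousOn_frontier ht
  have hσ := fun i j => (hS.reg_σ i j).continuousOn_frontier ht
  simp only [compV, compT]
  fun_prop

theorem IsC1Domain.integrable_wall_tangential (hΩ : IsC1Domain Ω) (he : IsWallFrame Ω e)
    (hS : IsSolution K Kn I Ω S) (ht : t ∈ I) {vW : ℝ → E3 → Fin 3 → ℝ}
    (hvW : ∀ i, Integrable (fun x => vW t x i) (surfaceMeasure Ω)) (C₄ C₅ C₆ : ℝ) :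
    Integrable (fun x => compV (e x) (vW t x) 1 * (C₄ * compV (e x) (S.v t x) 1
        + C₅ * compV (e x) (S.q t x) 1 + C₆ * compT (e x) (S.σ t x) 0 1)
      + compV (e x) (vW t x) 2 * (C₄ * compV (e x) (S.v t x) 2
        + C₅ * compV (e x) (S.q t x) 2 + C₆ * compT (e x) (S.σ t x) 0 2))
      (surfaceMeasure Ω) := by
  have hn := he.continuousOn_normal hΩ.isOpen
  have hv := fun i => (hS.reg_v i).continuousOn_frontier ht
  have hq := fun i => (hS.reg_q i).continuousOn_frontier ht
  have hσ := fun i j => (hS.reg_σ i j).continuousOn_frontier ht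
  have hint : Integrable (fun x => ∑ k, vW t x k * (C₄ * S.v t x k + C₅ * S.q t x k
      + C₆ * compV (e x) (S.σ t x k) 0 - e x 0 k * compV (e x) (fun l => C₄ * S.v t x l
      + C₅ * S.q t x l + C₆ * compV (e x) (S.σ t x l) 0) 0)) (surfaceMeasure Ω) := by
    refine integrable_finsetSum _ fun k _ => hΩ.integrable_mul (hvW k) ?_
    simp only [compV]
    fun_prop
  refine hint.congr (ae_surfaceMeasure_mem.mono fun x hx => ?_)
  exact (sum_tangential (he x hx).1 _ _ _ _
    (hS.stf_σ t ht x (frontier_subset_closure hx)).1 _ _ _).symm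

end WallData

end LinearR13

/-! ### The entropy inequality on the domain -/

theorem mainTheorem3 (K : LinearR13.EqCoeffs) (M : LinearR13.WallCoeffs) (χ : ℝ)
    (hχ₀ : 0 ≤ χ) (hχ₁ : χ ≤ 1) (hKM : LinearR13.IsOnsagerModel K M χ) :
    ∃ C₁ C₂ C₃ C₄ C₅ C₆ : ℝ,
      ∀ (Kn : ℝ), 0 < Kn →
      ∀ (Ω : Set LinearR13.E3), LinearR13.IsC1Domain Ω →
      ∀ (e : LinearR13.E3 → Fin 3 → LinearR13.E3), LinearR13.IsWallFrame Ω e →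
      ∀ (I : Set ℝ), IsOpen I →
      ∀ (S : LinearR13.Fields), LinearR13.IsSolution K Kn I Ω S →
      ∀ (θW : ℝ → LinearR13.E3 → ℝ) (vW : ℝ → LinearR13.E3 → Fin 3 → ℝ),
      (∀ t ∈ I, Integrable (θW t) (LinearR13.surfaceMeasure Ω)) →
      (∀ t ∈ I, ∀ i, Integrable (fun x => vW t x i) (LinearR13.surfaceMeasure Ω)) →
      (∀ t ∈ I, ∀ x ∈ frontier Ω,
        LinearR13.WallBC M χ (LinearR13.wallState Kn S θW vW e t x)) →
      ∀ (H₀ : ℝ), ∀ t ∈ I,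
        DifferentiableAt ℝ (fun s => ∫ x in Ω, LinearR13.entropy H₀ S s x) t ∧
        -deriv (fun s => ∫ x in Ω, LinearR13.entropy H₀ S s x) t ≤
          (∫ x, θW t x * (C₁ * S.θ t x + C₂ * LinearR13.compV (e x) (S.q t x) 0
              + C₃ * LinearR13.compT (e x) (S.σ t x) 0 0) ∂(LinearR13.surfaceMeasure Ω))
          + ∫ x, (LinearR13.compV (e x) (vW t x) 1 *
                (C₄ * LinearR13.compV (e x) (S.v t x) 1 + C₅ * LinearR13.compV (e x) (S.q t x) 1
                  + C₆ * LinearR13.compT (e x) (S.σ t x) 0 1)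
              + LinearR13.compV (e x) (vW t x) 2 *
                (C₄ * LinearR13.compV (e x) (S.v t x) 2 + C₅ * LinearR13.compV (e x) (S.q t x) 2
                  + C₆ * LinearR13.compT (e x) (S.σ t x) 0 2))
              ∂(LinearR13.surfaceMeasure Ω) := by
  obtain ⟨D, hD, rfl, QN, QT, s₇, s₈, hQN, hQT, hs₇, hs₈, hBC⟩ := hKM
  have hχ : 0 ≤ LinearR13.chiT χ := div_nonneg (by linarith) (by linarith)
  obtain ⟨C₁, C₂, C₃, C₄, C₅, C₆, hC⟩ := LinearR13.MomentCoeffs.exists_neg_flux_le hD hQN hQT hs₇ hs₈ hχ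
  refine ⟨C₁, C₂, C₃, C₄, C₅, C₆, ?_⟩
  intro Kn hKn Ω hΩ e he I hI S hS θW vW hθW hvW hwall H₀ t ht
  obtain ⟨hrate, hder⟩ := hS.hasDerivAt_integral_entropy hI hΩ H₀ ht
  refine ⟨hder.differentiableAt, ?_⟩
  obtain ⟨hdiv, hflux, hgauss⟩ := hΩ.integral_divV he
    (w := LinearR13.fluxField D Kn S θW vW t) fun x hx j => hS.contDiffAt_fluxField D ht hx j
  -- The production is dropped here; `Kn` enters only as the positive factor `1 / Kn`.
  have hbulk : ∫ x in Ω, -LinearR13.entropyRate S t x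
      ≤ ∫ x in Ω, -LinearR13.divV (LinearR13.fluxField D Kn S θW vW t) x := by
    refine setIntegral_mono_on hrate.neg hdiv.neg hΩ.isOpen.measurableSet fun x hx => ?_
    have h1 := hS.entropy_balance (θW := θW) (vW := vW) hD hKn ht hx
    have h2 := hD.production_nonpos (LinearR13.pointState Kn S θW vW t x)
    have h3 := mul_nonpos_of_nonneg_of_nonpos (one_div_nonneg.2 hKn.le) h2
    simp only [LinearR13.entropyRate, neg_neg]
    linarith
  rw [hder.deriv, ← integral_neg]
  refine hbulk.trans ?_
  rw [integral_neg, hgauss, ← integral_neg, ← integral_add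
    (hΩ.integrable_wall_normal he hS ht (hθW t ht) C₁ C₂ C₃)
    (hΩ.integrable_wall_tangential he hS ht (hvW t ht) C₄ C₅ C₆)]
  refine integral_mono_ae (hΩ.integrable hflux).neg
    ((hΩ.integrable_wall_normal he hS ht (hθW t ht) C₁ C₂ C₃).add
    (hΩ.integrable_wall_tangential he hS ht (hvW t ht) C₄ C₅ C₆))
    (LinearR13.ae_surfaceMeasure_mem.mono fun x hx => ?_)
  have hx' := frontier_subset_closure hx
  have hadm : (LinearR13.wallState Kn S θW vW e t x).IsAdmissible :=
    (hS.isAdmissible_pointState hΩ.isOpen θW vW ht hx').rotate (he x hx).1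
  have hons := (hBC _ hadm).1 (hwall t ht x hx)
  have hle := hC _ hadm hons
  -- Impermeability removes the pressure part `(ρ + θ) v_n` of the flux, about which the other wall
  -- conditions say nothing.
  have hv : LinearR13.compV (e x) (S.v t x) 0 = 0 := hons.mass
  have hfl : LinearR13.compV (e x) (LinearR13.fluxField D Kn S θW vW t x) 0
      = D.flux (LinearR13.wallState Kn S θW vW e t x) 0 := by
    rw [LinearR13.wallState_eq_rotate, D.flux_rotate _ (he x hx).1]
    change LinearR13.compV (e x) (fun j => (S.ρ t x + S.θ t x) * S.v t x j
      + D.flux (LinearR13.pointState Kn S θW vW t x) j) 0 = _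
    rw [LinearR13.compV_add, LinearR13.compV_const_mul, hv, mul_zero, zero_add]
  change -LinearR13.compV (e x) (LinearR13.fluxField D Kn S θW vW t x) 0 ≤ _
  rw [hfl]
  exact hle
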